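/- Let $G$ be a connected semisimple linear algebraic group over $\mathbb C$ with Lie algebra $\mathfrak g$. Let $\mathfrak h\subset\mathfrak g$ be a Cartan subalgebra (the Lie algebra of a maximal torus), let $\mathfrak u$ be the sum of the root spaces of the positive roots for some base of the root system of $(\mathfrak g,\mathfrak h)$, and let $\mathfrak b=\mathfrak h\oplus\mathfrak u$ be the corresponding Borel subalgebra. Let $n\ge 2$. Let $\mathbf{Conn}_n^B$ be the space of connections $d+\sum_{k\ge -n}A_kz^k\,dz$ on the trivial $G$-bundle on the formal disk, with $A_k\in\mathfrak g$ for all $k$, $A_k\in\mathfrak b$ for $k<0$, and leading coefficient $A_{-n}$ regular semisimple in $\mathfrak g$. Let $G_n^U$ be the group of loops $\exp(u_0+u_1z+\dots+u_{n-1}z^{n-1}+g_nz^n+g_{n+1}z^{n+1}+\dots)$ with $u_i\in\mathfrak u$, $g_i\in\mathfrak g$, acting on $\mathbf{Conn}_n^B$ by gauge transformations $d+A\,dz\mapsto d+(gAg^{-1}-g'g^{-1})\,dz$. The regular functions on the quotient $\mathbf{Conn}_n^B/G_n^U$ are the $G_n^U$-invariant regular functions on $\mathbf{Conn}_n^B$.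 The quotient is a Poisson variety, as an open subset of the hamiltonian reduction at $0$ by $G_n^U$ of the space of all connections on the formal punctured disk. Explicitly, identify covectors on the latter space with elements of $\mathfrak g((z))$ by the pairing $\operatorname{Res}\langle\xi,v\rangle\,dz$, where $\langle\cdot,\cdot\rangle$ is the Killing form of $\mathfrak g$. For regular functions $f_1,f_2$ on the quotient, the value of $\{f_1,f_2\}$ at the class of $d+A\,dz\in\mathbf{Conn}_n^B$ is $$\operatorname{Res}\langle A,[\xi_1,\xi_2]\rangle\,dz+\operatorname{Res}\langle \xi_1',\xi_2\rangle\,dz ,$$ where $\xi_i\in\mathfrak g((z))$ is any covector whose restriction to the tangent space of $\mathbf{Conn}_n^B$ at $d+A\,dz$ is the differential of the pullback of $f_i$. The symplectic leaves are the classes of points that can be joined by finitely many pieces of trajectories of hamiltonian vector fields. Then: 1. Every point of $\mathbf{Conn}_n^B/G_n^U$ has a unique representative in $\mathbf{Conn}_n^B$ of the form $$d+\alpha_n\frac{dz}{z^n}+\dots+\alpha_1\frac{dz}{z}+\beta_0\,dz+\dots+\beta_{n-2}z^{n-2}\,dz,\qquad \alpha_i,\beta_i\in\mathfrak h .$$ 2.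 The bracket $\{f_1,f_2\}$ of any two regular functions on $\mathbf{Conn}_n^B/G_n^U$ exists as a regular function and is uniquely determined by the formula above. 3. The symplectic leaves of $\mathbf{Conn}_n^B/G_n^U$ are exactly the subsets $\{\alpha_1=c\}$, $c\in\mathfrak h$. -/

import Mathlib

open scoped TensorProduct LaurentSeries

attribute [local instance 100] LieRing.ofAssociativeRing

-- The coefficientwise `ℂ`-algebra structure on Laurent series, preferred here over the one that is
-- induced from power series.
attribute [local instance 2000] HahnSeries.instAlgebra

noncomputable section

namespace FormalConn

/-! ## Linear algebraic groups and their Lie algebras -/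

section AlgebraicGroup

variable {N : ℕ}

/-- The value of a polynomial in the matrix entries at an invertible matrix. -/
def evalAt (g : GL (Fin N) ℂ) (p : MvPolynomial (Fin N × Fin N) ℂ) : ℂ :=
  MvPolynomial.eval (fun ij => (g : Matrix (Fin N) (Fin N) ℂ) ij.1 ij.2) p

/-- A polynomial in the matrix entries vanishes on `S`. -/
def VanishesOn (S : Set (GL (Fin N) ℂ)) (p : MvPolynomial (Fin N × Fin N) ℂ) : Prop :=
  ∀ g ∈ S, evalAt g p = 0

/-- `S` is closed in `GL_N(ℂ)` for the Zariski topology. -/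
def IsZariskiClosed (S : Set (GL (Fin N) ℂ)) : Prop :=
  ∀ g, (∀ p, VanishesOn S p → evalAt g p = 0) → g ∈ S

/-- `S` is connected for the Zariski topology (used for closed sets `S`): it is not the disjoint
union of two nonempty closed subsets. -/
def IsZariskiConnected (S : Set (GL (Fin N) ℂ)) : Prop :=
  ∀ Z₁ Z₂ : Set (GL (Fin N) ℂ), IsZariskiClosed Z₁ → IsZariskiClosed Z₂ →
    S = Z₁ ∪ Z₂ → Disjoint Z₁ Z₂ → Z₁ = ∅ ∨ Z₂ = ∅

/-- The left-invariant vector field on matrix space attached to the matrix `A`: the derivation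
`p ↦ d/dt p(g (1 + t A))` at `t = 0`. -/
def leftDeriv (A : Matrix (Fin N) (Fin N) ℂ) :
    Derivation ℂ (MvPolynomial (Fin N × Fin N) ℂ) (MvPolynomial (Fin N × Fin N) ℂ) :=
  MvPolynomial.mkDerivation ℂ
    (fun ij => ∑ k, MvPolynomial.X (ij.1, k) * MvPolynomial.C (A k ij.2))

lemma leftDeriv_X (A : Matrix (Fin N) (Fin N) ℂ) (i j : Fin N) :
    leftDeriv A (MvPolynomial.X (i, j)) =
      ∑ k, MvPolynomial.X (i, k) * MvPolynomial.C (A k j) := by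
  simp [leftDeriv, MvPolynomial.mkDerivation_X]

lemma leftDeriv_add (A B : Matrix (Fin N) (Fin N) ℂ) :
    leftDeriv (A + B) = leftDeriv A + leftDeriv B := by
  apply MvPolynomial.derivation_ext
  rintro ⟨i, j⟩
  simp [leftDeriv_X, mul_add, Finset.sum_add_distrib]

lemma leftDeriv_smul (c : ℂ) (A : Matrix (Fin N) (Fin N) ℂ) :
    leftDeriv (c • A) = c • leftDeriv A := by
  apply MvPolynomial.derivation_ext
  rintro ⟨i, j⟩
  simp only [leftDeriv_X, Derivation.smul_apply, Finset.smul_sum, Matrix.smul_apply, smul_eq_mul,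
    MvPolynomial.C_mul, MvPolynomial.smul_eq_C_mul]
  exact Finset.sum_congr rfl fun k _ => by ring

lemma leftDeriv_comm (A B : Matrix (Fin N) (Fin N) ℂ) :
    leftDeriv (A * B - B * A) = ⁅leftDeriv A, leftDeriv B⁆ := by
  have key : ∀ (A B : Matrix (Fin N) (Fin N) ℂ) (i j : Fin N),
      leftDeriv A (leftDeriv B (MvPolynomial.X (i, j))) =
        ∑ l, MvPolynomial.X (i, l) * MvPolynomial.C ((A * B) l j) := by
    intro A B i j
    simp only [leftDeriv_X, map_sum, Derivation.leibniz, MvPolynomial.derivation_C,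
      smul_eq_mul, Matrix.mul_apply, MvPolynomial.C_mul, Finset.mul_sum]
    simp only [mul_zero, zero_add, Finset.mul_sum]
    rw [Finset.sum_comm]
    exact Finset.sum_congr rfl fun l _ => Finset.sum_congr rfl fun k _ => by ring
  apply MvPolynomial.derivation_ext
  rintro ⟨i, j⟩
  rw [Derivation.commutator_apply, key, key, leftDeriv_X, ← Finset.sum_sub_distrib]
  exact Finset.sum_congr rfl fun l _ => by simp [mul_sub]

/-- The Lie algebra of a closed subgroup `G` of `GL_N(ℂ)`: the matrices whose left-invariant
vector field preserves the ideal of `G`. -/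
def lieAlg (G : Subgroup (GL (Fin N) ℂ)) : LieSubalgebra ℂ (Matrix (Fin N) (Fin N) ℂ) where
  carrier := {A | ∀ p, VanishesOn (G : Set (GL (Fin N) ℂ)) p →
    VanishesOn (G : Set (GL (Fin N) ℂ)) (leftDeriv A p)}
  zero_mem' := by
    intro p _ g _
    have h0 : leftDeriv (0 : Matrix (Fin N) (Fin N) ℂ) = 0 := by
      simpa using leftDeriv_smul (0 : ℂ) (0 : Matrix (Fin N) (Fin N) ℂ)
    simp [h0, evalAt]
  add_mem' := by
    intro A B hA hB p hp g hg
    have h1 : evalAt g (leftDeriv A p) = 0 := hA p hp g hg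
    have h2 : evalAt g (leftDeriv B p) = 0 := hB p hp g hg
    simp only [evalAt] at h1 h2
    simp [leftDeriv_add, evalAt, h1, h2]
  smul_mem' := by
    intro c A hA p hp g hg
    have h1 : evalAt g (leftDeriv A p) = 0 := hA p hp g hg
    simp only [evalAt] at h1
    simp [leftDeriv_smul, evalAt, h1]
  lie_mem' := by
    intro A B hA hB p hp g hg
    have h1 : evalAt g (leftDeriv A (leftDeriv B p)) = 0 := hA _ (hB p hp) g hg
    have h2 : evalAt g (leftDeriv B (leftDeriv A p)) = 0 := hB _ (hA p hp) g hg
    simp only [evalAt] at h1 h2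
    rw [LieRing.of_associative_ring_bracket, leftDeriv_comm, Derivation.commutator_apply]
    simp [evalAt, h1, h2]

end AlgebraicGroup

/-! ## Regular semisimple elements, the nilpotent and the Borel subalgebra -/

section LieAlgebra

variable {𝔤 : Type*} [LieRing 𝔤] [LieAlgebra ℂ 𝔤]

/-- Regular semisimple elements of a semisimple Lie algebra: `ad x` is semisimple and the
centralizer of `x` is a Cartan subalgebra. -/
def IsRegularSemisimple (x : 𝔤) : Prop :=
  (LieAlgebra.ad ℂ 𝔤 x).IsSemisimple ∧
    ∃ K : LieSubalgebra ℂ 𝔤, K.IsCartanSubalgebra ∧ ∀ y, y ∈ K ↔ ⁅x, y⁆ = 0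

variable [FiniteDimensional ℂ 𝔤] [LieAlgebra.IsSemisimple ℂ 𝔤]
  {H : LieSubalgebra ℂ 𝔤} [H.IsCartanSubalgebra]

/-- The maximal nilpotent subalgebra `𝔲`: the sum of the root spaces of the positive roots. -/
def nilpSub (Δ : (LieAlgebra.IsKilling.rootSystem H).Base) : Submodule ℂ 𝔤 :=
  ⨆ (α : H.root) (_ : Δ.IsPos α), (LieAlgebra.rootSpace H α.1).toSubmodule

/-- The Borel subalgebra `𝔟 = 𝔥 ⊕ 𝔲`. -/
def borelSub (Δ : (LieAlgebra.IsKilling.rootSystem H).Base) : Submodule ℂ 𝔤 :=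
  H.toSubmodule ⊔ nilpSub Δ

end LieAlgebra

/-! ## The loop algebra `𝔤((z))` -/

section Loop

instance instIsScalarTowerLaurent : IsScalarTower ℂ ℂ⸨X⸩ ℂ⸨X⸩ :=
  IsScalarTower.right (R := ℂ) (A := ℂ⸨X⸩)

variable (𝔤 : Type*) [LieRing 𝔤] [LieAlgebra ℂ 𝔤]

/-- The loop algebra `𝔤((z)) = ℂ((z)) ⊗ 𝔤` (for finite-dimensional `𝔤`). Its elements `A` also
stand for the connections `d + A dz` on the trivial bundle on the formal punctured disk. -/
abbrev Loop : Type _ := ℂ⸨X⸩ ⊗[ℂ] 𝔤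

variable {𝔤}

/-- The coefficient `A_k ∈ 𝔤` of `z ^ k`. -/
def coeff (k : ℤ) : Loop 𝔤 →ₗ[ℂ] 𝔤 :=
  (TensorProduct.lid ℂ 𝔤).toLinearMap ∘ₗ
    LinearMap.rTensor 𝔤 (HahnSeries.coeff.linearMap (R := ℂ) (V := ℂ) k)

/-- The derivative `d/dz` on the loop algebra. -/
def loopDeriv : Loop 𝔤 →ₗ[ℂ] Loop 𝔤 :=
  LinearMap.rTensor 𝔤 (LaurentSeries.derivative ℂ (V := ℂ))

/-- The residue pairing `Res ⟨ξ, v⟩ dz` on `𝔤((z))`, with `⟨ , ⟩` the Killing form of `𝔤`. It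
identifies the covectors on the space of connections with elements of `𝔤((z))`. -/
def resPairing (ξ v : Loop 𝔤) : ℂ :=
  (LinearMap.BilinForm.baseChange ℂ⸨X⸩ (killingForm ℂ 𝔤) ξ v).coeff (-1)

/-- The Poisson tensor at `d + A dz` of the space of all connections on the formal punctured disk,
embedded as a hyperplane in the dual of the central extension of `𝔤((z))`, evaluated on the
covectors `ξ`, `η`: `⟨A, [ξ, η]⟩ + Res ⟨ξ', η⟩ dz`. -/
def poissonTensor (A ξ η : Loop 𝔤) : ℂ :=
  resPairing A ⁅ξ, η⁆ + resPairing (loopDeriv ξ) η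

variable (𝔤) in
/-- Polynomial functions on `𝔤((z))`: polynomials in finitely many coordinates of finitely many
coefficients. -/
def polyFun : Subalgebra ℂ (Loop 𝔤 → ℂ) :=
  Algebra.adjoin ℂ {φ | ∃ (k : ℤ) (l : Module.Dual ℂ 𝔤), φ = fun A => l (coeff k A)}

variable [FiniteDimensional ℂ 𝔤] [LieAlgebra.IsSemisimple ℂ 𝔤]
  {H : LieSubalgebra ℂ 𝔤} [H.IsCartanSubalgebra]

/-- Loops with a pole of order at most `n` and polar part in `𝔟`. -/
def polarBorel (Δ : (LieAlgebra.IsKilling.rootSystem H).Base) (n : ℕ) :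
    Submodule ℂ (Loop 𝔤) where
  carrier := {A | (∀ k : ℤ, k < -n → coeff k A = 0) ∧ ∀ k : ℤ, k < 0 → coeff k A ∈ borelSub Δ}
  zero_mem' := by simp
  add_mem' := by
    rintro A B ⟨hA, hA'⟩ ⟨hB, hB'⟩
    exact ⟨fun k hk => by simp [hA k hk, hB k hk],
      fun k hk => by simpa using add_mem (hA' k hk) (hB' k hk)⟩
  smul_mem' := by
    rintro c A ⟨hA, hA'⟩
    exact ⟨fun k hk => by simp [hA k hk],
      fun k hk => by simpa using Submodule.smul_mem _ c (hA' k hk)⟩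

/-- `Conn_n^B`: connections `d + A dz` with a pole of order `n`, polar part in `𝔟` and regular
semisimple leading coefficient. -/
def connB (Δ : (LieAlgebra.IsKilling.rootSystem H).Base) (n : ℕ) : Set (Loop 𝔤) :=
  {A | A ∈ polarBorel Δ n ∧ IsRegularSemisimple (coeff (-n) A)}

/-- The Lie algebra of `G_n^U`: loops `u_0 + ⋯ + u_{n-1} z^{n-1} + g_n z^n + ⋯` with `u_i ∈ 𝔲` and
`g_i ∈ 𝔤`. -/
def unipLoops (Δ : (LieAlgebra.IsKilling.rootSystem H).Base) (n : ℕ) : Set (Loop 𝔤) :=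
  {Y | (∀ k : ℤ, k < 0 → coeff k Y = 0) ∧ ∀ k : ℤ, k < n → coeff k Y ∈ nilpSub Δ}

/-- The form `d + α_n dz/z^n + ⋯ + α_1 dz/z + β_0 dz + ⋯ + β_{n-2} z^{n-2} dz` with all
coefficients in `𝔥`, for an element of `Conn_n^B` (so that there is no pole of order above `n`). -/
def IsNormalForm (Δ : (LieAlgebra.IsKilling.rootSystem H).Base) (n : ℕ) (A : connB Δ n) : Prop :=
  (∀ k : ℤ, coeff k A.1 ∈ H) ∧ ∀ k : ℤ, (n : ℤ) - 2 < k → coeff k A.1 = 0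

end Loop

/-! ## Gauge transformations and the quotient `Conn_n^B / G_n^U` -/

section Gauge

variable {N : ℕ}

/-- Termwise derivative of a matrix of Laurent series. -/
def matDeriv (M : Matrix (Fin N) (Fin N) ℂ⸨X⸩) : Matrix (Fin N) (Fin N) ℂ⸨X⸩ :=
  M.map (LaurentSeries.derivative ℂ (V := ℂ))

/-- Gauge transformation: `g ∘ (d + M dz) ∘ g⁻¹ = d + (g M g⁻¹ - g' g⁻¹) dz`. -/
def gauge (g : GL (Fin N) ℂ⸨X⸩) (M : Matrix (Fin N) (Fin N) ℂ⸨X⸩) :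
    Matrix (Fin N) (Fin N) ℂ⸨X⸩ :=
  g.1 * M * g⁻¹.1 - matDeriv g.1 * g⁻¹.1

/-- `E = exp M`, the exponential series being summed coefficientwise. -/
def IsExp (M E : Matrix (Fin N) (Fin N) ℂ⸨X⸩) : Prop :=
  ∀ (i j : Fin N) (m : ℤ),
    HasSum (fun k : ℕ => ((k.factorial : ℂ))⁻¹ * ((M ^ k) i j).coeff m) ((E i j).coeff m)

/-- The matrix of Laurent series given by an element of `𝔤((z))`, for `𝔤 ⊆ 𝔤𝔩_N`. -/
def toMat {𝔤 : LieSubalgebra ℂ (Matrix (Fin N) (Fin N) ℂ)} (A : Loop 𝔤) :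
    Matrix (Fin N) (Fin N) ℂ⸨X⸩ :=
  Matrix.of fun i j => TensorProduct.rid ℂ ℂ⸨X⸩
    (LinearMap.lTensor ℂ⸨X⸩ ((Matrix.entryLinearMap ℂ ℂ i j) ∘ₗ 𝔤.toSubmodule.subtype) A)

lemma derivative_mul (f g : ℂ⸨X⸩) :
    LaurentSeries.derivative ℂ (f * g) =
      LaurentSeries.derivative ℂ f * g + f * LaurentSeries.derivative ℂ g := by
  have euler : ∀ (h : ℂ⸨X⸩) (k : ℤ),
      (HahnSeries.single (1 : ℤ) (1 : ℂ) * LaurentSeries.derivative ℂ h).coeff k =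
        (k : ℂ) * h.coeff k := by
    intro h k
    rw [HahnSeries.coeff_single_mul]
    simp [LaurentSeries.hasseDeriv_coeff]
  have supp : ∀ h : ℂ⸨X⸩,
      (HahnSeries.single (1 : ℤ) (1 : ℂ) * LaurentSeries.derivative ℂ h).support ⊆ h.support := by
    intro h k hk hk'
    exact hk (by rw [euler, hk', mul_zero])
  have hne : HahnSeries.single (1 : ℤ) (1 : ℂ) ≠ 0 := by simp
  apply mul_left_cancel₀ hne
  rw [mul_add, ← mul_assoc, mul_left_comm]
  ext k
  rw [euler, HahnSeries.coeff_add, HahnSeries.coeff_mul_left' f.isPWO_support (supp f),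
    HahnSeries.coeff_mul_right' g.isPWO_support (supp g), HahnSeries.coeff_mul, Finset.mul_sum,
    ← Finset.sum_add_distrib]
  refine Finset.sum_congr rfl fun ij hij => ?_
  rw [euler, euler, ← (Finset.mem_antidiagonal.mp hij).2.2]
  push_cast
  ring

lemma matDeriv_mul (M M' : Matrix (Fin N) (Fin N) ℂ⸨X⸩) :
    matDeriv (M * M') = matDeriv M * M' + M * matDeriv M' := by
  ext1 i j
  simp only [matDeriv, Matrix.map_apply, Matrix.mul_apply, Matrix.add_apply, map_sum,
    derivative_mul, Finset.sum_add_distrib]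

lemma gauge_one (M : Matrix (Fin N) (Fin N) ℂ⸨X⸩) : gauge 1 M = M := by
  have h : matDeriv (1 : Matrix (Fin N) (Fin N) ℂ⸨X⸩) = 0 := by
    have := matDeriv_mul (1 : Matrix (Fin N) (Fin N) ℂ⸨X⸩) 1
    simpa using this
  simp [gauge, h]

lemma gauge_mul (g h : GL (Fin N) ℂ⸨X⸩) (M : Matrix (Fin N) (Fin N) ℂ⸨X⸩) :
    gauge (g * h) M = gauge g (gauge h M) := by
  have hh : h.1 * h⁻¹.1 = 1 := h.mul_inv
  simp only [gauge, mul_inv_rev, Units.val_mul, matDeriv_mul, add_mul, mul_sub, sub_mul]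
  have e : matDeriv g.1 * h.1 * (h⁻¹.1 * g⁻¹.1) = matDeriv g.1 * g⁻¹.1 := by
    rw [mul_assoc, ← mul_assoc h.1, hh, one_mul]
  rw [e]
  simp only [mul_assoc]
  abel

variable (G : Subgroup (GL (Fin N) ℂ)) [LieAlgebra.IsSemisimple ℂ (lieAlg G)]
  {H : LieSubalgebra ℂ (lieAlg G)} [H.IsCartanSubalgebra]

/-- The group `G_n^U` of loops `exp(u_0 + ⋯ + u_{n-1} z^{n-1} + g_n z^n + ⋯)`, `u_i ∈ 𝔲`,
`g_i ∈ 𝔤` (these exponentials form a group, so `closure` adds nothing). -/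
def GU (Δ : (LieAlgebra.IsKilling.rootSystem H).Base) (n : ℕ) : Subgroup (GL (Fin N) ℂ⸨X⸩) :=
  Subgroup.closure {g | ∃ Y ∈ unipLoops Δ n, IsExp (toMat Y) g.1}

/-- Gauge equivalence under `G_n^U` on `Conn_n^B`. -/
def gaugeSetoid (Δ : (LieAlgebra.IsKilling.rootSystem H).Base) (n : ℕ) : Setoid (connB Δ n) where
  r A A' := ∃ g ∈ GU G Δ n, toMat A'.1 = gauge g (toMat A.1)
  iseqv :=
    { refl := fun A => ⟨1, one_mem _, (gauge_one _).symm⟩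
      symm := by
        rintro A A' ⟨g, hg, h⟩
        exact ⟨g⁻¹, inv_mem hg, by rw [h, ← gauge_mul, inv_mul_cancel, gauge_one]⟩
      trans := by
        rintro A A' A'' ⟨g, hg, h⟩ ⟨g', hg', h'⟩
        exact ⟨g' * g, mul_mem hg' hg, by rw [h', h, gauge_mul]⟩ }

/-- The quotient `Conn_n^B / G_n^U`. -/
def ConnQuot (Δ : (LieAlgebra.IsKilling.rootSystem H).Base) (n : ℕ) : Type :=
  Quotient (gaugeSetoid G Δ n)

variable {G}
variable {Δ : (LieAlgebra.IsKilling.rootSystem H).Base} {n : ℕ}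

/-- The class of a connection in `Conn_n^B / G_n^U`. -/
def ConnQuot.mk (A : connB Δ n) : ConnQuot G Δ n :=
  Quotient.mk (gaugeSetoid G Δ n) A

/-! ## The Poisson variety `Conn_n^B / G_n^U` -/

/-- Regular functions on the variety `Conn_n^B / G_n^U`: functions whose pullback to `Conn_n^B`
(a `G_n^U`-invariant function) is regular, i.e. locally a fraction of polynomial functions. -/
def IsRegularFun (f : ConnQuot G Δ n → ℂ) : Prop :=
  ∀ A : connB Δ n, ∃ P ∈ polyFun (lieAlg G), ∃ Q ∈ polyFun (lieAlg G), Q A.1 ≠ 0 ∧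
    ∀ A' : connB Δ n, Q A'.1 ≠ 0 → f (.mk A') = P A'.1 / Q A'.1

open Classical in
/-- The pullback of `f` to `Conn_n^B`, extended by `0` to `𝔤((z))`. -/
def pullback (f : ConnQuot G Δ n → ℂ) (A : Loop (lieAlg G)) : ℂ :=
  if h : A ∈ connB Δ n then f (.mk ⟨A, h⟩) else 0

/-- The covector `ξ ∈ 𝔤((z))` on the space of all connections restricts to the differential at `A`
of the pullback of `f`, that is, `ξ` is the differential at `A` of a lift of `f`. The tangent space
of `Conn_n^B` at `A` is `polarBorel Δ n`. -/
def IsLiftedDifferential (f : ConnQuot G Δ n → ℂ) (A : connB Δ n) (ξ : Loop (lieAlg G)) : Prop :=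
  ∀ v ∈ polarBorel Δ n,
    HasDerivAt (fun t : ℂ => pullback f (A.1 + t • v)) (resPairing ξ v) 0

/-- `k` is the Poisson bracket `{f, g}` on `Conn_n^B / G_n^U`, viewed as (an open subset of) the
hamiltonian reduction at `0` of the space of all connections on the formal punctured disk by
`G_n^U`: the pullback of `k` to `Conn_n^B` is the bracket of lifts of `f` and `g`. -/
def IsPoissonBracket (f g k : ConnQuot G Δ n → ℂ) : Prop :=
  IsRegularFun k ∧ ∀ (A : connB Δ n) (ξ η : Loop (lieAlg G)),
    IsLiftedDifferential f A ξ → IsLiftedDifferential g A η →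
      k (.mk A) = poissonTensor A.1 ξ η

/-- `γ` is a trajectory over the time interval `[0, 1]` of the hamiltonian vector field of `h`: the
derivative of each regular function `f` along `γ` is `{f, h}`. -/
def IsTrajectory (h : ConnQuot G Δ n → ℂ) (γ : ℝ → ConnQuot G Δ n) : Prop :=
  ∀ f, IsRegularFun f → ∃ k, IsPoissonBracket f h k ∧
    ∀ t ∈ Set.Icc (0 : ℝ) 1, HasDerivWithinAt (fun s => f (γ s)) (k (γ t)) (Set.Icc 0 1) t

/-- `q` is reached from `p` along a trajectory of a hamiltonian vector field. -/
def FlowsTo (p q : ConnQuot G Δ n) : Prop :=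
  ∃ h γ, IsRegularFun h ∧ IsTrajectory h γ ∧ γ 0 = p ∧ γ 1 = q

variable (G Δ n) in
/-- The symplectic leaves: the classes of the equivalence relation of being joined by finitely many
pieces of trajectories of hamiltonian vector fields. (The variety being affine, global regular
hamiltonians span the hamiltonian directions at each point.) -/
def symplecticLeaves : Set (Set (ConnQuot G Δ n)) :=
  (Relation.EqvGen.setoid (FlowsTo (G := G) (Δ := Δ) (n := n))).classes

/-- The formal residue `α_1` in the normal form of `p` is `c`. -/
def HasFormalResidue (p : ConnQuot G Δ n) (c : lieAlg G) : Prop :=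
  ∃ A : connB Δ n, IsNormalForm Δ n A ∧ .mk A = p ∧ coeff (-1) A.1 = c

end Gauge

end FormalConn

end

/-! Grade `𝔤` by height, the eigenvalue of `ad rho`, where `rho ∈ H` takes the value 1 on all simple
roots. Let L(a, h) (`Frame.L`) be the space of loops of order at least a whose coefficients at z^k,
k < a + n, have height at least h. These spaces are additive under the bracket. The Lie algebra of
G_n^U is L(0, 1), the tangent space of Conn_n^B is L(-n, 0), and L(0, 1) is the annihilator of L(-n,
0) for the residue pairing. Bracketing with L(0, 1) raises the height until it runs out, and then
the order grows by n; hence all exponential series converge z-adically. An element of `𝔟` is regular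
semisimple exactly when no root vanishes on its `𝔥`-part (`Frame.isRegularSemisimple_iff`).

Normal form. Exponentials of w z^j with w in `𝔲` and j < n clear the polar part of its root
components, order by order and height by height. Each step divides by the value of a root on the
leading coefficient, which never vanishes, so the result depends regularly on the connection
(`exists_polar_reduction`). One exponential of a loop in z^n 𝔤[[z]] then removes the remaining root
components and the `𝔥`-parts of the coefficients beyond z^(n-2) (`Frame.exists_normalForm`).
Conversely, a gauge transformation between connections with polar part in `𝔥` is trivial modulo z^n
and preserves the `𝔥`-parts of the coefficients up to z^(n-2) (`IsGaugeAction.proj_coeff_eq`). So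
the normal form is unique, and its coordinates are the `𝔥`-parts of the polar reduction, hence
regular functions.

Bracket. Two lifts of a differential differ by an element of L(0, 1), and a lift of an invariant
function annihilates the gauge directions [Y, A] - Y' with Y in L(0, 1). Hence the Poisson tensor
does not depend on the lifts; it is gauge equivariant, and local gradients of numerator and
denominator show that it is regular (`existsUnique_isPoissonBracket`).

Leaves. At a normal form, the function ⟨w, coefficient of z^j⟩ has the lift w z^(-1-j)
(`isLiftedDifferential_coeff`). It commutes with the connection, so its hamiltonian direction is its
derivative -(1+j) w z^(-2-j). For j = -1 this is zero, so the residue is a Casimir function; every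
other coefficient is moved freely by the flow of its partner. Only the leading coefficient has to
avoid the root hyperplanes, which is possible because their complement is connected over the complex
numbers. -/

noncomputable section

namespace FormalConn

open LieAlgebra LieAlgebra.IsKilling Module

set_option linter.unusedSectionVars false

/-! ### Weight bases, heights and the height filtration of `𝔤` -/

section Frames

variable {𝔤 : Type*} [LieRing 𝔤] [LieAlgebra ℂ 𝔤] [FiniteDimensional ℂ 𝔤]
  [LieAlgebra.IsSemisimple ℂ 𝔤] {H : LieSubalgebra ℂ 𝔤} [H.IsCartanSubalgebra]

/-- A basis of `𝔤` consisting of weight vectors for the Cartan subalgebra `H`, with the heights of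
the weights; the weights are extended to `𝔤` by zero on the root spaces. -/
structure Frame (Δ : (rootSystem H).Base) where
  b : Basis (Fin (finrank ℂ 𝔤)) ℂ 𝔤
  ht : Fin (finrank ℂ 𝔤) → ℤ
  wt : Fin (finrank ℂ 𝔤) → Dual ℂ 𝔤
  rho : 𝔤
  rho_mem : rho ∈ H
  lie_b : ∀ h ∈ H, ∀ i, ⁅h, b i⁆ = wt i h • b i
  wt_rho : ∀ i, wt i rho = ht i
  mem_H_iff : ∀ x, x ∈ H ↔ ∀ i, ht i ≠ 0 → b.repr x i = 0
  mem_nilp_iff : ∀ x, x ∈ nilpSub Δ ↔ ∀ i, ht i ≤ 0 → b.repr x i = 0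
  wt_b : ∀ i j, ht j ≠ 0 → wt i (b j) = 0

/-- The element of `H` on which all simple roots take the value `1`. -/
lemma exists_height_element (Δ : (rootSystem H).Base) :
    ∃ r : H, ∀ α : H.root, (rootSystem H).root α r = (Δ.height α : ℂ) := by
  classical
  let φ : Dual ℂ (Dual ℂ H) := Δ.toWeightBasis.constr ℂ (fun _ => (1 : ℂ))
  refine ⟨(evalEquiv ℂ H).symm φ, fun α => ?_⟩
  obtain ⟨f, -, -, hf⟩ := Δ.exists_root_eq_sum_int α
  have h1 : (rootSystem H).root α ((evalEquiv ℂ H).symm φ) = φ ((rootSystem H).root α) :=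
    apply_evalEquiv_symm_apply ..
  rw [h1, RootPairing.Base.height_eq_sum hf, hf, map_sum, Int.cast_sum]
  refine Finset.sum_congr rfl fun j hj => ?_
  have : φ ((rootSystem H).root j) = 1 := by
    have := Δ.toWeightBasis.constr_basis ℂ (fun _ => (1 : ℂ)) ⟨j, hj⟩
    rwa [RootPairing.Base.toWeightBasis_apply] at this
  rw [map_zsmul, this]
  simp

/-- `𝔤` is the direct sum of its weight spaces for `H`, so bases of these can be collected. -/
lemma exists_weight_basis : ∃ (b : Basis (Fin (finrank ℂ 𝔤)) ℂ 𝔤)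
    (χ : Fin (finrank ℂ 𝔤) → LieModule.Weight ℂ H 𝔤),
    ∀ i, b i ∈ LieModule.genWeightSpace 𝔤 (χ i) := by
  classical
  have hint : DirectSum.IsInternal
      (fun χ : LieModule.Weight ℂ H 𝔤 => (LieModule.genWeightSpace 𝔤 χ).toSubmodule) := by
    rw [DirectSum.isInternal_submodule_iff_iSupIndep_and_iSup_eq_top]
    refine ⟨LieSubmodule.iSupIndep_toSubmodule.mpr
      (LieModule.iSupIndep_genWeightSpace' ℂ H 𝔤), ?_⟩
    rw [← LieSubmodule.iSup_toSubmodule, LieModule.iSup_genWeightSpace_eq_top' ℂ H 𝔤]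
    rfl
  let b₀ := hint.collectedBasis (fun χ => Module.finBasis ℂ (LieModule.genWeightSpace 𝔤 χ))
  let e := Fintype.equivFinOfCardEq (Module.finrank_eq_card_basis b₀).symm
  refine ⟨b₀.reindex e, fun i => (e.symm i).1, fun i => ?_⟩
  have := hint.collectedBasis_mem
    (fun χ => Module.finBasis ℂ (LieModule.genWeightSpace 𝔤 χ)) (e.symm i)
  rwa [Basis.reindex_apply]

/-- All conditions can be read off from the eigenvalues of `ad r`. No root has height 0, so `H` is
the zero eigenspace, and the positive roots are those of positive height. -/
theorem exists_frame (Δ : (rootSystem H).Base) : Nonempty (Frame Δ) := by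
  classical
  obtain ⟨r, hr⟩ := exists_height_element Δ
  obtain ⟨b, χ, hb⟩ := exists_weight_basis (H := H)
  have hht0 : ∀ i, ∃ h : ℤ, χ i r = h ∧ ((χ i).IsZero ∨ ∃ α : H.root, α.1 = χ i ∧
      h = Δ.height α) := by
    intro i
    by_cases h : (χ i).IsZero
    · refine ⟨0, ?_, Or.inl h⟩
      rw [LieModule.Weight.IsZero] at h
      rw [h]; simp
    · exact ⟨Δ.height ⟨χ i, by simpa using h⟩, hr ⟨χ i, by simpa using h⟩,
        Or.inr ⟨⟨χ i, by simpa using h⟩, rfl, rfl⟩⟩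
  choose ht hht hroot using hht0
  have hbr : ∀ x i, b.repr ⁅(r : 𝔤), x⁆ i = ht i * b.repr x i := by
    intro x i
    conv_lhs => rw [← b.sum_repr x]
    have : ∀ j, ⁅(r : 𝔤), b j⁆ = (ht j : ℂ) • b j := fun j => by
      rw [← hht j]
      exact lie_eq_smul_of_mem_rootSpace (hb j) r
    simp only [lie_sum, lie_smul, this, map_sum, map_smul, Finsupp.coe_finsetSum,
      Finset.sum_apply, Finsupp.smul_apply, Basis.repr_self, smul_eq_mul]
    rw [Finset.sum_eq_single i (fun j _ hj => by simp [hj]) (by simp)]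
    simp [mul_comm]
  have hH : ∀ x, x ∈ H ↔ ∀ i, ht i ≠ 0 → b.repr x i = 0 := by
    intro x
    constructor
    · intro hx i hi
      have h0 : ⁅(r : 𝔤), x⁆ = 0 := by
        have : ⁅r, (⟨x, hx⟩ : H)⁆ = 0 := trivial_lie_zero H H r ⟨x, hx⟩
        simpa using congrArg (Subtype.val) this
      have := hbr x i
      rw [h0] at this
      simpa [hi] using this
    · intro hx
      rw [← b.sum_repr x]
      refine sum_mem fun i _ => ?_
      by_cases hi : ht i = 0
      · refine H.smul_mem _ ?_
        have hz : (χ i).IsZero := by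
          refine (hroot i).resolve_right ?_
          rintro ⟨α, -, h⟩
          exact Δ.height_ne_zero α (h ▸ hi)
        have h1 := hb i
        rw [hz] at h1
        have h2 := LieAlgebra.rootSpace_zero_eq ℂ 𝔤 H
        have h3 : b i ∈ LieAlgebra.rootSpace H (0 : H → ℂ) := h1
        rw [h2] at h3
        exact h3
      · rw [hx i hi, zero_smul]; exact H.zero_mem
  -- Composition with this projection extends the weights from `H` to all of `𝔤`.
  let π : 𝔤 →ₗ[ℂ] 𝔤 := b.constr ℂ (fun i => if ht i = 0 then b i else 0)
  have hπ : ∀ x, π x ∈ H := by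
    intro x
    rw [← b.sum_repr x, map_sum]
    refine sum_mem fun i _ => ?_
    rw [map_smul, b.constr_basis]
    split_ifs with h
    · refine H.smul_mem _ ((hH _).mpr fun j hj => ?_)
      have : i ≠ j := by rintro rfl; exact hj h
      simp [this]
    · simp
  have hπ' : ∀ x ∈ H, π x = x := by
    intro x hx
    conv_lhs => rw [← b.sum_repr x, map_sum]
    conv_rhs => rw [← b.sum_repr x]
    refine Finset.sum_congr rfl fun i _ => ?_
    rw [map_smul, b.constr_basis]
    split_ifs with h
    · rfl
    · rw [(hH x).mp hx i h]; simp
  let πH : 𝔤 →ₗ[ℂ] H := π.codRestrict H.toSubmodule hπ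
  have hπH : ∀ (x) (hx : x ∈ H), πH x = ⟨x, hx⟩ := fun x hx => Subtype.ext (hπ' x hx)
  refine ⟨⟨b, ht, fun i => (χ i).toLinear ∘ₗ πH, r, r.2, ?_, ?_, hH, ?_, ?_⟩⟩
  · intro h hh i
    rw [LinearMap.comp_apply, hπH h hh]
    exact lie_eq_smul_of_mem_rootSpace (hb i) ⟨h, hh⟩
  · intro i
    rw [LinearMap.comp_apply, hπH r r.2]
    exact hht i
  · intro x
    constructor
    · intro hx i hi
      -- A coordinate of height at most 0 vanishes on every positive root space, because `ad r` acts
      -- there with a different eigenvalue.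
      let W : Submodule ℂ 𝔤 := LinearMap.ker (b.coord i)
      have : nilpSub Δ ≤ W := by
        refine iSup_le fun α => iSup_le fun hα y hy => ?_
        have h1 : ⁅(r : 𝔤), y⁆ = (Δ.height α : ℂ) • y := by
          rw [← hr α]
          exact lie_eq_smul_of_mem_rootSpace hy r
        have h2 := hbr y i
        rw [h1, map_smul] at h2
        have h3 : ((Δ.height α - ht i : ℤ) : ℂ) ≠ 0 := by
          have : 0 < Δ.height α := hα
          exact_mod_cast (by omega : Δ.height α - ht i ≠ 0)
        have h4 : ((Δ.height α - ht i : ℤ) : ℂ) * b.repr y i = 0 := by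
          push_cast
          rw [sub_mul, sub_eq_zero]
          simpa using h2
        exact (mul_eq_zero.mp h4).resolve_left h3
      simpa [W] using this hx
    · intro hx
      rw [← b.sum_repr x]
      refine sum_mem fun i _ => ?_
      by_cases hi : ht i ≤ 0
      · rw [hx i hi, zero_smul]; exact zero_mem _
      · refine Submodule.smul_mem _ _ ?_
        have hne : ¬ (χ i).IsZero := by
          intro h
          have h0 := hht i
          rw [LieModule.Weight.IsZero] at h
          rw [h] at h0
          have : ht i = 0 := by
            rw [Pi.zero_apply] at h0
            exact_mod_cast h0.symm
          omega
        obtain ⟨α, h1, h2⟩ := (hroot i).resolve_left hne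
        have hpos : Δ.IsPos α := show 0 < Δ.height α by omega
        refine Submodule.mem_iSup_of_mem α (Submodule.mem_iSup_of_mem hpos ?_)
        rw [h1]
        exact hb i
  · intro i j hj
    have : πH (b j) = 0 := Subtype.ext
      ((b.constr_basis ℂ _ j).trans (if_neg hj))
    rw [LinearMap.comp_apply, this, map_zero]


namespace Frame

variable {Δ : (rootSystem H).Base} (F : Frame Δ)

lemma repr_lie_of_mem {h : 𝔤} (hh : h ∈ H) (x : 𝔤) (i) :
    F.b.repr ⁅h, x⁆ i = F.wt i h * F.b.repr x i := by
  conv_lhs => rw [← F.b.sum_repr x]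
  simp only [lie_sum, lie_smul, F.lie_b h hh, map_sum, map_smul, Finsupp.coe_finsetSum,
    Finset.sum_apply, Finsupp.smul_apply, Basis.repr_self, smul_eq_mul]
  rw [Finset.sum_eq_single i (fun j _ hj => by simp [hj]) (by simp)]
  simp [mul_comm]

lemma repr_rho_lie (x : 𝔤) (i) : F.b.repr ⁅F.rho, x⁆ i = F.ht i * F.b.repr x i := by
  rw [F.repr_lie_of_mem F.rho_mem, F.wt_rho]

/-- The span of the weight vectors of height at least `h`. -/
def V (h : ℤ) : Submodule ℂ 𝔤 where
  carrier := {x | ∀ i, F.ht i < h → F.b.repr x i = 0}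
  zero_mem' := by simp
  add_mem' := by
    intro x y hx hy i hi
    simp [hx i hi, hy i hi]
  smul_mem' := by
    intro c x hx i hi
    simp [hx i hi]

lemma mem_V {h : ℤ} {x : 𝔤} : x ∈ F.V h ↔ ∀ i, F.ht i < h → F.b.repr x i = 0 := Iff.rfl

lemma V_anti {h h' : ℤ} (hh : h ≤ h') : F.V h' ≤ F.V h :=
  fun _ hx i hi => hx i (hi.trans_le hh)

lemma b_mem_V {h : ℤ} {i} (hi : h ≤ F.ht i) : F.b i ∈ F.V h := by
  intro j hj
  have : i ≠ j := by rintro rfl; omega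
  simp [this]

lemma nilpSub_eq : nilpSub Δ = F.V 1 := by
  ext x
  rw [F.mem_nilp_iff, mem_V]
  exact forall_congr' fun i => imp_congr_left (by omega)

lemma H_le_V {h : ℤ} (hh : h ≤ 0) {x : 𝔤} (hx : x ∈ H) : x ∈ F.V h :=
  fun i hi => (F.mem_H_iff x).mp hx i (by omega)

/-- The projection to `H` along the root spaces. -/
def proj : 𝔤 →ₗ[ℂ] 𝔤 := F.b.constr ℂ (fun i => if F.ht i = 0 then F.b i else 0)

lemma repr_proj (x : 𝔤) (i) : F.b.repr (F.proj x) i = if F.ht i = 0 then F.b.repr x i else 0 := by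
  conv_lhs => rw [← F.b.sum_repr x, map_sum]
  simp only [map_smul, proj, F.b.constr_basis, map_sum, Finsupp.coe_finsetSum, Finset.sum_apply,
    Finsupp.smul_apply, smul_eq_mul]
  rw [Finset.sum_eq_single i ?_ (by simp)]
  · split_ifs <;> simp
  · intro j _ hj
    split_ifs <;> simp [hj]

lemma proj_mem (x : 𝔤) : F.proj x ∈ H :=
  (F.mem_H_iff _).mpr fun i hi => by rw [repr_proj, if_neg hi]

lemma proj_of_mem {x : 𝔤} (hx : x ∈ H) : F.proj x = x := by
  apply F.b.ext_elem
  intro i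
  rw [repr_proj]
  split_ifs with h
  · rfl
  · exact ((F.mem_H_iff x).mp hx i h).symm

lemma proj_eq_zero {x : 𝔤} (hx : ∀ i, F.ht i = 0 → F.b.repr x i = 0) : F.proj x = 0 := by
  apply F.b.ext_elem
  intro i
  rw [repr_proj]
  split_ifs with h
  · simp [hx i h]
  · simp

lemma proj_of_mem_V {x : 𝔤} (hx : x ∈ F.V 1) : F.proj x = 0 :=
  F.proj_eq_zero fun i hi => hx i (by omega)

lemma sub_proj_mem_V {x : 𝔤} (hx : x ∈ F.V 0) : x - F.proj x ∈ F.V 1 := by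
  intro i hi
  rw [map_sub, Finsupp.sub_apply, repr_proj]
  split_ifs with h
  · simp
  · simp [hx i (by omega)]

lemma borelSub_eq : borelSub Δ = F.V 0 := by
  rw [borelSub, F.nilpSub_eq]
  apply le_antisymm
  · exact sup_le (fun x hx => F.H_le_V le_rfl hx) (F.V_anti (by norm_num))
  · intro x hx
    rw [← add_sub_cancel (F.proj x) x]
    exact add_mem (Submodule.mem_sup_left (F.proj_mem x))
      (Submodule.mem_sup_right (F.sub_proj_mem_V hx))

lemma eq_zero_of_mem_of_mem_V {x : 𝔤} (hx : x ∈ H) (hx' : x ∈ F.V 1) : x = 0 := by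
  rw [← F.proj_of_mem hx, F.proj_of_mem_V hx']

lemma wt_proj (i) (x : 𝔤) : F.wt i (F.proj x) = F.wt i x := by
  conv_rhs => rw [← F.b.sum_repr x]
  conv_lhs => rw [← F.b.sum_repr x]
  simp only [map_sum, map_smul]
  refine Finset.sum_congr rfl fun j _ => ?_
  rw [proj, F.b.constr_basis]
  split_ifs with h
  · rfl
  · rw [F.wt_b i j h, map_zero]

lemma wt_of_mem_V (i) {x : 𝔤} (hx : x ∈ F.V 1) : F.wt i x = 0 := by
  rw [← F.wt_proj, F.proj_of_mem_V hx, map_zero]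

lemma lie_eq_zero_of_mem {x y : 𝔤} (hx : x ∈ H) (hy : y ∈ H) : ⁅x, y⁆ = 0 := by
  have : ⁅(⟨x, hx⟩ : H), (⟨y, hy⟩ : H)⁆ = 0 := trivial_lie_zero H H _ _
  simpa using congrArg (Subtype.val) this

lemma b_mem_H {i} (hi : F.ht i = 0) : F.b i ∈ H :=
  (F.mem_H_iff _).mpr fun j hj => by
    have : i ≠ j := by rintro rfl; exact hj hi
    simp [this]

/-- `b i` lies in `H`, which is abelian. -/
lemma wt_of_ht_eq_zero {i} (hi : F.ht i = 0) (x : 𝔤) : F.wt i x = 0 := by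
  rw [← F.wt_proj]
  have h1 := F.lie_b _ (F.proj_mem x) i
  rw [lie_eq_zero_of_mem (F.proj_mem x) (F.b_mem_H hi)] at h1
  exact (smul_eq_zero.mp h1.symm).resolve_right (F.b.ne_zero i)

/-- By the Jacobi identity the bracket is an eigenvector of `ad rho` for the sum of the two heights.
-/
lemma repr_lie_b_ne {i j k} (h : F.b.repr ⁅F.b i, F.b j⁆ k ≠ 0) : F.ht k = F.ht i + F.ht j := by
  have h1 : ⁅F.rho, ⁅F.b i, F.b j⁆⁆ = ((F.ht i + F.ht j : ℤ) : ℂ) • ⁅F.b i, F.b j⁆ := by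
    rw [leibniz_lie, F.lie_b _ F.rho_mem, F.lie_b _ F.rho_mem, F.wt_rho, F.wt_rho, smul_lie,
      lie_smul, ← add_smul]
    push_cast; rfl
  have h2 := F.repr_rho_lie ⁅F.b i, F.b j⁆ k
  rw [h1, map_smul, Finsupp.smul_apply, smul_eq_mul] at h2
  exact_mod_cast (mul_right_cancel₀ h h2).symm

lemma lie_mem_V {h h' : ℤ} {x y : 𝔤} (hx : x ∈ F.V h) (hy : y ∈ F.V h') :
    ⁅x, y⁆ ∈ F.V (h + h') := by
  intro k hk
  rw [← F.b.sum_repr x, ← F.b.sum_repr y]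
  simp only [sum_lie, lie_sum, smul_lie, lie_smul, map_sum, map_smul, Finsupp.coe_finsetSum,
    Finset.sum_apply, Finsupp.smul_apply, smul_eq_mul]
  refine Finset.sum_eq_zero fun j _ => ?_
  simp only [Finset.mul_sum]
  refine Finset.sum_eq_zero fun i _ => ?_
  by_cases hi : F.ht i < h
  · simp [hx i hi]
  by_cases hj : F.ht j < h'
  · simp [hy j hj]
  by_cases h0 : F.b.repr ⁅F.b i, F.b j⁆ k = 0
  · simp [h0]
  · have := F.repr_lie_b_ne h0
    omega

/-- A bound for the absolute values of the heights. -/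
def m : ℕ := ∑ i, (F.ht i).natAbs

lemma ht_le (i) : -(F.m : ℤ) ≤ F.ht i ∧ F.ht i ≤ F.m := by
  have : (F.ht i).natAbs ≤ F.m :=
    Finset.single_le_sum (f := fun i => (F.ht i).natAbs) (fun _ _ => Nat.zero_le _)
      (Finset.mem_univ i)
  omega

lemma mem_V_of_le {h : ℤ} (hh : h ≤ -F.m) (x : 𝔤) : x ∈ F.V h := by
  intro i hi
  have := F.ht_le i
  omega

lemma eq_zero_of_mem_V {h : ℤ} (hh : F.m < h) {x : 𝔤} (hx : x ∈ F.V h) : x = 0 := by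
  apply F.b.ext_elem
  intro i
  rw [hx i (by have := F.ht_le i; omega)]
  simp

/-- Invariance of the Killing form under `ad rho`: the sum of the heights annihilates the pairing.
-/
lemma killing_b {i j} (h : F.ht i + F.ht j ≠ 0) : killingForm ℂ 𝔤 (F.b i) (F.b j) = 0 := by
  have h1 : killingForm ℂ 𝔤 ⁅F.b i, F.rho⁆ (F.b j) = killingForm ℂ 𝔤 (F.b i) ⁅F.rho, F.b j⁆ :=
    LieModule.traceForm_apply_lie_apply ℂ 𝔤 𝔤 _ _ _
  rw [← lie_skew, F.lie_b _ F.rho_mem, F.lie_b _ F.rho_mem, F.wt_rho, F.wt_rho] at h1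
  simp only [map_neg, map_smul, LinearMap.neg_apply, LinearMap.smul_apply, smul_eq_mul] at h1
  have h2 : ((F.ht i + F.ht j : ℤ) : ℂ) ≠ 0 := by exact_mod_cast h
  have h3 : ((F.ht i + F.ht j : ℤ) : ℂ) * killingForm ℂ 𝔤 (F.b i) (F.b j) = 0 := by
    push_cast
    linear_combination -h1
  exact (mul_eq_zero.mp h3).resolve_left h2

lemma killing_eq_zero {h h' : ℤ} (hh : 0 < h + h') {x y : 𝔤} (hx : x ∈ F.V h) (hy : y ∈ F.V h') :
    killingForm ℂ 𝔤 x y = 0 := by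
  rw [← F.b.sum_repr x, ← F.b.sum_repr y]
  simp only [map_sum, LinearMap.sum_apply, map_smul, LinearMap.smul_apply, smul_eq_mul]
  refine Finset.sum_eq_zero fun j _ => ?_
  simp only [Finset.mul_sum]
  refine Finset.sum_eq_zero fun i _ => ?_
  by_cases hi : F.ht i < h
  · simp [hx i hi]
  by_cases hj : F.ht j < h'
  · simp [hy j hj]
  rw [F.killing_b (by omega)]
  simp

lemma killing_proj {x y : 𝔤} (hx : x ∈ H) : killingForm ℂ 𝔤 x (F.proj y) = killingForm ℂ 𝔤 x y := by
  have hx' := (F.mem_H_iff x).mp hx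
  rw [← F.b.sum_repr x, ← F.b.sum_repr y]
  simp only [map_sum, LinearMap.sum_apply, map_smul, LinearMap.smul_apply, smul_eq_mul]
  refine Finset.sum_congr rfl fun j _ => ?_
  congr 1
  refine Finset.sum_congr rfl fun i _ => ?_
  by_cases hi : F.ht i = 0
  · rw [proj, F.b.constr_basis]
    split_ifs with hj
    · rfl
    · rw [F.killing_b (by omega)]; simp
  · simp [hx' i hi]

/-- The part `p` of `x` below height `h` pairs nontrivially only with basis vectors of height at
least `1 - h`. There it pairs as `x` does, that is, to zero; nondegeneracy gives `p = 0`. -/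
lemma mem_V_of_killing {h : ℤ} {x : 𝔤} (hx : ∀ y ∈ F.V (1 - h), killingForm ℂ 𝔤 x y = 0) :
    x ∈ F.V h := by
  intro i hi
  let p : 𝔤 := ∑ j, if F.ht j < h then F.b.repr x j • F.b j else 0
  have hp : p = 0 := by
    have hnd := LieAlgebra.IsKilling.killingForm_nondegenerate (R := ℂ) (L := 𝔤)
    refine hnd.1 p fun y => ?_
    rw [← F.b.sum_repr y, map_sum]
    refine Finset.sum_eq_zero fun k _ => ?_
    rw [map_smul]
    by_cases hk : 1 - h ≤ F.ht k
    · have h1 := hx _ (F.b_mem_V hk)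
      have h2 : killingForm ℂ 𝔤 p (F.b k) = killingForm ℂ 𝔤 x (F.b k) := by
        conv_rhs => rw [← F.b.sum_repr x]
        simp only [p, map_sum, LinearMap.sum_apply]
        refine Finset.sum_congr rfl fun j _ => ?_
        split_ifs with hj
        · rfl
        · rw [map_smul, LinearMap.smul_apply, F.killing_b (by omega)]; simp
      rw [h2, h1, smul_zero]
    · have h2 : killingForm ℂ 𝔤 p (F.b k) = 0 := by
        simp only [p, map_sum, LinearMap.sum_apply]
        refine Finset.sum_eq_zero fun j _ => ?_
        split_ifs with hj
        · rw [map_smul, LinearMap.smul_apply, F.killing_b (by omega)]; simp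
        · simp
      rw [h2, smul_zero]
  have h3 : F.b.repr p i = F.b.repr x i := by
    simp only [p, map_sum, Finsupp.coe_finsetSum, Finset.sum_apply]
    rw [Finset.sum_eq_single i (fun j _ hj => by split_ifs <;> simp [hj]) (by simp)]
    simp [hi]
  rw [← h3, hp]; simp

end Frame

end Frames

/-! ### Coefficients of loops, the bracket and the residue pairing -/

section LoopCoefficients

/-- Lower bounds for the orders replace the support-dependent antidiagonal by an interval that is
the same for all series with these bounds. -/
lemma laurent_coeff_mul {a b : ℤ} {f g : ℂ⸨X⸩} (hf : ∀ k < a, f.coeff k = 0)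
    (hg : ∀ k < b, g.coeff k = 0) (m : ℤ) :
    (f * g).coeff m = ∑ i ∈ Finset.Icc a (m - b), f.coeff i * g.coeff (m - i) := by
  rw [HahnSeries.coeff_mul]
  refine Finset.sum_of_injOn (fun p => p.1) ?_ ?_ ?_ ?_
  · rintro ⟨p, q⟩ hp ⟨p', q'⟩ hp' h
    simp only [Finset.mem_coe, Finset.mem_antidiagonal] at hp hp' h
    obtain rfl : p = p' := h
    have h1 : p + q = m := hp.2.2
    have h2 : p + q' = m := hp'.2.2
    rw [Prod.mk.injEq]
    exact ⟨rfl, by omega⟩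
  · rintro ⟨p, q⟩ hp
    simp only [Finset.mem_coe, Finset.mem_antidiagonal] at hp
    obtain ⟨h1, h2, h3⟩ := hp
    simp only [Finset.coe_Icc, Set.mem_Icc]
    constructor
    · by_contra h; exact h1 (hf p (by omega))
    · by_contra h; exact h2 (hg q (by omega))
  · intro i _ hi
    by_contra h
    apply hi
    refine ⟨(i, m - i), ?_, rfl⟩
    simp only [Finset.mem_coe, Finset.mem_antidiagonal]
    refine ⟨left_ne_zero_of_mul h, right_ne_zero_of_mul h, by ring⟩
  · rintro ⟨p, q⟩ hp
    simp only [Finset.mem_antidiagonal] at hp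
    have : m - p = q := by have := hp.2.2; omega
    simp [this]

variable {𝔤 : Type*} [LieRing 𝔤] [LieAlgebra ℂ 𝔤]

@[simp] lemma loop_add_lie (A B C : Loop 𝔤) : ⁅A + B, C⁆ = ⁅A, C⁆ + ⁅B, C⁆ := add_lie A B C
@[simp] lemma loop_lie_add (A B C : Loop 𝔤) : ⁅A, B + C⁆ = ⁅A, B⁆ + ⁅A, C⁆ := lie_add A B C
@[simp] lemma loop_sub_lie (A B C : Loop 𝔤) : ⁅A - B, C⁆ = ⁅A, C⁆ - ⁅B, C⁆ := sub_lie A B C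
@[simp] lemma loop_lie_sub (A B C : Loop 𝔤) : ⁅A, B - C⁆ = ⁅A, B⁆ - ⁅A, C⁆ := lie_sub A B C
@[simp] lemma loop_smul_lie (c : ℂ) (A B : Loop 𝔤) : ⁅c • A, B⁆ = c • ⁅A, B⁆ := smul_lie c A B
@[simp] lemma loop_lie_smul (c : ℂ) (A B : Loop 𝔤) : ⁅A, c • B⁆ = c • ⁅A, B⁆ := lie_smul c A B
lemma loop_smul_sub (c : ℂ) (A B : Loop 𝔤) : c • (A - B) = c • A - c • B := smul_sub c A B

@[simp] lemma loop_sub_zero (A : Loop 𝔤) : A - 0 = A := sub_zero A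

@[simp] lemma loop_zero_lie (A : Loop 𝔤) : ⁅(0 : Loop 𝔤), A⁆ = 0 := by
  have := loop_smul_lie 0 0 A
  rwa [zero_smul, zero_smul] at this
@[simp] lemma loop_lie_zero (A : Loop 𝔤) : ⁅A, (0 : Loop 𝔤)⁆ = 0 := by
  have := loop_lie_smul 0 A 0
  rwa [zero_smul, zero_smul] at this
lemma loop_lie_skew (A B : Loop 𝔤) : -⁅B, A⁆ = ⁅A, B⁆ := lie_skew A B

@[simp] lemma coeff_tmul (k : ℤ) (f : ℂ⸨X⸩) (x : 𝔤) : coeff k (f ⊗ₜ[ℂ] x) = f.coeff k • x := by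
  simp [coeff]

instance : AddSubgroupClass (Submodule ℂ (Loop 𝔤)) (Loop 𝔤) where
  neg_mem := by
    intro S x hx
    rw [← neg_one_smul ℂ x]
    exact S.smul_mem _ hx

@[simp] lemma coeff_neg (k : ℤ) (A : Loop 𝔤) : coeff k (-A) = -coeff k A := (coeff k).map_neg A
@[simp] lemma coeff_sub (k : ℤ) (A B : Loop 𝔤) : coeff k (A - B) = coeff k A - coeff k B :=
  (coeff k).map_sub A B

/-- The monomial `x z ^ k`. -/
def mono (k : ℤ) : 𝔤 →ₗ[ℂ] Loop 𝔤 := TensorProduct.mk ℂ ℂ⸨X⸩ 𝔤 (HahnSeries.single k 1)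

lemma mono_apply (k : ℤ) (x : 𝔤) : mono k x = HahnSeries.single k (1 : ℂ) ⊗ₜ[ℂ] x := rfl

lemma coeff_mono (j k : ℤ) (x : 𝔤) : coeff j (mono k x) = if j = k then x else 0 := by
  rw [mono_apply, coeff_tmul, HahnSeries.coeff_single]
  split_ifs <;> simp

lemma coeff_loopDeriv (k : ℤ) (A : Loop 𝔤) :
    coeff k (loopDeriv A) = ((k : ℂ) + 1) • coeff (k + 1) A := by
  induction A using TensorProduct.induction_on with
  | zero => simp
  | tmul f x =>
    rw [loopDeriv, LinearMap.rTensor_tmul, coeff_tmul, coeff_tmul, smul_smul]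
    simp [LaurentSeries.hasseDeriv_coeff]
  | add A B hA hB => simp only [map_add, hA, hB, smul_add]

/-- Loops of order at least `a`. -/
def O (a : ℤ) : Submodule ℂ (Loop 𝔤) where
  carrier := {A | ∀ k < a, coeff k A = 0}
  zero_mem' := by simp
  add_mem' := by
    intro A B hA hB k hk
    simp [hA k hk, hB k hk]
  smul_mem' := by
    intro c A hA k hk
    simp [hA k hk]

lemma mem_O {a : ℤ} {A : Loop 𝔤} : A ∈ O a ↔ ∀ k < a, coeff k A = 0 := Iff.rfl

lemma O_anti {a b : ℤ} (h : a ≤ b) : (O b : Submodule ℂ (Loop 𝔤)) ≤ O a :=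
  fun _ hA k hk => hA k (hk.trans_le h)

lemma mono_mem_O {a k : ℤ} (h : a ≤ k) (x : 𝔤) : mono k x ∈ O a := by
  intro j hj
  rw [coeff_mono, if_neg (by omega)]

lemma loopDeriv_mem_O {a : ℤ} {A : Loop 𝔤} (hA : A ∈ O a) : loopDeriv A ∈ O (a - 1) := by
  intro k hk
  rw [coeff_loopDeriv, hA _ (by omega), smul_zero]

lemma loopDeriv_mono (k : ℤ) (x : 𝔤) : loopDeriv (mono k x) = (k : ℂ) • mono (k - 1) x := by
  rw [mono_apply, mono_apply, loopDeriv, LinearMap.rTensor_tmul, TensorProduct.smul_tmul']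
  congr 1
  ext j
  simp only [LaurentSeries.derivative_apply, LaurentSeries.hasseDeriv_coeff,
    HahnSeries.coeff_single, HahnSeries.coeff_smul]
  by_cases h : j = k - 1
  · subst h; simp
  · rw [if_neg (by push_cast; omega), if_neg h]; simp

variable [FiniteDimensional ℂ 𝔤]

lemma repr_coeff {ι : Type*} (b : Basis ι ℂ 𝔤) (A : Loop 𝔤) (i : ι) (k : ℤ) :
    ((Algebra.TensorProduct.basis ℂ⸨X⸩ b).repr A i).coeff k = b.repr (coeff k A) i := by
  induction A using TensorProduct.induction_on with
  | zero => simp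
  | add A B hA hB => simp [hA, hB]
  | tmul f x =>
    rw [Algebra.TensorProduct.basis_repr_tmul, coeff_tmul]
    simp only [Finsupp.smul_apply, Finsupp.mapRange_apply, map_smul, smul_eq_mul]
    rw [HahnSeries.algebraMap_apply, mul_comm]
    simp [mul_comm]

lemma loop_ext {A B : Loop 𝔤} (h : ∀ k, coeff k A = coeff k B) : A = B := by
  apply (Algebra.TensorProduct.basis ℂ⸨X⸩ (Module.finBasis ℂ 𝔤)).ext_elem
  intro i
  ext k
  rw [repr_coeff, repr_coeff, h]

lemma exists_loop {a : ℤ} {c : ℤ → 𝔤} (hc : ∀ k < a, c k = 0) :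
    ∃ A : Loop 𝔤, ∀ k, coeff k A = c k := by
  let b := Module.finBasis ℂ 𝔤
  let f : Fin (finrank ℂ 𝔤) → ℂ⸨X⸩ := fun i =>
    HahnSeries.ofSuppBddBelow (fun k => b.repr (c k) i) ⟨a, fun k hk => by
      by_contra h
      exact hk (by simp [hc k (not_le.mp h)])⟩
  refine ⟨∑ i, f i ⊗ₜ[ℂ] b i, fun k => ?_⟩
  rw [map_sum]
  conv_rhs => rw [← b.sum_repr (c k)]
  simp only [coeff_tmul]
  rfl

lemma exists_mem_O (A : Loop 𝔤) : ∃ a, A ∈ O a := by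
  induction A using TensorProduct.induction_on with
  | zero => exact ⟨0, zero_mem _⟩
  | tmul f x =>
    by_cases hf : f = 0
    · exact ⟨0, by simp [hf]⟩
    · refine ⟨f.order, fun k hk => ?_⟩
      rw [coeff_tmul, HahnSeries.coeff_eq_zero_of_lt_order hk, zero_smul]
  | add A B hA hB =>
    obtain ⟨a, ha⟩ := hA
    obtain ⟨b, hb⟩ := hB
    exact ⟨min a b, add_mem (O_anti (min_le_left _ _) ha) (O_anti (min_le_right _ _) hb)⟩

lemma eq_zero_of_forall_mem_O {A : Loop 𝔤} (h : ∀ a, A ∈ O a) : A = 0 :=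
  loop_ext fun k => by rw [h (k + 1) k (by omega), map_zero]

/-- The common source of the coefficient formulas for the bracket and for the residue pairing: both
are determined on pure tensors by one coefficient of the product of the series. -/
lemma bilin_coeff {W : Type*} [AddCommGroup W] [Module ℂ W] (m : ℤ)
    (Ψ : Loop 𝔤 →ₗ[ℂ] Loop 𝔤 →ₗ[ℂ] W) (β : 𝔤 →ₗ[ℂ] 𝔤 →ₗ[ℂ] W)
    (hΨ : ∀ f x g y, Ψ (f ⊗ₜ x) (g ⊗ₜ y) = (f * g).coeff m • β x y)
    {a b : ℤ} {A B : Loop 𝔤} (hA : A ∈ O a) (hB : B ∈ O b) :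
    Ψ A B = ∑ i ∈ Finset.Icc a (m - b), β (coeff i A) (coeff (m - i) B) := by
  let e := Module.finBasis ℂ 𝔤
  let E := Algebra.TensorProduct.basis ℂ⸨X⸩ e
  have hrep : ∀ A : Loop 𝔤, A = ∑ i, E.repr A i ⊗ₜ[ℂ] e i := by
    intro A
    conv_lhs => rw [← E.sum_repr A]
    refine Finset.sum_congr rfl fun i _ => ?_
    rw [Algebra.TensorProduct.basis_apply, TensorProduct.smul_tmul', smul_eq_mul, mul_one]
  have hco : ∀ (A : Loop 𝔤) (k : ℤ), coeff k A = ∑ i, (E.repr A i).coeff k • e i := by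
    intro A k
    rw [← e.sum_repr (coeff k A)]
    exact Finset.sum_congr rfl fun i _ => by rw [repr_coeff]
  conv_lhs => rw [hrep A, hrep B]
  simp only [map_sum, LinearMap.sum_apply, hΨ]
  simp only [hco, map_sum, LinearMap.sum_apply, map_smul, LinearMap.smul_apply]
  rw [Finset.sum_comm]
  refine Eq.trans ?_ Finset.sum_comm
  rw [Finset.sum_comm]
  refine Finset.sum_congr rfl fun j _ => ?_
  simp only [Finset.smul_sum]
  refine Eq.trans ?_ Finset.sum_comm
  refine Finset.sum_congr rfl fun i _ => ?_
  rw [laurent_coeff_mul (a := a) (b := b)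
    (fun k hk => by rw [repr_coeff, hA k hk]; simp)
    (fun k hk => by rw [repr_coeff, hB k hk]; simp), Finset.sum_smul]
  refine Finset.sum_congr rfl fun k _ => ?_
  rw [smul_smul, mul_comm]

lemma coeff_lie {a b : ℤ} {A B : Loop 𝔤} (hA : A ∈ O a) (hB : B ∈ O b) (m : ℤ) :
    coeff m ⁅A, B⁆ = ∑ i ∈ Finset.Icc a (m - b), ⁅coeff i A, coeff (m - i) B⁆ := by
  let Ψ : Loop 𝔤 →ₗ[ℂ] Loop 𝔤 →ₗ[ℂ] 𝔤 := LinearMap.mk₂ ℂ (fun A B => coeff m ⁅A, B⁆)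
    (by simp) (by simp) (by simp) (by simp)
  let β : 𝔤 →ₗ[ℂ] 𝔤 →ₗ[ℂ] 𝔤 := LinearMap.mk₂ ℂ (fun x y => ⁅x, y⁆)
    (by simp) (by simp) (by simp) (by simp)
  exact bilin_coeff m Ψ β (fun f x g y => by simp [Ψ, β, ExtendScalars.bracket_tmul]) hA hB

lemma lie_mem_O {a b : ℤ} {A B : Loop 𝔤} (hA : A ∈ O a) (hB : B ∈ O b) : ⁅A, B⁆ ∈ O (a + b) := by
  intro k hk
  rw [coeff_lie hA hB, Finset.Icc_eq_empty (by omega), Finset.sum_empty]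

lemma coeff_lie_lowest {a b : ℤ} {A B : Loop 𝔤} (hA : A ∈ O a) (hB : B ∈ O b) :
    coeff (a + b) ⁅A, B⁆ = ⁅coeff a A, coeff b B⁆ := by
  rw [coeff_lie hA hB]
  simp

lemma coeff_mono_lie (k : ℤ) (x : 𝔤) (A : Loop 𝔤) (m : ℤ) :
    coeff m ⁅mono k x, A⁆ = ⁅x, coeff (m - k) A⁆ := by
  induction A using TensorProduct.induction_on with
  | zero => simp
  | add A B hA hB => simp [hA, hB]
  | tmul f y =>
    rw [mono_apply, ExtendScalars.bracket_tmul, coeff_tmul, coeff_tmul, lie_smul]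
    congr 1
    rw [show m = (m - k) + k by ring, HahnSeries.coeff_single_mul_add, one_mul]
    ring_nf

/-- The residue pairing as a bilinear map. -/
def resForm : Loop 𝔤 →ₗ[ℂ] Loop 𝔤 →ₗ[ℂ] ℂ :=
  LinearMap.mk₂ ℂ resPairing
    (by simp [resPairing])
    (by intro c A B; simp only [resPairing]; rw [← algebraMap_smul ℂ⸨X⸩ c A, map_smul]
        simp [HahnSeries.algebraMap_apply])
    (by simp [resPairing])
    (by intro c A B; simp only [resPairing]; rw [← algebraMap_smul ℂ⸨X⸩ c B, map_smul]
        simp [HahnSeries.algebraMap_apply])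

@[simp] lemma resForm_apply (ξ v : Loop 𝔤) : resForm ξ v = resPairing ξ v := rfl

lemma resPairing_neg_right (A B : Loop 𝔤) : resPairing A (-B) = -resPairing A B :=
  (resForm A).map_neg B

lemma resPairing_neg_left (A B : Loop 𝔤) : resPairing (-A) B = -resPairing A B :=
  (resForm.flip B).map_neg A

lemma resPairing_sub_right (A B C : Loop 𝔤) :
    resPairing A (B - C) = resPairing A B - resPairing A C :=
  (resForm A).map_sub B C

lemma resPairing_sub_left (A B C : Loop 𝔤) :
    resPairing (A - B) C = resPairing A C - resPairing B C :=
  (resForm.flip C).map_sub A B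

lemma resPairing_add_left (A B C : Loop 𝔤) :
    resPairing (A + B) C = resPairing A C + resPairing B C :=
  (resForm.flip C).map_add A B

lemma resPairing_smul_right (c : ℂ) (A B : Loop 𝔤) :
    resPairing A (c • B) = c * resPairing A B :=
  (resForm A).map_smul c B

lemma resPairing_smul_left (c : ℂ) (A B : Loop 𝔤) :
    resPairing (c • A) B = c * resPairing A B :=
  (resForm.flip B).map_smul c A

lemma resPairing_tmul (f g : ℂ⸨X⸩) (x y : 𝔤) :
    resPairing (f ⊗ₜ x) (g ⊗ₜ y) = (f * g).coeff (-1) • killingForm ℂ 𝔤 x y := by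
  rw [resPairing, LinearMap.BilinForm.baseChange_tmul]
  simp [mul_comm]

lemma resPairing_eq {a b : ℤ} {A B : Loop 𝔤} (hA : A ∈ O a) (hB : B ∈ O b) :
    resPairing A B =
      ∑ i ∈ Finset.Icc a (-1 - b), killingForm ℂ 𝔤 (coeff i A) (coeff (-1 - i) B) :=
  bilin_coeff (-1) resForm (killingForm ℂ 𝔤) (fun f x g y => resPairing_tmul f g x y) hA hB

lemma resPairing_mono (k : ℤ) (x : 𝔤) (v : Loop 𝔤) :
    resPairing (mono k x) v = killingForm ℂ 𝔤 x (coeff (-1 - k) v) := by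
  obtain ⟨b, hb⟩ := exists_mem_O v
  have h := resPairing_eq (mono_mem_O (le_refl k) x) hb
  rw [h]
  by_cases hk : k ≤ -1 - b
  · rw [Finset.sum_eq_single_of_mem k (Finset.mem_Icc.mpr ⟨le_rfl, hk⟩)]
    · rw [coeff_mono, if_pos rfl]
    · intro i _ hi
      rw [coeff_mono, if_neg hi, map_zero, LinearMap.zero_apply]
  · rw [Finset.Icc_eq_empty hk, Finset.sum_empty, hb _ (by omega), map_zero]

lemma resPairing_comm (ξ v : Loop 𝔤) : resPairing ξ v = resPairing v ξ := by
  simp only [← resForm_apply]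
  induction ξ using TensorProduct.induction_on with
  | zero => simp [-resForm_apply]
  | add A B hA hB => rw [map_add, LinearMap.add_apply, hA, hB, map_add]
  | tmul f x =>
    induction v using TensorProduct.induction_on with
    | zero => simp [-resForm_apply]
    | add A B hA hB => rw [map_add, LinearMap.map_add₂, hA, hB]
    | tmul g y =>
      rw [resForm_apply, resForm_apply, resPairing_tmul, resPairing_tmul, mul_comm,
        LieModule.traceForm_comm]

lemma resPairing_lie (A B C : Loop 𝔤) : resPairing ⁅A, B⁆ C = resPairing A ⁅B, C⁆ := by
  simp only [← resForm_apply]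
  induction A using TensorProduct.induction_on with
  | zero => simp [-resForm_apply]
  | add A A' hA hA' => rw [loop_add_lie, LinearMap.map_add₂, hA, hA', LinearMap.map_add₂]
  | tmul f x =>
    induction B using TensorProduct.induction_on with
    | zero => simp [-resForm_apply]
    | add B B' hB hB' => rw [loop_lie_add, LinearMap.map_add₂, hB, hB', loop_add_lie, map_add]
    | tmul g y =>
      induction C using TensorProduct.induction_on with
      | zero => simp [-resForm_apply]
      | add C C' hC hC' => rw [map_add, hC, hC', loop_lie_add, map_add]
      | tmul h z =>
        simp only [ExtendScalars.bracket_tmul, resForm_apply, resPairing_tmul, mul_assoc]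
        rw [show killingForm ℂ 𝔤 ⁅x, y⁆ z = killingForm ℂ 𝔤 x ⁅y, z⁆ from
          LieModule.traceForm_apply_lie_apply ℂ 𝔤 𝔤 x y z]

/-- Integration by parts: a derivative has no residue. -/
lemma resPairing_loopDeriv (A B : Loop 𝔤) :
    resPairing (loopDeriv A) B = -resPairing A (loopDeriv B) := by
  simp only [← resForm_apply]
  induction A using TensorProduct.induction_on with
  | zero => simp [-resForm_apply]
  | add A A' hA hA' => rw [map_add, LinearMap.map_add₂, hA, hA', LinearMap.map_add₂]; ring
  | tmul f x =>
    induction B using TensorProduct.induction_on with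
    | zero => simp [-resForm_apply]
    | add B B' hB hB' => rw [map_add, hB, hB', map_add, map_add]; ring
    | tmul g y =>
      simp only [resForm_apply, loopDeriv, LinearMap.rTensor_tmul, resPairing_tmul]
      have h : (LaurentSeries.derivative ℂ (f * g)).coeff (-1) = 0 := by
        simp [LaurentSeries.hasseDeriv_coeff]
      rw [derivative_mul, HahnSeries.coeff_add] at h
      rw [eq_neg_of_add_eq_zero_left h, neg_smul]

/-- The Hamiltonian vector field of a covector. -/
lemma poissonTensor_eq (A ξ η : Loop 𝔤) :
    poissonTensor A ξ η = resPairing (⁅A, ξ⁆ + loopDeriv ξ) η := by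
  rw [poissonTensor, resPairing_add_left, resPairing_lie]

lemma poissonTensor_antisymm (A ξ η : Loop 𝔤) :
    poissonTensor A ξ η = -poissonTensor A η ξ := by
  rw [poissonTensor, poissonTensor, ← loop_lie_skew, resPairing_neg_right,
    resPairing_loopDeriv, resPairing_comm ξ]
  ring

/-- The duality behind the reduction: a covector annihilates the gauge direction of `Y` exactly when
its hamiltonian direction is orthogonal to `Y`. -/
lemma resPairing_gauge_direction (A ξ Y : Loop 𝔤) :
    resPairing ξ (⁅Y, A⁆ - loopDeriv Y) = resPairing (⁅A, ξ⁆ + loopDeriv ξ) Y := by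
  rw [resPairing_sub_right, resPairing_add_left, resPairing_loopDeriv, ← loop_lie_skew Y A,
    ← loop_lie_skew A ξ, resPairing_neg_left, resPairing_neg_right, resPairing_lie]
  ring

end LoopCoefficients

/-! ### Convergent series for a filtration -/

section Convergence

variable {W : Type*} [AddCommGroup W] [Module ℂ W]

/-- `S` is the sum of the series `s` for the topology with the fundamental system `O` of
neighbourhoods of `0`. -/
def HasZSum (O : ℤ → Submodule ℂ W) (s : ℕ → W) (S : W) : Prop :=
  ∀ a, ∃ K, ∀ L ≥ K, S - ∑ j ∈ Finset.range L, s j ∈ O a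

variable {O : ℤ → Submodule ℂ W} {s s' : ℕ → W} {S S' : W}

lemma HasZSum.sub (h : HasZSum O s S) (h' : HasZSum O s' S') :
    HasZSum O (fun j => s j - s' j) (S - S') := by
  intro a
  obtain ⟨K, hK⟩ := h a
  obtain ⟨K', hK'⟩ := h' a
  refine ⟨max K K', fun L hL => ?_⟩
  have h1 := sub_mem (hK L (by omega)) (hK' L (by omega))
  rw [Finset.sum_sub_distrib]
  convert h1 using 1
  abel

lemma HasZSum.tail (h : HasZSum O s S) : HasZSum O (fun j => s (j + 1)) (S - s 0) := by
  intro a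
  obtain ⟨K, hK⟩ := h a
  refine ⟨K, fun L hL => ?_⟩
  have h1 := hK (L + 1) (by omega)
  rw [Finset.sum_range_succ'] at h1
  convert h1 using 1
  abel

lemma HasZSum.sub_mem (h : HasZSum O s S) (h' : HasZSum O s S') (a : ℤ) : S - S' ∈ O a := by
  obtain ⟨K, hK⟩ := h a
  obtain ⟨K', hK'⟩ := h' a
  have h1 := Submodule.sub_mem _ (hK (max K K') (by omega)) (hK' (max K K') (by omega))
  convert h1 using 1
  abel

lemma HasZSum.mem (h : HasZSum O s S) {a : ℤ} (hs : ∀ j, s j ∈ O a) : S ∈ O a := by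
  obtain ⟨K, hK⟩ := h a
  have h1 := add_mem (hK K le_rfl) (sum_mem (t := Finset.range K) fun j _ => hs j)
  rwa [sub_add_cancel] at h1

lemma HasZSum.sub_sum_mem (h : HasZSum O s S) {a : ℤ} {L : ℕ} (hs : ∀ j ≥ L, s j ∈ O a) :
    S - ∑ j ∈ Finset.range L, s j ∈ O a := by
  obtain ⟨K, hK⟩ := h a
  have h1 := hK (max K L) (le_max_left _ _)
  have h2 : ∑ j ∈ Finset.Ico L (max K L), s j ∈ O a :=
    sum_mem fun j hj => hs j (Finset.mem_Ico.mp hj).1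
  have h3 := Finset.sum_range_add_sum_Ico s (le_max_right K L)
  have h4 := add_mem h1 h2
  convert h4 using 1
  rw [← h3]
  abel

end Convergence

/-! ### The order-height filtration and the exponential series -/

section Filtration

variable {𝔤 : Type*} [LieRing 𝔤] [LieAlgebra ℂ 𝔤] [FiniteDimensional ℂ 𝔤]

lemma HasZSum.loop_unique {s : ℕ → Loop 𝔤} {S S' : Loop 𝔤} (h : HasZSum O s S)
    (h' : HasZSum O s S') : S = S' :=
  sub_eq_zero.mp (eq_zero_of_forall_mem_O fun a => h.sub_mem h' a)

lemma HasZSum.coeff_eq {s : ℕ → Loop 𝔤} {S : Loop 𝔤} (h : HasZSum O s S) {k : ℤ} {L : ℕ}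
    (hs : ∀ j ≥ L, s j ∈ O (k + 1)) : coeff k S = ∑ j ∈ Finset.range L, coeff k (s j) := by
  have h1 := h.sub_sum_mem hs k (by omega)
  rw [coeff_sub, map_sum] at h1
  exact sub_eq_zero.mp h1

/-- Completeness: the terms from `K (k + 1)` on do not contribute to the coefficient of z^k, so
every coefficient stabilises. -/
lemma exists_hasZSum {s : ℕ → Loop 𝔤} {a₀ : ℤ} (h₀ : ∀ j, s j ∈ O a₀)
    (hs : ∀ a, ∃ K, ∀ j ≥ K, s j ∈ O a) : ∃ S, HasZSum O s S := by
  choose K hK using hs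
  obtain ⟨S, hS⟩ := exists_loop (a := a₀)
    (c := fun k => ∑ j ∈ Finset.range (K (k + 1)), coeff k (s j))
    (fun k hk => Finset.sum_eq_zero fun j _ => h₀ j k hk)
  refine ⟨S, fun a => ⟨K a, fun L hL k hk => ?_⟩⟩
  rw [coeff_sub, map_sum, hS, sub_eq_zero]
  have key : ∀ L' ≥ K (k + 1), ∑ j ∈ Finset.range L', coeff k (s j) =
      ∑ j ∈ Finset.range (K (k + 1)), coeff k (s j) := by
    intro L' hL'
    rw [← Finset.sum_range_add_sum_Ico _ hL', add_eq_left]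
    exact Finset.sum_eq_zero fun j hj => hK _ j (Finset.mem_Ico.mp hj).1 k (by omega)
  have key' : ∀ L' ≥ K a, ∑ j ∈ Finset.range L', coeff k (s j) =
      ∑ j ∈ Finset.range (K a), coeff k (s j) := by
    intro L' hL'
    rw [← Finset.sum_range_add_sum_Ico _ hL', add_eq_left]
    exact Finset.sum_eq_zero fun j hj => hK _ j (Finset.mem_Ico.mp hj).1 k hk
  rw [key' L hL, ← key' (max (K a) (K (k + 1))) (le_max_left _ _),
    key (max (K a) (K (k + 1))) (le_max_right _ _)]

/-- The terms of the series for the action of `exp Y` on `ε d + A dz`. -/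
def gseq (Y : Loop 𝔤) (ε : ℂ) (A : Loop 𝔤) : ℕ → Loop 𝔤
  | 0 => A
  | j + 1 => ((j : ℂ) + 1)⁻¹ • (⁅Y, gseq Y ε A j⁆ - if j = 0 then ε • loopDeriv Y else 0)

lemma gseq_zero (Y : Loop 𝔤) (ε : ℂ) (A : Loop 𝔤) : gseq Y ε A 0 = A := rfl

lemma gseq_one (Y : Loop 𝔤) (ε : ℂ) (A : Loop 𝔤) :
    gseq Y ε A 1 = ⁅Y, A⁆ - ε • loopDeriv Y := by
  simp [gseq]

lemma gseq_succ_succ (Y : Loop 𝔤) (ε : ℂ) (A : Loop 𝔤) (j : ℕ) :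
    gseq Y ε A (j + 2) = ((j : ℂ) + 2)⁻¹ • ⁅Y, gseq Y ε A (j + 1)⁆ := by
  rw [gseq]
  simp only [Nat.add_eq_zero_iff, one_ne_zero, and_false, if_false]
  rw [loop_sub_zero]
  congr 2
  push_cast
  ring

lemma gseq_succ (Y : Loop 𝔤) (ε : ℂ) (A : Loop 𝔤) (j : ℕ) :
    ((j : ℂ) + 1) • gseq Y ε A (j + 1) =
      ⁅Y, gseq Y ε A j⁆ - if j = 0 then ε • loopDeriv Y else 0 := by
  rw [gseq, smul_smul, mul_inv_cancel₀ (by exact_mod_cast Nat.succ_ne_zero j), one_smul]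

/-- Homogeneity of degree `j` in `Y` holds for the derivative term too. Hence the coefficients of
`exp (t Y)` applied to a connection are polynomials in `t`. -/
lemma gseq_smul (t : ℂ) (Y : Loop 𝔤) (ε : ℂ) (A : Loop 𝔤) (j : ℕ) :
    gseq (t • Y) ε A j = t ^ j • gseq Y ε A j := by
  induction j with
  | zero => simp [gseq_zero]
  | succ j ih =>
    rw [gseq, gseq, ih, loop_lie_smul, loop_smul_lie, map_smul]
    split_ifs with h
    · subst h
      simp only [pow_zero, one_smul, zero_add, pow_one]
      rw [smul_comm ε t, ← loop_smul_sub, smul_comm]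
    · rw [loop_sub_zero, loop_sub_zero, smul_smul, smul_smul, smul_smul]
      congr 1
      ring

variable [LieAlgebra.IsSemisimple ℂ 𝔤] {H : LieSubalgebra ℂ 𝔤} [H.IsCartanSubalgebra]
  {Δ : (rootSystem H).Base} (F : Frame Δ)

namespace Frame

/-- Loops of order at least `a` whose first `n` coefficients have height at least `h`. -/
def L (n : ℕ) (a h : ℤ) : Submodule ℂ (Loop 𝔤) where
  carrier := {X | X ∈ O a ∧ ∀ k < a + n, coeff k X ∈ F.V h}
  zero_mem' := ⟨zero_mem _, by simp⟩
  add_mem' := by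
    rintro X X' ⟨h1, h2⟩ ⟨h1', h2'⟩
    exact ⟨add_mem h1 h1', fun k hk => by simpa using add_mem (h2 k hk) (h2' k hk)⟩
  smul_mem' := by
    rintro c X ⟨h1, h2⟩
    exact ⟨Submodule.smul_mem _ c h1, fun k hk => by simpa using Submodule.smul_mem _ c (h2 k hk)⟩

variable {F} {n : ℕ} {a a' h h' : ℤ} {X Y : Loop 𝔤}

lemma mem_L : X ∈ F.L n a h ↔ X ∈ O a ∧ ∀ k < a + n, coeff k X ∈ F.V h := Iff.rfl

lemma L_mono (ha : a' ≤ a) (hh : h' ≤ h) : F.L n a h ≤ F.L n a' h' :=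
  fun _ hX => ⟨O_anti ha hX.1, fun k hk => F.V_anti hh (hX.2 k (by omega))⟩

lemma O_le_L (hh : h ≤ -F.m) : O a ≤ F.L n a h :=
  fun _ hX => ⟨hX, fun _ _ => F.mem_V_of_le hh _⟩

lemma O_le_L' : O (a + n) ≤ F.L n a h :=
  fun _ hX => ⟨O_anti (by omega) hX, fun k hk => by rw [hX k hk]; exact zero_mem _⟩

/-- This trades height for order: no weight has height above `m`, so the first `n` coefficients
vanish. -/
lemma L_le_O (hh : F.m < h) : F.L n a h ≤ O (a + n) :=
  fun _ hX k hk => F.eq_zero_of_mem_V hh (hX.2 k hk)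

/-- Below z^(a' + a + n), the lower bound for one index keeps the other index among the first `n`
coefficients of its factor. -/
lemma lie_mem_L (hY : Y ∈ F.L n a' h') (hX : X ∈ F.L n a h) :
    ⁅Y, X⁆ ∈ F.L n (a' + a) (h' + h) := by
  refine ⟨lie_mem_O hY.1 hX.1, fun k hk => ?_⟩
  rw [coeff_lie hY.1 hX.1]
  refine sum_mem fun i hi => ?_
  rw [Finset.mem_Icc] at hi
  exact F.lie_mem_V (hY.2 i (by omega)) (hX.2 _ (by omega))

lemma loopDeriv_mem_L (hX : X ∈ F.L n a h) : loopDeriv X ∈ F.L n (a - 1) h := by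
  refine ⟨loopDeriv_mem_O hX.1, fun k hk => ?_⟩
  rw [coeff_loopDeriv]
  exact Submodule.smul_mem _ _ (hX.2 _ (by omega))

/-- With `mem_polarBorel`, this puts the Lie algebra of the group and the tangent space of the
connections into one filtration. -/
lemma mem_unipLoops : X ∈ unipLoops Δ n ↔ X ∈ F.L n 0 1 := by
  simp only [unipLoops, Set.mem_ofPred_eq, F.nilpSub_eq, mem_L, mem_O, zero_add]

lemma mem_polarBorel : X ∈ polarBorel Δ n ↔ X ∈ F.L n (-n) 0 := by
  rw [mem_L, mem_O, neg_add_cancel, ← F.borelSub_eq]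
  rfl

lemma gseq_mem_L (hY : Y ∈ F.L n 0 1) {ε : ℂ} (hX : X ∈ F.L n a h)
    (hε : ε • loopDeriv Y ∈ F.L n a (h + 1)) (j : ℕ) : gseq Y ε X j ∈ F.L n a (h + j) := by
  induction j with
  | zero => simpa [gseq_zero] using hX
  | succ j ih =>
    rw [gseq]
    refine Submodule.smul_mem _ _ (sub_mem ?_ ?_)
    · have := lie_mem_L hY ih
      rw [zero_add, show 1 + (h + j) = h + (j + 1 : ℕ) by push_cast; ring] at this
      exact this
    · split_ifs with h0
      · subst h0; simpa using hε
      · exact zero_mem _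

/-- After the first term, every bracket with `Y` raises the height by one. From the lowest height
`-m`, `2 m + 1` brackets lead beyond `m`, where the order has grown by `n`; then the count starts
again at height `-m`. -/
lemma gseq_mem_O (hY : Y ∈ F.L n 0 1) {ε : ℂ} (h1 : gseq Y ε X 1 ∈ O a) (r j : ℕ)
    (hj : r * (2 * F.m + 1) ≤ j) : gseq Y ε X (j + 1) ∈ O (a + r * n) := by
  have key : ∀ r i : ℕ, gseq Y ε X (r * (2 * F.m + 1) + i + 1) ∈
      F.L n (a + r * n) (-F.m + i) := by
    intro r
    induction r with
    | zero =>
      intro i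
      induction i with
      | zero =>
        simp only [zero_mul, zero_add, Nat.cast_zero, add_zero]
        exact O_le_L le_rfl h1
      | succ i ih =>
        have := lie_mem_L hY ih
        rw [show 0 * (2 * F.m + 1) + (i + 1) + 1 = 0 * (2 * F.m + 1) + i + 2 by ring,
          gseq_succ_succ]
        refine Submodule.smul_mem _ _ ?_
        convert this using 2
        · ring
        · push_cast; ring
    | succ r ihr =>
      intro i
      induction i with
      | zero =>
        have h2 := L_le_O (by push_cast; omega) (ihr (2 * F.m + 1))
        have h3 : (a + (r * n : ℤ) + n) = a + ((r + 1 : ℕ) : ℤ) * n := by push_cast; ring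
        rw [h3] at h2
        have h4 : (r + 1) * (2 * F.m + 1) + 0 + 1 = r * (2 * F.m + 1) + (2 * F.m + 1) + 1 := by
          ring
        rw [h4]
        exact O_le_L (by simp) h2
      | succ i ih =>
        have := lie_mem_L hY ih
        rw [show (r + 1) * (2 * F.m + 1) + (i + 1) + 1 = (r + 1) * (2 * F.m + 1) + i + 2 by ring,
          gseq_succ_succ]
        refine Submodule.smul_mem _ _ ?_
        convert this using 2
        · ring
        · push_cast; ring
  obtain ⟨i, rfl⟩ := Nat.exists_eq_add_of_le hj
  exact (key r i).1

lemma gseq_eventually_mem_O (hn : 1 ≤ n) (hY : Y ∈ F.L n 0 1) {ε : ℂ}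
    (h1 : gseq Y ε X 1 ∈ O a) (t : ℤ) :
    ∀ j ≥ (t - a).toNat * (2 * F.m + 1) + 1, gseq Y ε X j ∈ O t := by
  intro j hj
  obtain ⟨i, rfl⟩ := Nat.exists_eq_add_of_le (show 1 ≤ j by omega)
  rw [add_comm 1 i]
  refine O_anti ?_ (gseq_mem_O hY h1 (t - a).toNat i (by omega))
  have : ((t - a).toNat : ℤ) * 1 ≤ ((t - a).toNat : ℤ) * n := by gcongr; exact_mod_cast hn
  have := Int.self_le_toNat (t - a)
  omega

/-- The action of `exp Y` on `ε d + A dz` exists on the level of `𝔤((z))`. -/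
lemma exists_gseq_sum (hn : 1 ≤ n) (hY : Y ∈ F.L n 0 1) (ε : ℂ) (X : Loop 𝔤) :
    ∃ S, HasZSum O (gseq Y ε X) S := by
  obtain ⟨a, ha⟩ := exists_mem_O X
  have hY0 : Y ∈ O 0 := hY.1
  have h1 : gseq Y ε X 1 ∈ O (min a (-1)) := by
    rw [gseq_one]
    refine sub_mem (O_anti (by omega) (lie_mem_O hY0 ha))
      (Submodule.smul_mem _ _ (O_anti (by omega) (loopDeriv_mem_O hY0)))
  refine exists_hasZSum (a₀ := min a (-1)) (fun j => ?_)
    (fun t => ⟨_, gseq_eventually_mem_O hn hY h1 t⟩)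
  cases j with
  | zero => exact O_anti (min_le_left _ _) ha
  | succ j => simpa using gseq_mem_O hY h1 0 j (by simp)

end Frame

end Filtration

/-! ### Matrices of Laurent series and their exponentials -/

section MatrixSeries

variable {N : ℕ}

/-- Matrices of Laurent series of order at least `a`. -/
def OM (a : ℤ) : Submodule ℂ (Matrix (Fin N) (Fin N) ℂ⸨X⸩) where
  carrier := {M | ∀ i j, ∀ k < a, (M i j).coeff k = 0}
  zero_mem' := by simp
  add_mem' := by
    intro A B hA hB i j k hk
    simp [hA i j k hk, hB i j k hk]
  smul_mem' := by
    intro c A hA i j k hk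
    simp [hA i j k hk]

variable {A B : Matrix (Fin N) (Fin N) ℂ⸨X⸩} {a b : ℤ}

lemma OM_anti (h : a ≤ b) : (OM b : Submodule ℂ (Matrix (Fin N) (Fin N) ℂ⸨X⸩)) ≤ OM a :=
  fun _ hA i j k hk => hA i j k (hk.trans_le h)

lemma mul_mem_OM (hA : A ∈ OM a) (hB : B ∈ OM b) : A * B ∈ OM (a + b) := by
  intro i j k hk
  rw [Matrix.mul_apply, HahnSeries.coeff_sum]
  refine Finset.sum_eq_zero fun l _ => ?_
  rw [laurent_coeff_mul (hA i l) (hB l j), Finset.Icc_eq_empty (by omega), Finset.sum_empty]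

lemma one_mem_OM : (1 : Matrix (Fin N) (Fin N) ℂ⸨X⸩) ∈ OM 0 := by
  intro i j k hk
  rw [Matrix.one_apply]
  split_ifs
  · rw [HahnSeries.coeff_one, if_neg (by omega)]
  · simp

lemma matDeriv_mem_OM (hA : A ∈ OM a) : matDeriv A ∈ OM (a - 1) := by
  intro i j k hk
  simp only [matDeriv, Matrix.map_apply, LaurentSeries.derivative_apply,
    LaurentSeries.hasseDeriv_coeff]
  rw [hA i j _ (by push_cast; omega), smul_zero]

/-- The derivative of matrices of Laurent series as a linear map. -/
def matDerivL : Matrix (Fin N) (Fin N) ℂ⸨X⸩ →ₗ[ℂ] Matrix (Fin N) (Fin N) ℂ⸨X⸩ where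
  toFun := matDeriv
  map_add' A B := by ext1 i j; simp [matDeriv]
  map_smul' c A := by ext1 i j; simp only [matDeriv, Matrix.map_apply, Matrix.smul_apply, map_smul,
    RingHom.id_apply]

@[simp] lemma matDerivL_apply : matDerivL A = matDeriv A := rfl

lemma eq_zero_of_forall_mem_OM (h : ∀ a, A ∈ OM a) : A = 0 := by
  ext i j k
  rw [h (k + 1) i j k (by omega)]
  simp

lemma HasZSum.mat_unique {s : ℕ → Matrix (Fin N) (Fin N) ℂ⸨X⸩} (h : HasZSum OM s A)
    (h' : HasZSum OM s B) : A = B :=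
  sub_eq_zero.mp (eq_zero_of_forall_mem_OM fun a => h.sub_mem h' a)

lemma HasZSum.mul_right {s : ℕ → Matrix (Fin N) (Fin N) ℂ⸨X⸩} (h : HasZSum OM s A)
    (hB : B ∈ OM b) : HasZSum OM (fun k => s k * B) (A * B) := by
  intro a
  obtain ⟨K, hK⟩ := h (a - b)
  refine ⟨K, fun L hL => ?_⟩
  have := mul_mem_OM (hK L hL) hB
  rwa [sub_add_cancel, sub_mul, Finset.sum_mul] at this

lemma HasZSum.matDeriv {s : ℕ → Matrix (Fin N) (Fin N) ℂ⸨X⸩} (h : HasZSum OM s A) (ε : ℂ) :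
    HasZSum OM (fun k => ε • matDeriv (s k)) (ε • matDeriv A) := by
  intro a
  obtain ⟨K, hK⟩ := h (a + 1)
  refine ⟨K, fun L hL => ?_⟩
  have := (OM _).smul_mem ε (matDeriv_mem_OM (hK L hL))
  simp only [← matDerivL_apply, map_sub, map_sum, smul_sub, Finset.smul_sum,
    add_sub_cancel_right] at this ⊢
  exact this

/-- Cauchy products. -/
lemma HasZSum.mul {p q : ℕ → Matrix (Fin N) (Fin N) ℂ⸨X⸩} (hp : HasZSum OM p A)
    (hq : HasZSum OM q B) (hpa : ∀ j, p j ∈ OM a) (hqb : ∀ j, q j ∈ OM b)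
    (hp' : ∀ t, ∃ K, ∀ j ≥ K, p j ∈ OM t) (hq' : ∀ t, ∃ K, ∀ j ≥ K, q j ∈ OM t) :
    HasZSum OM (fun k => ∑ ij ∈ Finset.HasAntidiagonal.antidiagonal k, p ij.1 * q ij.2) (A * B) := by
  intro t
  obtain ⟨K₀, hK₀⟩ := hp (t - b)
  obtain ⟨K₁, hK₁⟩ := hp' (t - b)
  obtain ⟨K₂, hK₂⟩ := hq' (t - a)
  have hB := hq.mem hqb
  refine ⟨K₀ + K₁ + K₂, fun L hL => ?_⟩
  have hflip : ∑ k ∈ Finset.range L, ∑ ij ∈ Finset.HasAntidiagonal.antidiagonal k, p ij.1 * q ij.2 =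
      ∑ i ∈ Finset.range L, p i * ∑ j ∈ Finset.range (L - i), q j := by
    simp only [Finset.mul_sum]
    rw [← Finset.sum_range_diag_flip L (fun i j => p i * q j)]
    exact Finset.sum_congr rfl fun k _ =>
      Finset.Nat.sum_antidiagonal_eq_sum_range_succ (fun i j => p i * q j) k
  have hsplit : A * B - ∑ i ∈ Finset.range L, p i * ∑ j ∈ Finset.range (L - i), q j =
      (A - ∑ i ∈ Finset.range L, p i) * B +
        ∑ i ∈ Finset.range L, p i * (B - ∑ j ∈ Finset.range (L - i), q j) := by
    simp only [mul_sub, Finset.sum_sub_distrib, sub_mul, Finset.sum_mul]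
    abel
  rw [hflip, hsplit]
  refine add_mem ?_ (sum_mem fun i hi => ?_)
  · have := mul_mem_OM (hK₀ L (by omega)) hB
    rwa [sub_add_cancel] at this
  · by_cases h : K₁ ≤ i
    · have := mul_mem_OM (hK₁ i h)
        (_root_.sub_mem hB (sum_mem (t := Finset.range (L - i)) fun j _ => hqb j))
      rwa [sub_add_cancel] at this
    · have := mul_mem_OM (hpa i) (hq.sub_sum_mem (L := L - i) (a := t - a)
        (fun j hj => hK₂ j (by omega)))
      rwa [add_sub_cancel] at this

lemma mat_smul_mul (c : ℂ) (A B : Matrix (Fin N) (Fin N) ℂ⸨X⸩) : (c • A) * B = c • (A * B) := by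
  ext1 i j
  simp only [Matrix.mul_apply, Matrix.smul_apply, Finset.smul_sum]
  exact Finset.sum_congr rfl fun k _ => by rw [← HahnSeries.C_mul_eq_smul, ← HahnSeries.C_mul_eq_smul, mul_assoc]

lemma mat_mul_smul (c : ℂ) (A B : Matrix (Fin N) (Fin N) ℂ⸨X⸩) : A * (c • B) = c • (A * B) := by
  ext1 i j
  simp only [Matrix.mul_apply, Matrix.smul_apply, Finset.smul_sum]
  exact Finset.sum_congr rfl fun k _ => by rw [← HahnSeries.C_mul_eq_smul, ← HahnSeries.C_mul_eq_smul, mul_left_comm]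

lemma mat_add_smul (c d : ℂ) (A : Matrix (Fin N) (Fin N) ℂ⸨X⸩) : (c + d) • A = c • A + d • A := by
  ext1 i j
  exact add_smul c d (A i j)

lemma mat_zero_smul (A : Matrix (Fin N) (Fin N) ℂ⸨X⸩) : (0 : ℂ) • A = 0 := by
  ext1 i j
  exact zero_smul ℂ (A i j)

lemma mat_smul_zero (c : ℂ) : c • (0 : Matrix (Fin N) (Fin N) ℂ⸨X⸩) = 0 := by
  ext1 i j
  exact smul_zero (A := ℂ⸨X⸩) c

/-- The terms of the exponential series. -/
def expSeq (y : Matrix (Fin N) (Fin N) ℂ⸨X⸩) (k : ℕ) : Matrix (Fin N) (Fin N) ℂ⸨X⸩ :=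
  ((k.factorial : ℂ))⁻¹ • y ^ k

variable {y : Matrix (Fin N) (Fin N) ℂ⸨X⸩}

lemma expSeq_zero : expSeq y 0 = 1 := by simp [expSeq]

lemma expSeq_succ (k : ℕ) : ((k : ℂ) + 1) • expSeq y (k + 1) = y * expSeq y k := by
  rw [expSeq, expSeq, smul_smul, Nat.factorial_succ, pow_succ', mat_mul_smul]
  congr 1
  have h1 : ((k : ℂ) + 1) ≠ 0 := by exact_mod_cast Nat.succ_ne_zero k
  push_cast
  field_simp

lemma expSeq_comm (k : ℕ) : y * expSeq y k = expSeq y k * y := by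
  rw [expSeq, mat_mul_smul, mat_smul_mul, ← pow_succ', pow_succ]

/-- The powers of `y` tend to zero. -/
def PowTendsto (y : Matrix (Fin N) (Fin N) ℂ⸨X⸩) : Prop :=
  y ∈ OM 0 ∧ ∀ t, ∃ K, ∀ k ≥ K, y ^ k ∈ OM t

lemma PowTendsto.neg (h : PowTendsto y) : PowTendsto (-y) := by
  refine ⟨neg_mem h.1, fun t => ?_⟩
  obtain ⟨K, hK⟩ := h.2 t
  refine ⟨K, fun k hk => ?_⟩
  have h1 : ∀ k : ℕ, (-y) ^ k = y ^ k ∨ (-y) ^ k = -y ^ k := by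
    intro k
    induction k with
    | zero => simp
    | succ k ih =>
      rw [pow_succ, pow_succ]
      rcases ih with ih | ih
      · right; rw [ih, Matrix.mul_neg]
      · left; rw [ih, Matrix.neg_mul, Matrix.mul_neg, neg_neg]
  rcases h1 k with h2 | h2
  · rw [h2]; exact hK k hk
  · rw [h2]; exact neg_mem (hK k hk)

lemma PowTendsto.pow_mem (h : PowTendsto y) (k : ℕ) : y ^ k ∈ OM 0 := by
  induction k with
  | zero => rw [pow_zero]; exact one_mem_OM
  | succ k ih => rw [pow_succ]; simpa using mul_mem_OM ih h.1

lemma PowTendsto.expSeq_mem (h : PowTendsto y) (k : ℕ) : expSeq y k ∈ OM 0 :=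
  (OM 0).smul_mem _ (h.pow_mem k)

lemma PowTendsto.expSeq_tendsto (h : PowTendsto y) (t : ℤ) :
    ∃ K, ∀ k ≥ K, expSeq y k ∈ OM t := by
  obtain ⟨K, hK⟩ := h.2 t
  exact ⟨K, fun k hk => (OM t).smul_mem _ (hK k hk)⟩

lemma expSeq_coeff (i j : Fin N) (m : ℤ) (k : ℕ) :
    (expSeq y k i j).coeff m = ((k.factorial : ℂ))⁻¹ * ((y ^ k) i j).coeff m := by
  simp [expSeq]

/-- In a fixed coefficient only finitely many terms are nonzero, so the analytic sum in `IsExp` is a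
finite sum and agrees with the z-adic one. -/
lemma PowTendsto.hasZSum (h : PowTendsto y) {E : Matrix (Fin N) (Fin N) ℂ⸨X⸩} (hE : IsExp y E) :
    HasZSum OM (expSeq y) E := by
  intro t
  obtain ⟨K, hK⟩ := h.expSeq_tendsto t
  refine ⟨K, fun L hL i j m hm => ?_⟩
  have h1 : HasSum (fun k : ℕ => (expSeq y k i j).coeff m)
      (∑ k ∈ Finset.range L, (expSeq y k i j).coeff m) := by
    refine hasSum_sum_of_ne_finset_zero fun k hk => ?_
    rw [Finset.mem_range, not_lt] at hk
    exact hK k (by omega) i j m hm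
  simp only [expSeq_coeff] at h1
  have h2 := (hE i j m).unique h1
  rw [Matrix.sub_apply, Matrix.sum_apply, HahnSeries.coeff_sub, HahnSeries.coeff_sum, h2]
  simp [expSeq_coeff]

lemma PowTendsto.exists_isExp (h : PowTendsto y) : ∃ E, IsExp y E := by
  choose K hK using h.expSeq_tendsto
  have hz : ∀ i j, ∀ m < (0 : ℤ),
      ∑ k ∈ Finset.range (K (m + 1)), (expSeq y k i j).coeff m = 0 := fun i j m hm =>
    Finset.sum_eq_zero fun k _ => h.expSeq_mem k i j m hm
  refine ⟨Matrix.of fun i j => HahnSeries.ofSuppBddBelow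
    (fun m => ∑ k ∈ Finset.range (K (m + 1)), (expSeq y k i j).coeff m)
    ⟨0, fun m hm => by
      by_contra h'
      exact hm (hz i j m (not_le.mp h'))⟩, fun i j m => ?_⟩
  have h1 : HasSum (fun k : ℕ => (expSeq y k i j).coeff m)
      (∑ k ∈ Finset.range (K (m + 1)), (expSeq y k i j).coeff m) := by
    refine hasSum_sum_of_ne_finset_zero fun k hk => ?_
    rw [Finset.mem_range, not_lt] at hk
    exact hK (m + 1) k hk i j m (by omega)
  simp only [expSeq_coeff] at h1
  convert h1 using 1
  simp only [Matrix.of_apply, ← expSeq_coeff]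
  rfl

/-- In degree `k + 1` of the Cauchy product, the factor `k + 1` splits as the sum of the two
indices. Lowering either index produces a factor `y`, with opposite signs, and the two sums cancel.
-/
lemma PowTendsto.exp_mul_exp_neg (h : PowTendsto y) {E E' : Matrix (Fin N) (Fin N) ℂ⸨X⸩}
    (hE : IsExp y E) (hE' : IsExp (-y) E') : E * E' = 1 := by
  have h1 := (h.hasZSum hE).mul (h.neg.hasZSum hE') h.expSeq_mem h.neg.expSeq_mem
    h.expSeq_tendsto h.neg.expSeq_tendsto
  have hs : ∀ k, ∑ ij ∈ Finset.HasAntidiagonal.antidiagonal k, expSeq y ij.1 * expSeq (-y) ij.2 =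
      if k = 0 then 1 else 0 := by
    intro k
    cases k with
    | zero => simp [expSeq_zero]
    | succ k =>
      rw [if_neg (Nat.succ_ne_zero k)]
      have hk : ((k : ℂ) + 1) ≠ 0 := by exact_mod_cast Nat.succ_ne_zero k
      rw [← inv_smul_smul₀ hk (∑ ij ∈ _, _)]
      suffices h0 : ((k : ℂ) + 1) • ∑ ij ∈ Finset.HasAntidiagonal.antidiagonal (k + 1),
          expSeq y ij.1 * expSeq (-y) ij.2 = 0 by
        rw [h0]; exact mat_smul_zero _
      have e1 : ∀ ij ∈ Finset.HasAntidiagonal.antidiagonal (k + 1),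
          ((k : ℂ) + 1) • (expSeq y ij.1 * expSeq (-y) ij.2) =
          ((ij.1 : ℂ) • expSeq y ij.1) * expSeq (-y) ij.2 +
          expSeq y ij.1 * ((ij.2 : ℂ) • expSeq (-y) ij.2) := by
        intro ij hij
        have : (k : ℂ) + 1 = ij.1 + ij.2 := by
          rw [Finset.HasAntidiagonal.mem_antidiagonal] at hij
          exact_mod_cast hij.symm
        rw [this, mat_add_smul, mat_smul_mul, mat_mul_smul]
      rw [Finset.smul_sum, Finset.sum_congr rfl e1, Finset.sum_add_distrib,
        Finset.Nat.sum_antidiagonal_succ, Finset.Nat.sum_antidiagonal_succ']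
      simp only [Nat.cast_zero, mat_zero_smul, Matrix.zero_mul, Matrix.mul_zero, zero_add,
        Nat.cast_add, Nat.cast_one, expSeq_succ]
      rw [← Finset.sum_add_distrib]
      refine Finset.sum_eq_zero fun ij _ => ?_
      rw [expSeq_comm, mul_assoc, Matrix.neg_mul, Matrix.mul_neg, add_neg_cancel]
  simp only [hs] at h1
  refine h1.mat_unique fun t => ⟨1, fun L hL => ?_⟩
  rw [Finset.sum_ite_eq' (Finset.range L) 0, if_pos (Finset.mem_range.mpr (by omega)), sub_self]
  exact zero_mem _

end MatrixSeries

/-! ### Comparison of loops with matrices -/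

section ToMat

variable {N : ℕ} {𝔤 : LieSubalgebra ℂ (Matrix (Fin N) (Fin N) ℂ)}

lemma toMat_coeff (A : Loop 𝔤) (i j : Fin N) (k : ℤ) :
    (toMat A i j).coeff k = ((coeff k A : 𝔤) : Matrix (Fin N) (Fin N) ℂ) i j := by
  induction A using TensorProduct.induction_on with
  | zero => simp [toMat]
  | tmul f x => simp [toMat, mul_comm]
  | add A B hA hB =>
    have h : ((coeff k (A + B) : 𝔤) : Matrix (Fin N) (Fin N) ℂ) =
        ((coeff k A : 𝔤) : Matrix (Fin N) (Fin N) ℂ) + ((coeff k B : 𝔤) : Matrix (Fin N) (Fin N) ℂ) := by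
      rw [map_add]
      rfl
    rw [h, Matrix.add_apply, ← hA, ← hB, ← HahnSeries.coeff_add]
    simp only [toMat, Matrix.of_apply, map_add]

lemma mat_ext {A B : Matrix (Fin N) (Fin N) ℂ⸨X⸩}
    (h : ∀ i j k, (A i j).coeff k = (B i j).coeff k) : A = B := by
  ext i j k
  exact h i j k

lemma toMat_injective : Function.Injective (toMat (𝔤 := 𝔤)) := fun A B h => loop_ext fun k => by
  ext i j
  rw [← toMat_coeff, ← toMat_coeff, h]

/-- `toMat` as a linear map. -/
def toMatL : Loop 𝔤 →ₗ[ℂ] Matrix (Fin N) (Fin N) ℂ⸨X⸩ where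
  toFun := toMat
  map_add' A B := mat_ext fun i j k => by
    rw [toMat_coeff, map_add, Matrix.add_apply, HahnSeries.coeff_add, toMat_coeff, toMat_coeff]
    rfl
  map_smul' c A := mat_ext fun i j k => by
    rw [toMat_coeff, map_smul, RingHom.id_apply, Matrix.smul_apply, HahnSeries.coeff_smul,
      toMat_coeff]
    rfl

@[simp] lemma toMatL_apply (A : Loop 𝔤) : toMatL A = toMat A := rfl

lemma toMat_zero : toMat (0 : Loop 𝔤) = 0 := (toMatL (𝔤 := 𝔤)).map_zero

lemma toMat_add (A B : Loop 𝔤) : toMat (A + B) = toMat A + toMat B := (toMatL (𝔤 := 𝔤)).map_add A B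

lemma toMat_sub (A B : Loop 𝔤) : toMat (A - B) = toMat A - toMat B := (toMatL (𝔤 := 𝔤)).map_sub A B

lemma toMat_neg (A : Loop 𝔤) : toMat (-A) = -toMat A := (toMatL (𝔤 := 𝔤)).map_neg A

lemma toMat_smul (c : ℂ) (A : Loop 𝔤) : toMat (c • A) = c • toMat A :=
  (toMatL (𝔤 := 𝔤)).map_smul c A

lemma toMat_tmul (f : ℂ⸨X⸩) (x : 𝔤) (i j : Fin N) :
    toMat (f ⊗ₜ[ℂ] x) i j = f * HahnSeries.C ((x : Matrix (Fin N) (Fin N) ℂ) i j) := by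
  ext k
  rw [toMat_coeff, coeff_tmul, mul_comm, HahnSeries.C_mul_eq_smul]
  simp [mul_comm]

lemma toMat_series_smul (f : ℂ⸨X⸩) (A : Loop 𝔤) : toMat (f • A) = f • toMat A := by
  induction A using TensorProduct.induction_on with
  | zero =>
    rw [smul_zero, toMat_zero]
    ext1 i j
    exact (mul_zero f).symm
  | tmul g x =>
    ext1 i j
    rw [TensorProduct.smul_tmul', Matrix.smul_apply, toMat_tmul, toMat_tmul, smul_eq_mul, smul_eq_mul,
      mul_assoc]
  | add A B hA hB =>
    rw [smul_add, toMat_add, toMat_add, hA, hB]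
    ext1 i j
    exact (mul_add f (toMat A i j) (toMat B i j)).symm

lemma toMat_lie (A B : Loop 𝔤) : toMat ⁅A, B⁆ = toMat A * toMat B - toMat B * toMat A := by
  induction A using TensorProduct.induction_on with
  | zero => rw [loop_zero_lie, toMat_zero, Matrix.zero_mul, Matrix.mul_zero, sub_self]
  | add A A' hA hA' =>
    rw [loop_add_lie, toMat_add, toMat_add, hA, hA', Matrix.add_mul, Matrix.mul_add]
    abel
  | tmul f x =>
    induction B using TensorProduct.induction_on with
    | zero => rw [loop_lie_zero, toMat_zero, Matrix.zero_mul, Matrix.mul_zero, sub_self]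
    | add A A' hA hA' =>
      rw [loop_lie_add, toMat_add, toMat_add, hA, hA', Matrix.add_mul, Matrix.mul_add]
      abel
    | tmul g y =>
      rw [LieAlgebra.ExtendScalars.bracket_tmul]
      ext1 i j
      have h1 : ((⁅x, y⁆ : 𝔤) : Matrix (Fin N) (Fin N) ℂ) i j = ∑ l, x.1 i l * y.1 l j -
          ∑ l, y.1 i l * x.1 l j := by
        rw [LieSubalgebra.coe_bracket, LieRing.of_associative_ring_bracket, Matrix.sub_apply,
          Matrix.mul_apply, Matrix.mul_apply]
      rw [toMat_tmul, h1, map_sub, map_sum, map_sum, mul_sub, Finset.mul_sum, Finset.mul_sum,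
        Matrix.sub_apply, Matrix.mul_apply, Matrix.mul_apply]
      congr 1
      · refine Finset.sum_congr rfl fun l _ => ?_
        rw [toMat_tmul, toMat_tmul, map_mul]
        ring
      · refine Finset.sum_congr rfl fun l _ => ?_
        rw [toMat_tmul, toMat_tmul, map_mul]
        ring

lemma toMat_loopDeriv (A : Loop 𝔤) : toMat (loopDeriv A) = matDeriv (toMat A) := by
  refine mat_ext fun i j k => ?_
  rw [toMat_coeff, coeff_loopDeriv]
  simp only [matDeriv, Matrix.map_apply, LaurentSeries.derivative_apply,
    LaurentSeries.hasseDeriv_coeff, toMat_coeff]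
  simp

lemma toMat_mem_OM {A : Loop 𝔤} {a : ℤ} (h : A ∈ O a) : toMat A ∈ OM a := fun i j k hk => by
  rw [toMat_coeff, h k hk]
  rfl

lemma HasZSum.toMat {s : ℕ → Loop 𝔤} {S : Loop 𝔤} (h : HasZSum O s S) :
    HasZSum OM (fun j => toMat (s j)) (toMat S) := by
  intro a
  obtain ⟨K, hK⟩ := h a
  refine ⟨K, fun L hL => ?_⟩
  have := toMat_mem_OM (hK L hL)
  rwa [← toMatL_apply, map_sub, map_sum] at this

lemma sum_antidiagonal_ite_fst {W : Type*} [AddCommMonoid W] (k : ℕ) (f : ℕ → W) :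
    ∑ ij ∈ Finset.HasAntidiagonal.antidiagonal k, (if ij.1 = 0 then f ij.2 else 0) = f k := by
  cases k with
  | zero => simp
  | succ k => rw [Finset.Nat.sum_antidiagonal_succ]; simp

/-- The homogeneous parts in `Y` of the identity E A - ε E' = S E. The induction compares the
recursion of the exponential with that of `gseq`; the derivative of `Y` enters only through the
first step of `gseq`. -/
lemma expSeq_mul_toMat (Y A : Loop 𝔤) (ε : ℂ) (k : ℕ) :
    expSeq (toMat Y) k * toMat A - ε • matDeriv (expSeq (toMat Y) k) =
      ∑ ij ∈ Finset.HasAntidiagonal.antidiagonal k,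
        toMat (gseq Y ε A ij.1) * expSeq (toMat Y) ij.2 := by
  induction k with
  | zero =>
    have h1 : matDeriv (1 : Matrix (Fin N) (Fin N) ℂ⸨X⸩) = 0 := by
      simpa using matDeriv_mul (1 : Matrix (Fin N) (Fin N) ℂ⸨X⸩) 1
    simp [expSeq_zero, h1, mat_smul_zero, gseq_zero]
  | succ k ih =>
    have hk : ((k : ℂ) + 1) ≠ 0 := by exact_mod_cast Nat.succ_ne_zero k
    set y := toMat Y
    have hcancel : ∀ P Q : Matrix (Fin N) (Fin N) ℂ⸨X⸩,
        ((k : ℂ) + 1) • P = ((k : ℂ) + 1) • Q → P = Q := fun P Q h => by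
      rw [← inv_smul_smul₀ hk P, h, inv_smul_smul₀ hk]
    apply hcancel
    have e1 : ∀ ij ∈ Finset.HasAntidiagonal.antidiagonal (k + 1),
        ((k : ℂ) + 1) • (toMat (gseq Y ε A ij.1) * expSeq y ij.2) =
        ((ij.1 : ℂ) • toMat (gseq Y ε A ij.1)) * expSeq y ij.2 +
        toMat (gseq Y ε A ij.1) * ((ij.2 : ℂ) • expSeq y ij.2) := by
      intro ij hij
      have : (k : ℂ) + 1 = ij.1 + ij.2 := by
        rw [Finset.HasAntidiagonal.mem_antidiagonal] at hij
        exact_mod_cast hij.symm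
      rw [this, mat_add_smul, mat_smul_mul, mat_mul_smul]
    have e2 : ∀ i : ℕ, ((i : ℂ) + 1) • toMat (gseq Y ε A (i + 1)) =
        y * toMat (gseq Y ε A i) - toMat (gseq Y ε A i) * y -
          if i = 0 then ε • matDeriv y else 0 := by
      intro i
      rw [← toMat_smul, gseq_succ, toMat_sub, toMat_lie]
      split_ifs
      · rw [toMat_smul, toMat_loopDeriv]
      · rw [toMat_zero]
    have e3 : ((k : ℂ) + 1) • matDeriv (expSeq y (k + 1)) =
        matDeriv y * expSeq y k + y * matDeriv (expSeq y k) := by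
      rw [← matDeriv_mul, ← expSeq_succ, ← matDerivL_apply, ← matDerivL_apply, map_smul]
    rw [Finset.smul_sum, Finset.sum_congr rfl e1, Finset.sum_add_distrib,
      Finset.Nat.sum_antidiagonal_succ, Finset.Nat.sum_antidiagonal_succ']
    simp only [Nat.cast_zero, mat_zero_smul, Matrix.zero_mul, Matrix.mul_zero, zero_add,
      Nat.cast_add, Nat.cast_one, expSeq_succ, e2]
    rw [← Finset.sum_add_distrib]
    have e4 : ∀ ij ∈ Finset.HasAntidiagonal.antidiagonal k,
        (y * toMat (gseq Y ε A ij.1) - toMat (gseq Y ε A ij.1) * y -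
          if ij.1 = 0 then ε • matDeriv y else 0) * expSeq y ij.2 +
          toMat (gseq Y ε A ij.1) * (y * expSeq y ij.2) =
        y * (toMat (gseq Y ε A ij.1) * expSeq y ij.2) -
          if ij.1 = 0 then (ε • matDeriv y) * expSeq y ij.2 else 0 := by
      intro ij _
      split_ifs
      · simp only [Matrix.sub_mul, Matrix.mul_assoc]; abel
      · simp only [Matrix.sub_mul, Matrix.mul_assoc, Matrix.zero_mul]; abel
    rw [Finset.sum_congr rfl e4, Finset.sum_sub_distrib, ← Finset.mul_sum, ← ih]
    have hsub : ∀ (c : ℂ) (P Q : Matrix (Fin N) (Fin N) ℂ⸨X⸩), c • (P - Q) = c • P - c • Q :=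
      fun c P Q => by ext1 i j; exact smul_sub c (P i j) (Q i j)
    have hadd : ∀ (c : ℂ) (P Q : Matrix (Fin N) (Fin N) ℂ⸨X⸩), c • (P + Q) = c • P + c • Q :=
      fun c P Q => by ext1 i j; exact smul_add c (P i j) (Q i j)
    rw [sum_antidiagonal_ite_fst k fun j => (ε • matDeriv y) * expSeq y j, hsub, ← mat_smul_mul, expSeq_succ, smul_comm, e3, hadd, mat_smul_mul, Matrix.mul_sub,
      mat_mul_smul, Matrix.mul_assoc]
    abel

/-- Conjugation by an exponential (`ε = 0`) and gauge transformation by it (`ε = 1`). -/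
lemma exp_mul_toMat {Y A S : Loop 𝔤} {ε : ℂ} (hy : PowTendsto (toMat Y))
    {E : Matrix (Fin N) (Fin N) ℂ⸨X⸩} (hE : IsExp (toMat Y) E) (hS : HasZSum O (gseq Y ε A) S)
    {a : ℤ} (ha : ∀ j, gseq Y ε A j ∈ O a) (ha' : ∀ t, ∃ K, ∀ j ≥ K, gseq Y ε A j ∈ O t) :
    E * toMat A - ε • matDeriv E = toMat S * E := by
  obtain ⟨b, hb⟩ := exists_mem_O A
  have h1 := ((hy.hasZSum hE).mul_right (toMat_mem_OM hb)).sub ((hy.hasZSum hE).matDeriv ε)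
  simp only [expSeq_mul_toMat] at h1
  refine h1.mat_unique (hS.toMat.mul (hy.hasZSum hE) (fun j => toMat_mem_OM (ha j)) hy.expSeq_mem
    (fun t => ?_) hy.expSeq_tendsto)
  obtain ⟨K, hK⟩ := ha' t
  exact ⟨K, fun j hj => toMat_mem_OM (hK j hj)⟩

end ToMat

/-! ### Powers of unipotent loops in the given matrix representation -/

section Nilpotent

variable {N : ℕ} (ρ : Matrix (Fin N) (Fin N) ℂ)

/-- The span of the matrices of weight at least `h` for the commutator with `ρ`. -/
def weightSpan (h : ℕ) : Submodule ℂ (Matrix (Fin N) (Fin N) ℂ) :=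
  Submodule.span ℂ {M | ∃ k : ℕ, h ≤ k ∧ ρ * M - M * ρ = (k : ℂ) • M}

lemma weightSpan_mul {h h' : ℕ} {A B : Matrix (Fin N) (Fin N) ℂ} (hA : A ∈ weightSpan ρ h)
    (hB : B ∈ weightSpan ρ h') : A * B ∈ weightSpan ρ (h + h') := by
  have := Submodule.mul_mem_mul hA hB
  rw [weightSpan, weightSpan, Submodule.span_mul_span] at this
  refine Submodule.span_mono ?_ this
  rintro _ ⟨P, ⟨k, hk, hP⟩, Q, ⟨k', hk', hQ⟩, rfl⟩
  refine ⟨k + k', by omega, ?_⟩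
  have h1 : ρ * (P * Q) - (P * Q) * ρ = (ρ * P - P * ρ) * Q + P * (ρ * Q - Q * ρ) := by noncomm_ring
  dsimp only
  rw [h1, hP, hQ, Matrix.smul_mul, Matrix.mul_smul, ← add_smul, Nat.cast_add]

/-- The commutator with `ρ` has only finitely many eigenvalues. -/
lemma exists_weightSpan_eq_bot : ∃ K, ∀ h ≥ K, weightSpan ρ h = ⊥ := by
  let T : Module.End ℂ (Matrix (Fin N) (Fin N) ℂ) :=
    LinearMap.mulLeft ℂ ρ - LinearMap.mulRight ℂ ρ
  have hfin : {k : ℕ | T.HasEigenvalue (k : ℂ)}.Finite :=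
    (Module.End.finite_hasEigenvalue T).preimage (Nat.cast_injective.injOn)
  obtain ⟨K, hK⟩ := hfin.bddAbove
  refine ⟨K + 1, fun h hh => ?_⟩
  rw [weightSpan, Submodule.span_eq_bot]
  rintro M ⟨k, hk, hM⟩
  by_contra hne
  have : T.HasEigenvalue (k : ℂ) :=
    Module.End.hasEigenvalue_of_hasEigenvector (x := M) ⟨Module.End.mem_eigenspace_iff.mpr hM, hne⟩
  have := hK this
  omega

/-- Series without pole whose first `n` coefficients have weight at least `h`. -/
def IsWeighted (n h : ℕ) (A : Matrix (Fin N) (Fin N) ℂ⸨X⸩) : Prop :=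
  A ∈ OM 0 ∧ ∀ k < (n : ℤ), A.map (HahnSeries.coeff · k) ∈ weightSpan ρ h

variable {ρ}

lemma IsWeighted.mul {n h h' : ℕ} {A B : Matrix (Fin N) (Fin N) ℂ⸨X⸩} (hA : IsWeighted ρ n h A)
    (hB : IsWeighted ρ n h' B) : IsWeighted ρ n (h + h') (A * B) := by
  refine ⟨by simpa using mul_mem_OM hA.1 hB.1, fun k hk => ?_⟩
  have h1 : (A * B).map (HahnSeries.coeff · k) = ∑ i ∈ Finset.Icc 0 (k - 0),
      A.map (HahnSeries.coeff · i) * B.map (HahnSeries.coeff · (k - i)) := by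
    ext p q
    rw [Matrix.map_apply, Matrix.mul_apply, HahnSeries.coeff_sum, Matrix.sum_apply]
    simp only [Matrix.mul_apply, Matrix.map_apply]
    rw [Finset.sum_comm]
    exact Finset.sum_congr rfl fun l _ => laurent_coeff_mul (hA.1 p l) (hB.1 l q) k
  rw [h1]
  refine sum_mem fun i hi => ?_
  rw [Finset.mem_Icc] at hi
  exact weightSpan_mul ρ (hA.2 i (by omega)) (hB.2 _ (by omega))

/-- The power `K + 1` has weight at least `K + 1`, so its first `n` coefficients vanish. As `n ≥ 1`,
each further factor of this kind raises the order by at least one. -/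
lemma IsWeighted.powTendsto {n : ℕ} (hn : 1 ≤ n) {A : Matrix (Fin N) (Fin N) ℂ⸨X⸩}
    (hA : IsWeighted ρ n 1 A) : PowTendsto A := by
  obtain ⟨K, hK⟩ := exists_weightSpan_eq_bot ρ
  have h1 : ∀ k, IsWeighted ρ n (k + 1) (A ^ (k + 1)) := by
    intro k
    induction k with
    | zero => simpa using hA
    | succ k ih => rw [pow_succ]; exact ih.mul hA
  have h0 : ∀ k, A ^ k ∈ OM 0 := by
    rintro (_ | k)
    · rw [pow_zero]; exact one_mem_OM
    · exact (h1 k).1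
  have h2 : A ^ (K + 1) ∈ OM 1 := by
    intro i j k hk
    have := (h1 K).2 k (by omega)
    rw [hK _ (by omega), Submodule.mem_bot] at this
    exact congrFun (congrFun this i) j
  have h3 : ∀ r : ℕ, A ^ ((K + 1) * r) ∈ OM (r : ℤ) := by
    intro r
    induction r with
    | zero => simpa using one_mem_OM
    | succ r ih =>
      rw [mul_add, mul_one, pow_add]
      simpa using mul_mem_OM ih h2
  refine ⟨hA.1, fun t => ⟨(K + 1) * t.toNat, fun k hk => ?_⟩⟩
  obtain ⟨i, rfl⟩ := Nat.exists_eq_add_of_le hk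
  rw [pow_add]
  have := mul_mem_OM (h3 t.toNat) (h0 i)
  exact OM_anti (by have := Int.self_le_toNat t; omega) this

variable {𝔤 : LieSubalgebra ℂ (Matrix (Fin N) (Fin N) ℂ)} [LieAlgebra.IsSemisimple ℂ 𝔤]
  {H : LieSubalgebra ℂ 𝔤} [H.IsCartanSubalgebra] {Δ : (rootSystem H).Base} {F : Frame Δ} {n : ℕ}

/-- `IsExp` concerns powers of `N × N` matrices, for which nilpotency of `ad` is not enough. A basis
vector of height k is also an eigenvector, for k, of the commutator with `rho` on all matrices. -/
lemma Frame.powTendsto (hn : 1 ≤ n) {Y : Loop 𝔤} (hY : Y ∈ F.L n 0 1) : PowTendsto (toMat Y) := by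
  refine IsWeighted.powTendsto (ρ := (F.rho : Matrix (Fin N) (Fin N) ℂ)) hn
    ⟨toMat_mem_OM hY.1, fun k hk => ?_⟩
  have h1 : (toMat Y).map (HahnSeries.coeff · k) =
      ((coeff k Y : 𝔤) : Matrix (Fin N) (Fin N) ℂ) := by
    ext i j
    rw [Matrix.map_apply, toMat_coeff]
  rw [h1]
  have h2 := hY.2 k (by omega)
  generalize coeff k Y = x at h2
  suffices h3 : F.V 1 ≤ (weightSpan (F.rho : Matrix (Fin N) (Fin N) ℂ) 1).comap
      𝔤.toSubmodule.subtype from h3 h2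
  intro x hx
  rw [← F.b.sum_repr x]
  refine sum_mem fun i _ => ?_
  by_cases hi : F.ht i < 1
  · rw [hx i hi, zero_smul]
    exact zero_mem _
  · refine Submodule.smul_mem _ _ (Submodule.subset_span ⟨(F.ht i).toNat, by omega, ?_⟩)
    have h4 := F.lie_b _ F.rho_mem i
    rw [F.wt_rho] at h4
    have h5 := congrArg (fun y : 𝔤 => (y : Matrix (Fin N) (Fin N) ℂ)) h4
    have h6 : (((F.ht i).toNat : ℕ) : ℂ) = ((F.ht i : ℤ) : ℂ) := by
      have : (((F.ht i).toNat : ℕ) : ℤ) = F.ht i := Int.toNat_of_nonneg (by omega)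
      exact_mod_cast congrArg (fun z : ℤ => (z : ℂ)) this
    rw [h6]
    exact h5

end Nilpotent

/-! ### Sums of the exponential series within the filtration -/

section GaugeAction

variable {𝔤 : Type*} [LieRing 𝔤] [LieAlgebra ℂ 𝔤] [FiniteDimensional ℂ 𝔤]
  [LieAlgebra.IsSemisimple ℂ 𝔤] {H : LieSubalgebra ℂ 𝔤} [H.IsCartanSubalgebra]
  {Δ : (rootSystem H).Base} {F : Frame Δ} {n : ℕ} {X Y : Loop 𝔤}

/-- The constant term is lost under differentiation, so no pole appears. -/
lemma loopDeriv_mem_O_zero (hY : Y ∈ O 0) : loopDeriv Y ∈ O 0 := by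
  intro k hk
  rw [coeff_loopDeriv]
  rcases (show k = -1 ∨ k + 1 < 0 by omega) with rfl | h
  · have : (((-1 : ℤ) : ℂ) + 1) = 0 := by norm_num
    rw [this, zero_smul]
  · rw [hY _ h, smul_zero]

namespace Frame

lemma exists_gseq_mem_O (hY : Y ∈ F.L n 0 1) (ε : ℂ) (X : Loop 𝔤) :
    ∃ a, ∀ j, gseq Y ε X j ∈ O a := by
  obtain ⟨a, ha⟩ := exists_mem_O X
  have h1 : gseq Y ε X 1 ∈ O (min a 0) := by
    rw [gseq_one]
    refine sub_mem (O_anti (by omega) (lie_mem_O hY.1 ha))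
      (Submodule.smul_mem _ _ (O_anti (by omega) (loopDeriv_mem_O_zero hY.1)))
  refine ⟨min a 0, fun j => ?_⟩
  cases j with
  | zero => exact O_anti (min_le_left _ _) ha
  | succ j => simpa using gseq_mem_O hY h1 0 j (by simp)

lemma gseq_tendsto (hn : 1 ≤ n) (hY : Y ∈ F.L n 0 1) (ε : ℂ) (X : Loop 𝔤) (t : ℤ) :
    ∃ K, ∀ j ≥ K, gseq Y ε X j ∈ O t := by
  obtain ⟨a, ha⟩ := exists_gseq_mem_O hY ε X
  exact ⟨_, gseq_eventually_mem_O hn hY (ha 1) t⟩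

/-- `F.L n a h` contains `O (a + n)`, so it is closed under limits. -/
lemma hasZSum_mem_L {s : ℕ → Loop 𝔤} {S : Loop 𝔤} (hS : HasZSum O s S) {a h : ℤ}
    (hs : ∀ j, s j ∈ F.L n a h) : S ∈ F.L n a h := by
  obtain ⟨K, hK⟩ := hS (a + n)
  have h1 := add_mem (O_le_L' (F := F) (h := h) (hK K le_rfl))
    (sum_mem (t := Finset.range K) fun j _ => hs j)
  rwa [sub_add_cancel] at h1

/-- The sum of the series `gseq Y ε X`. -/
lemma hasZSum_sub_mem_L {S : Loop 𝔤} {ε : ℂ} (hS : HasZSum O (gseq Y ε X) S)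
    (hY : Y ∈ F.L n 0 1) {a h : ℤ} (hX : X ∈ F.L n a h)
    (hε : ε • loopDeriv Y ∈ F.L n a (h + 1)) : S - X ∈ F.L n a (h + 1) :=
  hasZSum_mem_L hS.tail fun j => L_mono le_rfl (by push_cast; omega) (gseq_mem_L hY hX hε (j + 1))

lemma mono_mem_L {h : ℤ} {x : 𝔤} (hx : x ∈ F.V h) (k : ℤ) : mono k x ∈ F.L n k h := by
  refine ⟨mono_mem_O le_rfl x, fun m _ => ?_⟩
  rw [coeff_mono]
  split_ifs
  · exact hx
  · exact zero_mem _

end Frame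

end GaugeAction

/-! ### The action of the group on loops -/

section GroupAction

variable {N : ℕ} {𝔤 : LieSubalgebra ℂ (Matrix (Fin N) (Fin N) ℂ)} [LieAlgebra.IsSemisimple ℂ 𝔤]
  {H : LieSubalgebra ℂ 𝔤} [H.IsCartanSubalgebra] {Δ : (rootSystem H).Base} {F : Frame Δ} {n : ℕ}

/-- The conjugation by `g`, its inverse and the logarithmic derivative of `g`, on the level of
`𝔤((z))`. -/
structure IsGaugeAction (F : Frame Δ) (n : ℕ) (g : GL (Fin N) ℂ⸨X⸩) (Φ Ψ : Loop 𝔤 → Loop 𝔤)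
    (c : Loop 𝔤) : Prop where
  conj : ∀ A, toMat (Φ A) = g.1 * toMat A * g⁻¹.1
  conj_inv : ∀ A, toMat (Ψ A) = g⁻¹.1 * toMat A * g.1
  logDeriv : toMat c = matDeriv g.1 * g⁻¹.1
  mem_L : c ∈ F.L n (-1) 1
  mem_O : c ∈ O 0
  sub_mem : ∀ a h, ∀ X ∈ F.L n a h, Φ X - X ∈ F.L n a (h + 1)
  inv_sub_mem : ∀ a h, ∀ X ∈ F.L n a h, Ψ X - X ∈ F.L n a (h + 1)

variable {g g' : GL (Fin N) ℂ⸨X⸩} {Φ Ψ Φ' Ψ' : Loop 𝔤 → Loop 𝔤} {c c' : Loop 𝔤}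

lemma matDeriv_one : matDeriv (1 : Matrix (Fin N) (Fin N) ℂ⸨X⸩) = 0 := by
  simpa using matDeriv_mul (1 : Matrix (Fin N) (Fin N) ℂ⸨X⸩) 1

lemma mat_mul_conj (P Q A Q' P' : Matrix (Fin N) (Fin N) ℂ⸨X⸩) :
    P * (Q * A * Q') * P' = P * Q * A * (Q' * P') := by
  simp only [Matrix.mul_assoc]

lemma mat_series_smul_conj (f : ℂ⸨X⸩) (P A Q : Matrix (Fin N) (Fin N) ℂ⸨X⸩) :
    P * (f • A) * Q = f • (P * A * Q) := by
  ext1 i j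
  simp only [Matrix.mul_apply, Matrix.smul_apply, smul_eq_mul, Finset.mul_sum, Finset.sum_mul]
  exact Finset.sum_congr rfl fun k _ => Finset.sum_congr rfl fun l _ => by ring

namespace IsGaugeAction

lemma map_mem_L (hg : IsGaugeAction F n g Φ Ψ c) {a h : ℤ} {X : Loop 𝔤} (hX : X ∈ F.L n a h) :
    Φ X ∈ F.L n a h := by
  have := add_mem (Frame.L_mono le_rfl (by omega) (hg.sub_mem a h X hX)) hX
  rwa [sub_add_cancel] at this

lemma inv_mem_L (hg : IsGaugeAction F n g Φ Ψ c) {a h : ℤ} {X : Loop 𝔤} (hX : X ∈ F.L n a h) :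
    Ψ X ∈ F.L n a h := by
  have := add_mem (Frame.L_mono le_rfl (by omega) (hg.inv_sub_mem a h X hX)) hX
  rwa [sub_add_cancel] at this

lemma map_mem_O (hg : IsGaugeAction F n g Φ Ψ c) {a : ℤ} {X : Loop 𝔤} (hX : X ∈ O a) :
    Φ X ∈ O a :=
  (hg.map_mem_L (Frame.O_le_L (n := n) le_rfl hX)).1

lemma inv_mem_O (hg : IsGaugeAction F n g Φ Ψ c) {a : ℤ} {X : Loop 𝔤} (hX : X ∈ O a) :
    Ψ X ∈ O a :=
  (hg.inv_mem_L (Frame.O_le_L (n := n) le_rfl hX)).1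

lemma one : IsGaugeAction F n 1 id id 0 where
  conj A := by simp
  conj_inv A := by simp
  logDeriv := by rw [toMat_zero, Units.val_one, matDeriv_one, Matrix.zero_mul]
  mem_L := zero_mem _
  mem_O := zero_mem _
  sub_mem a h X _ := by rw [id, sub_self]; exact zero_mem _
  inv_sub_mem a h X _ := by rw [id, sub_self]; exact zero_mem _

lemma mul (hg : IsGaugeAction F n g Φ Ψ c) (hg' : IsGaugeAction F n g' Φ' Ψ' c') :
    IsGaugeAction F n (g * g') (Φ ∘ Φ') (Ψ' ∘ Ψ) (c + Φ c') where
  conj A := by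
    rw [mul_inv_rev, Units.val_mul, Units.val_mul, ← mat_mul_conj, ← hg'.conj, ← hg.conj]
    rfl
  conj_inv A := by
    rw [mul_inv_rev, Units.val_mul, Units.val_mul, ← mat_mul_conj, ← hg.conj_inv, ← hg'.conj_inv]
    rfl
  logDeriv := by
    have e : g'.1 * g'⁻¹.1 = 1 := g'.mul_inv
    rw [toMat_add, hg.conj, hg'.logDeriv, hg.logDeriv, mul_inv_rev, Units.val_mul, Units.val_mul,
      matDeriv_mul, Matrix.add_mul]
    have h1 : matDeriv g.1 * g'.1 * (g'⁻¹.1 * g⁻¹.1) = matDeriv g.1 * g⁻¹.1 := by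
      rw [Matrix.mul_assoc, ← Matrix.mul_assoc g'.1, e, Matrix.one_mul]
    have h2 : g.1 * (matDeriv g'.1 * g'⁻¹.1) * g⁻¹.1 = g.1 * matDeriv g'.1 * (g'⁻¹.1 * g⁻¹.1) := by
      rw [← Matrix.mul_assoc, Matrix.mul_assoc]
    rw [h1, h2]
  mem_L := add_mem hg.mem_L (hg.map_mem_L hg'.mem_L)
  mem_O := add_mem hg.mem_O (hg.map_mem_O hg'.mem_O)
  sub_mem a h X hX := by
    have := add_mem (hg.sub_mem a h _ (hg'.map_mem_L hX)) (hg'.sub_mem a h X hX)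
    rwa [sub_add_sub_cancel] at this
  inv_sub_mem a h X hX := by
    have := add_mem (hg'.inv_sub_mem a h _ (hg.inv_mem_L hX)) (hg.inv_sub_mem a h X hX)
    rwa [sub_add_sub_cancel] at this

lemma inv (hg : IsGaugeAction F n g Φ Ψ c) : IsGaugeAction F n g⁻¹ Ψ Φ (-Ψ c) where
  conj A := by rw [hg.conj_inv, inv_inv]
  conj_inv A := by rw [hg.conj, inv_inv]
  logDeriv := by
    have e : g⁻¹.1 * g.1 = 1 := g.inv_mul
    have h1 := matDeriv_mul g⁻¹.1 g.1
    rw [e, matDeriv_one] at h1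
    rw [toMat_neg, hg.conj_inv, hg.logDeriv, inv_inv, Matrix.mul_assoc, Matrix.mul_assoc, e,
      Matrix.mul_one]
    exact (eq_neg_of_add_eq_zero_left h1.symm).symm
  mem_L := neg_mem (hg.inv_mem_L hg.mem_L)
  mem_O := neg_mem (hg.inv_mem_O hg.mem_O)
  sub_mem := hg.inv_sub_mem
  inv_sub_mem := hg.sub_mem

lemma gauge_eq (hg : IsGaugeAction F n g Φ Ψ c) (A : Loop 𝔤) :
    gauge g (toMat A) = toMat (Φ A - c) := by
  rw [gauge, toMat_sub, hg.conj, hg.logDeriv]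

lemma left_inv (hg : IsGaugeAction F n g Φ Ψ c) (A : Loop 𝔤) : Ψ (Φ A) = A := by
  have e : g⁻¹.1 * g.1 = 1 := g.inv_mul
  apply toMat_injective
  rw [hg.conj_inv, hg.conj]
  rw [Matrix.mul_assoc, Matrix.mul_assoc, e, Matrix.mul_one, ← Matrix.mul_assoc, e, Matrix.one_mul]

lemma right_inv (hg : IsGaugeAction F n g Φ Ψ c) (A : Loop 𝔤) : Φ (Ψ A) = A := hg.inv.left_inv A

lemma map_add (hg : IsGaugeAction F n g Φ Ψ c) (A B : Loop 𝔤) : Φ (A + B) = Φ A + Φ B := by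
  apply toMat_injective
  rw [toMat_add, hg.conj, hg.conj, hg.conj, toMat_add, Matrix.mul_add, Matrix.add_mul]

lemma map_sub (hg : IsGaugeAction F n g Φ Ψ c) (A B : Loop 𝔤) : Φ (A - B) = Φ A - Φ B := by
  apply toMat_injective
  rw [toMat_sub, hg.conj, hg.conj, hg.conj, toMat_sub, Matrix.mul_sub, Matrix.sub_mul]

lemma map_series_smul (hg : IsGaugeAction F n g Φ Ψ c) (f : ℂ⸨X⸩) (A : Loop 𝔤) :
    Φ (f • A) = f • Φ A := by
  apply toMat_injective
  rw [toMat_series_smul, hg.conj, hg.conj, toMat_series_smul, mat_series_smul_conj]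

lemma map_smul (hg : IsGaugeAction F n g Φ Ψ c) (t : ℂ) (A : Loop 𝔤) : Φ (t • A) = t • Φ A := by
  apply toMat_injective
  rw [toMat_smul, hg.conj, hg.conj, toMat_smul, mat_mul_smul, mat_smul_mul]

lemma map_lie (hg : IsGaugeAction F n g Φ Ψ c) (A B : Loop 𝔤) : Φ ⁅A, B⁆ = ⁅Φ A, Φ B⁆ := by
  have e : g⁻¹.1 * g.1 = 1 := g.inv_mul
  have h : ∀ P Q : Matrix (Fin N) (Fin N) ℂ⸨X⸩,
      g.1 * P * g⁻¹.1 * (g.1 * Q * g⁻¹.1) = g.1 * (P * Q) * g⁻¹.1 := by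
    intro P Q
    calc _ = g.1 * P * (g⁻¹.1 * g.1) * Q * g⁻¹.1 := by simp only [Matrix.mul_assoc]
      _ = _ := by rw [e]; simp only [Matrix.mul_assoc, Matrix.mul_one]
  apply toMat_injective
  rw [toMat_lie, hg.conj, hg.conj, hg.conj, toMat_lie, h, h, Matrix.mul_sub, Matrix.sub_mul]

/-- The derivative of a conjugate. -/
lemma loopDeriv_map (hg : IsGaugeAction F n g Φ Ψ c) (A : Loop 𝔤) :
    loopDeriv (Φ A) = Φ (loopDeriv A) + ⁅c, Φ A⁆ := by
  have e : g⁻¹.1 * g.1 = 1 := g.inv_mul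
  have h1 := matDeriv_mul g⁻¹.1 g.1
  rw [e, matDeriv_one] at h1
  have h2 : matDeriv g⁻¹.1 = -(g⁻¹.1 * matDeriv g.1 * g⁻¹.1) := by
    have e' : g.1 * g⁻¹.1 = 1 := g.mul_inv
    have := eq_neg_of_add_eq_zero_left h1.symm
    rw [← Matrix.neg_mul, ← this, Matrix.mul_assoc, e', Matrix.mul_one]
  apply toMat_injective
  rw [toMat_loopDeriv, toMat_add, toMat_lie, hg.conj, hg.conj, hg.logDeriv, matDeriv_mul,
    matDeriv_mul, h2, toMat_loopDeriv]
  have h3 : matDeriv g.1 * g⁻¹.1 * (g.1 * toMat A * g⁻¹.1) = matDeriv g.1 * toMat A * g⁻¹.1 := by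
    calc _ = matDeriv g.1 * (g⁻¹.1 * g.1) * toMat A * g⁻¹.1 := by simp only [Matrix.mul_assoc]
      _ = _ := by rw [e, Matrix.mul_one]
  rw [h3, Matrix.add_mul, Matrix.mul_neg]
  simp only [Matrix.mul_assoc]
  abel

/-- Conjugation as an automorphism of the Lie algebra `𝔤((z))` over `ℂ((z))`. -/
def lieEquiv (hg : IsGaugeAction F n g Φ Ψ c) : Loop 𝔤 ≃ₗ⁅ℂ⸨X⸩⁆ Loop 𝔤 where
  toFun := Φ
  map_add' := hg.map_add
  map_smul' := hg.map_series_smul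
  map_lie' {A B} := hg.map_lie A B
  invFun := Ψ
  left_inv := hg.left_inv
  right_inv := hg.right_inv

/-- An automorphism of the Lie algebra over ℂ((z)) preserves its Killing form, which is the base
change of the Killing form of `𝔤`. -/
lemma resPairing_map (hg : IsGaugeAction F n g Φ Ψ c) (A B : Loop 𝔤) :
    resPairing (Φ A) (Φ B) = resPairing A B := by
  have h1 : LinearMap.BilinForm.baseChange ℂ⸨X⸩ (killingForm ℂ 𝔤) =
      killingForm ℂ⸨X⸩ (Loop 𝔤) := (LieModule.traceForm_baseChange ..).symm
  have h2 := LieAlgebra.killingForm_of_equiv_apply hg.lieEquiv A B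
  unfold resPairing
  rw [h1]
  exact congrArg (fun f : ℂ⸨X⸩ => f.coeff (-1)) h2

/-- The series with `ε = 0` for `Y` and `-Y` give the conjugations. The series with `ε = 1` at the
zero connection gives minus the logarithmic derivative, whence `c = -S 0`. -/
lemma of_exp (hn : 1 ≤ n) {Y : Loop 𝔤} (hY : Y ∈ F.L n 0 1) (hE : IsExp (toMat Y) g.1) :
    ∃ Φ Ψ c, IsGaugeAction F n g Φ Ψ c ∧ ∀ A, HasZSum O (gseq Y 0 A) (Φ A) ∧
      HasZSum O (gseq Y 1 A) (Φ A - c) := by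
  have hy := Frame.powTendsto hn hY
  have hY' : -Y ∈ F.L n 0 1 := neg_mem hY
  obtain ⟨E', hE'⟩ := hy.neg.exists_isExp
  have e1 : g.1 * E' = 1 := hy.exp_mul_exp_neg hE hE'
  have e2 : E' = g⁻¹.1 := (Units.inv_eq_of_mul_eq_one_right e1).symm
  have e3 : g.1 * g⁻¹.1 = 1 := g.mul_inv
  have e4 : g⁻¹.1 * g.1 = 1 := g.inv_mul
  rw [e2, ← toMat_neg] at hE'
  choose Φ hΦ using Frame.exists_gseq_sum hn hY 0
  choose Ψ hΨ using Frame.exists_gseq_sum hn hY' 0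
  choose S hS using Frame.exists_gseq_sum hn hY 1
  have key : ∀ {Y : Loop 𝔤} {E : Matrix (Fin N) (Fin N) ℂ⸨X⸩} {ε : ℂ} {A S : Loop 𝔤},
      Y ∈ F.L n 0 1 → IsExp (toMat Y) E → HasZSum O (gseq Y ε A) S →
      E * toMat A - ε • matDeriv E = toMat S * E := by
    intro Y E ε A S hY hE hS
    obtain ⟨a, ha⟩ := Frame.exists_gseq_mem_O hY ε A
    exact exp_mul_toMat (Frame.powTendsto hn hY) hE hS ha (Frame.gseq_tendsto hn hY ε A)
  have kΦ : ∀ A, toMat (Φ A) = g.1 * toMat A * g⁻¹.1 := fun A => by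
    have := key hY hE (hΦ A)
    rw [mat_zero_smul, sub_zero] at this
    rw [this, Matrix.mul_assoc, e3, Matrix.mul_one]
  have kΨ : ∀ A, toMat (Ψ A) = g⁻¹.1 * toMat A * g.1 := fun A => by
    have := key hY' hE' (hΨ A)
    rw [mat_zero_smul, sub_zero] at this
    rw [this, Matrix.mul_assoc, e4, Matrix.mul_one]
  have kS : ∀ A, toMat (S A) = g.1 * toMat A * g⁻¹.1 - matDeriv g.1 * g⁻¹.1 := fun A => by
    have := key hY hE (hS A)
    rw [one_smul] at this
    rw [← Matrix.sub_mul, this, Matrix.mul_assoc, e3, Matrix.mul_one]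
  have hc : toMat (-S 0) = matDeriv g.1 * g⁻¹.1 := by
    rw [toMat_neg, kS, toMat_zero, Matrix.mul_zero, Matrix.zero_mul, zero_sub, neg_neg]
  have hYd : (1 : ℂ) • loopDeriv Y ∈ F.L n (-1) (0 + 1) := by
    rw [one_smul]; exact Frame.loopDeriv_mem_L hY
  refine ⟨Φ, Ψ, -S 0, ⟨kΦ, kΨ, hc, neg_mem ?_, neg_mem ?_, fun a h X hX => ?_, fun a h X hX => ?_⟩,
    fun A => ⟨hΦ A, ?_⟩⟩
  · have := Frame.hasZSum_sub_mem_L (a := -1) (h := 0) (hS 0) hY (zero_mem _) hYd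
    rwa [loop_sub_zero] at this
  · refine (hS 0).mem fun j => ?_
    cases j with
    | zero => exact zero_mem _
    | succ j =>
      have h1 : gseq Y 1 0 1 ∈ O 0 := by
        rw [gseq_one, loop_lie_zero, one_smul]
        exact _root_.sub_mem (zero_mem _) (loopDeriv_mem_O_zero hY.1)
      simpa using Frame.gseq_mem_O hY h1 0 j (by simp)
  · exact Frame.hasZSum_sub_mem_L (hΦ X) hY hX (by rw [zero_smul]; exact zero_mem _)
  · exact Frame.hasZSum_sub_mem_L (hΨ X) hY' hX (by rw [zero_smul]; exact zero_mem _)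
  · convert hS A
    apply toMat_injective
    rw [toMat_sub, kΦ, hc, kS]

end IsGaugeAction

variable {G : Subgroup (GL (Fin N) ℂ)} [LieAlgebra.IsSemisimple ℂ (lieAlg G)]
  {H : LieSubalgebra ℂ (lieAlg G)} [H.IsCartanSubalgebra] {Δ : (rootSystem H).Base}

/-- The required properties are stable under products and inverses. Hence the Campbell-Hausdorff
formula is not needed for the group generated by the exponentials. -/
lemma exists_isGaugeAction (F : Frame Δ) (hn : 1 ≤ n) (hg : g ∈ GU G Δ n) :
    ∃ Φ Ψ c, IsGaugeAction F n g Φ Ψ c := by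
  induction hg using Subgroup.closure_induction with
  | mem g hg =>
    obtain ⟨Y, hY, hE⟩ := hg
    obtain ⟨Φ, Ψ, c, h, -⟩ := IsGaugeAction.of_exp hn (Frame.mem_unipLoops.mp hY) hE
    exact ⟨Φ, Ψ, c, h⟩
  | one => exact ⟨_, _, _, .one⟩
  | mul g g' _ _ h h' =>
    obtain ⟨_, _, _, h⟩ := h
    obtain ⟨_, _, _, h'⟩ := h'
    exact ⟨_, _, _, h.mul h'⟩
  | inv g _ h =>
    obtain ⟨_, _, _, h⟩ := h
    exact ⟨_, _, _, h.inv⟩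

/-- Gauge transformations by exponentials. -/
lemma exists_gauge_exp (F : Frame Δ) (hn : 1 ≤ n) {Y : Loop (lieAlg G)} (hY : Y ∈ F.L n 0 1) :
    ∃ g ∈ GU G Δ n, ∀ A S : Loop (lieAlg G), HasZSum O (gseq Y 1 A) S →
      toMat S = gauge g (toMat A) := by
  have hy := Frame.powTendsto hn hY
  obtain ⟨E, hE⟩ := hy.exists_isExp
  obtain ⟨E', hE'⟩ := hy.neg.exists_isExp
  have e1 : E * E' = 1 := hy.exp_mul_exp_neg hE hE'
  let g : GL (Fin N) ℂ⸨X⸩ := ⟨E, E', e1, mul_eq_one_comm.mp e1⟩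
  obtain ⟨Φ, Ψ, c, h, hS⟩ := IsGaugeAction.of_exp (g := g) hn hY hE
  refine ⟨g, Subgroup.subset_closure ⟨Y, Frame.mem_unipLoops.mpr hY, hE⟩, fun A S hAS => ?_⟩
  rw [h.gauge_eq, hAS.loop_unique (hS A).2]

end GroupAction

/-! ### Regular semisimple elements of the Borel subalgebra -/

section RegularSemisimple

variable {𝔤 : Type*} [LieRing 𝔤] [LieAlgebra ℂ 𝔤]

lemma IsRegularSemisimple.map {x : 𝔤} (hx : IsRegularSemisimple x) (σ : 𝔤 ≃ₗ⁅ℂ⁆ 𝔤) :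
    IsRegularSemisimple (σ x) := by
  obtain ⟨h1, K, hK, hK'⟩ := hx
  refine ⟨?_, K.map σ.toLieHom, ?_, fun y => ?_⟩
  · refine (LinearEquiv.isSemisimple_iff (ad ℂ 𝔤 x) (ad ℂ 𝔤 (σ x)) σ.toLinearEquiv ?_).mp h1
    ext y
    exact σ.toLieHom.map_lie x y
  · refine ⟨?_, ?_⟩
    · have := hK.nilpotent
      exact (LieEquiv.lieSubalgebraMap K σ).symm.injective.lieAlgebra_isNilpotent
        (f := (LieEquiv.lieSubalgebraMap K σ).symm.toLieHom)
    · refine le_antisymm (fun y hy => ?_) (LieSubalgebra.le_normalizer _)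
      rw [LieSubalgebra.mem_normalizer_iff] at hy
      have h2 : σ.symm y ∈ K.normalizer := by
        rw [LieSubalgebra.mem_normalizer_iff]
        intro z hz
        obtain ⟨w, hw, hw'⟩ := hy (σ z) ⟨z, hz, rfl⟩
        have : w = ⁅σ.symm y, z⁆ := by
          apply σ.injective
          show σ.toLieHom w = σ.toLieHom ⁅σ.symm y, z⁆
          rw [LieHom.map_lie]
          refine hw'.trans ?_
          congr 1
          exact (σ.apply_symm_apply y).symm
        rwa [← this]
      rw [hK.self_normalizing] at h2
      exact ⟨_, h2, σ.apply_symm_apply y⟩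
  · constructor
    · rintro ⟨z, hz, rfl⟩
      have := (hK' z).mp hz
      show ⁅σ x, σ z⁆ = 0
      rw [← LieEquiv.map_lie, this]
      exact σ.toLieHom.map_zero
    · intro hy
      refine ⟨σ.symm y, (hK' _).mpr ?_, σ.apply_symm_apply y⟩
      apply σ.injective
      show σ.toLieHom ⁅x, σ.symm y⁆ = σ.toLieHom 0
      rw [LieHom.map_lie, map_zero, ← hy]
      congr 1
      exact σ.apply_symm_apply y

variable [FiniteDimensional ℂ 𝔤] [LieAlgebra.IsSemisimple ℂ 𝔤] {H : LieSubalgebra ℂ 𝔤}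
  [H.IsCartanSubalgebra] {Δ : (rootSystem H).Base} (F : Frame Δ)

namespace Frame

lemma ad_pow_mem_V {k h : ℤ} {w x : 𝔤} (hw : w ∈ F.V k) (hx : x ∈ F.V h) (j : ℕ) :
    (ad ℂ 𝔤 w ^ j) x ∈ F.V (h + j * k) := by
  induction j with
  | zero => simpa using hx
  | succ j ih =>
    rw [pow_succ', Module.End.mul_apply, ad_apply]
    have := F.lie_mem_V hw ih
    rwa [show k + (h + j * k) = h + ((j + 1 : ℕ) : ℤ) * k by push_cast; ring] at this

lemma ad_pow_eq_zero {w : 𝔤} (hw : w ∈ F.V 1) {j : ℕ} (hj : 2 * F.m < j) : ad ℂ 𝔤 w ^ j = 0 := by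
  ext x
  exact F.eq_zero_of_mem_V (by omega) (F.ad_pow_mem_V hw (F.mem_V_of_le le_rfl x) j)

/-- The automorphism `exp (ad w)` for nilpotent `w`. -/
lemma exists_exp {k : ℤ} (hk : 1 ≤ k) {w : 𝔤} (hw : w ∈ F.V k) :
    ∃ σ : 𝔤 ≃ₗ⁅ℂ⁆ 𝔤, ∀ x ∈ F.V 0, σ x - (x + ⁅w, x⁆) ∈ F.V (k + 1) := by
  -- `LieDerivation.exp` works over ℚ, hence the restriction of scalars.
  let _ : Module ℚ 𝔤 := Module.compHom 𝔤 (algebraMap ℚ ℂ)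
  let _ : LieAlgebra ℚ 𝔤 := { lie_smul := fun t x y => lie_smul (algebraMap ℚ ℂ t) x y }
  have hw1 : w ∈ F.V 1 := F.V_anti hk hw
  have hz : ad ℂ 𝔤 w ^ (2 * F.m + 2) = 0 := F.ad_pow_eq_zero hw1 (by omega)
  have had : (LieDerivation.ad ℂ 𝔤 w).toLinearMap = ad ℂ 𝔤 w :=
    LieDerivation.coe_ad_apply_eq_ad_apply w
  have hnil : IsNilpotent (LieDerivation.ad ℂ 𝔤 w).toLinearMap := ⟨2 * F.m + 2, by rw [had, hz]⟩
  refine ⟨LieDerivation.exp _ hnil, fun x hx => ?_⟩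
  have h1 : LieDerivation.exp _ hnil x = (IsNilpotent.exp (ad ℂ 𝔤 w)) x := by
    rw [← had]
    exact LieDerivation.exp_map_apply _ hnil x
  rw [h1, IsNilpotent.exp_eq_sum hz, Finset.sum_range_succ', Finset.sum_range_succ']
  simp only [LinearMap.add_apply, LinearMap.sum_apply, LinearMap.smul_apply]
  have h2 : ∑ j ∈ Finset.range (2 * F.m), (((j + 1 + 1).factorial : ℚ))⁻¹ •
      (ad ℂ 𝔤 w ^ (j + 1 + 1)) x ∈ F.V (k + 1) := by
    refine sum_mem fun j _ => ?_
    have h3 := F.ad_pow_mem_V hw hx (j + 1 + 1)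
    have h4 : (((j + 1 + 1).factorial : ℚ))⁻¹ • (ad ℂ 𝔤 w ^ (j + 1 + 1)) x =
        (((j + 1 + 1).factorial : ℂ))⁻¹ • (ad ℂ 𝔤 w ^ (j + 1 + 1)) x := by
      rw [← Rat.cast_smul_eq_qsmul ℂ]
      push_cast
      rfl
    rw [h4]
    refine Submodule.smul_mem _ _ (F.V_anti ?_ h3)
    push_cast
    nlinarith
  convert h2 using 1
  simp
  abel

/-- The removal of the components of height `k` on which `proj x` acts without kernel. -/
lemma exists_reduced (k : ℕ) {x : 𝔤} (hx : x ∈ F.V 0) :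
    ∃ σ : 𝔤 ≃ₗ⁅ℂ⁆ 𝔤, σ x - F.proj x ∈ F.V 1 ∧
      ∀ i, F.ht i ≤ k → F.wt i x ≠ 0 → F.b.repr (σ x) i = 0 := by
  induction k with
  | zero =>
    refine ⟨LieEquiv.refl, F.sub_proj_mem_V hx, fun i hi hi' => ?_⟩
    rcases hi.lt_or_eq with h | h
    · exact hx i (by simpa using h)
    · exact absurd (F.wt_of_ht_eq_zero (by simpa using h) x) hi'
  | succ k ih =>
    obtain ⟨σ, h1, h2⟩ := ih
    set y := σ x
    have hy : y ∈ F.V 0 := by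
      have := add_mem (F.V_anti (show (0 : ℤ) ≤ 1 by omega) h1)
        (F.H_le_V (le_refl 0) (F.proj_mem x))
      rwa [sub_add_cancel] at this
    -- `w` is chosen such that `⁅w, F.proj x⁆` cancels the components of height `k + 1` of `y` on
    -- which `F.proj x` acts invertibly. All other contributions in this step have larger height.
    let w : 𝔤 := ∑ i, if F.ht i = k + 1 ∧ F.wt i x ≠ 0 then
      ((F.wt i x)⁻¹ * F.b.repr y i) • F.b i else 0
    have hwr : ∀ i, F.b.repr w i = if F.ht i = k + 1 ∧ F.wt i x ≠ 0 then
      (F.wt i x)⁻¹ * F.b.repr y i else 0 := by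
      intro i
      simp only [w, map_sum, Finsupp.coe_finsetSum, Finset.sum_apply]
      rw [Finset.sum_eq_single i]
      · split_ifs <;> simp
      · intro j _ hj
        split_ifs <;> simp [hj]
      · simp
    have hw : w ∈ F.V (k + 1) := fun i hi => by rw [hwr, if_neg (by omega)]
    obtain ⟨τ, hτ⟩ := F.exists_exp (by omega) hw
    have h3 := hτ y hy
    have h4 : ⁅w, y - F.proj x⁆ ∈ F.V (k + 1 + 1) := F.lie_mem_V hw h1
    have h5 : ∀ i, F.ht i < k + 1 + 1 → F.b.repr (τ y) i =
        F.b.repr y i - F.wt i x * F.b.repr w i := by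
      intro i hi
      have e1 := h3 i hi
      have e2 := h4 i hi
      have e3 := F.repr_lie_of_mem (F.proj_mem x) w i
      rw [F.wt_proj, ← lie_skew] at e3
      simp only [map_sub, map_add, map_neg, lie_sub, Finsupp.sub_apply, Finsupp.add_apply,
        Finsupp.neg_apply] at e1 e2 e3
      linear_combination e1 + e2 - e3
    refine ⟨σ.trans τ, ?_, fun i hi hi' => ?_⟩
    · have h6 : ⁅w, y⁆ ∈ F.V (k + 1) := by simpa using F.lie_mem_V hw hy
      have := add_mem (add_mem (F.V_anti (by omega) h3) (F.V_anti (show (1 : ℤ) ≤ k + 1 by omega) h6)) h1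
      convert this using 1
      rw [LieEquiv.trans_apply]
      abel
    · rw [LieEquiv.trans_apply, h5 i (by push_cast at hi; omega), hwr]
      split_ifs with h
      · rw [mul_inv_cancel_left₀ hi', sub_self]
      · have : F.ht i ≤ k := by
          push_cast at hi
          by_contra h'
          exact h ⟨by omega, hi'⟩
        rw [h2 i this hi', mul_zero, sub_zero]

lemma lie_eq_zero_iff {x y : 𝔤} (hx : x ∈ H) (hx' : ∀ i, F.ht i ≠ 0 → F.wt i x ≠ 0) :
    ⁅x, y⁆ = 0 ↔ y ∈ H := by
  rw [F.mem_H_iff]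
  constructor
  · intro h i hi
    have := F.repr_lie_of_mem hx y i
    rw [h, map_zero, Finsupp.zero_apply] at this
    exact (mul_eq_zero.mp this.symm).resolve_left (hx' i hi)
  · intro h
    apply F.b.ext_elem
    intro i
    rw [F.repr_lie_of_mem hx, map_zero, Finsupp.zero_apply]
    by_cases hi : F.ht i = 0
    · rw [F.wt_of_ht_eq_zero hi, zero_mul]
    · rw [h i hi, mul_zero]

/-- Regular semisimple elements of the Borel subalgebra. -/
lemma isRegularSemisimple_iff {x : 𝔤} (hx : x ∈ F.V 0) :
    IsRegularSemisimple x ↔ ∀ i, F.ht i ≠ 0 → F.wt i x ≠ 0 := by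
  obtain ⟨σ, h1, h2⟩ := F.exists_reduced F.m hx
  replace h2 : ∀ i, F.wt i x ≠ 0 → F.b.repr (σ x) i = 0 := fun i => h2 i (F.ht_le i).2
  constructor
  · intro hreg
    have hσ := hreg.map σ
    set y := σ x
    -- Only components of weight zero on `F.proj x` have survived the reduction.
    have hcomm : ⁅F.proj x, y - F.proj x⁆ = 0 := by
      apply F.b.ext_elem
      intro i
      rw [F.repr_lie_of_mem (F.proj_mem x), F.wt_proj, map_zero, Finsupp.zero_apply, mul_eq_zero]
      by_cases hi : F.wt i x = 0
      · exact Or.inl hi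
      · right
        rw [map_sub, Finsupp.sub_apply, h2 i hi, F.repr_proj, if_neg, sub_zero]
        exact fun h => hi (F.wt_of_ht_eq_zero h x)
    have hcomm' : ⁅y, F.proj x⁆ = 0 := by
      rw [lie_sub, lie_self, sub_zero] at hcomm
      rw [← lie_skew, hcomm, neg_zero]
    have hc : Commute (ad ℂ 𝔤 y) (ad ℂ 𝔤 (F.proj x)) := by
      rw [commute_iff_lie_eq, ← LieHom.map_lie, hcomm', map_zero]
    have hss : (ad ℂ 𝔤 (y - F.proj x)).IsSemisimple := by
      rw [map_sub]
      exact Module.End.IsSemisimple.sub_of_commute hc hσ.1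
        (isSemisimple_ad_of_mem_isCartanSubalgebra (H := H) (F.proj_mem x))
    have hnil : IsNilpotent (ad ℂ 𝔤 (y - F.proj x)) := ⟨_, F.ad_pow_eq_zero h1 (Nat.lt_succ_self _)⟩
    -- As a difference of commuting semisimple maps, `ad (y - F.proj x)` is semisimple; by height it
    -- is nilpotent. So it vanishes, and the centre of `𝔤` is trivial.
    have hz := Module.End.eq_zero_of_isNilpotent_isSemisimple hnil hss
    have hyx : y = F.proj x := by
      have : y - F.proj x ∈ LieAlgebra.center ℂ 𝔤 := by
        rw [LieModule.mem_maxTrivSubmodule]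
        intro z
        rw [← lie_skew, ← ad_apply (R := ℂ), hz, LinearMap.zero_apply, neg_zero]
      rw [LieAlgebra.center_eq_bot, LieSubmodule.mem_bot] at this
      exact sub_eq_zero.mp this
    obtain ⟨-, K, hK, hK'⟩ := hσ
    intro i hi h0
    rw [hyx] at hK'
    -- If `wt i` vanished, the Cartan subalgebra `K` would contain `b i` and `rho`. By nilpotency of
    -- `K`, `rho` would act nilpotently on it, but `b i` is an eigenvector for the nonzero
    -- eigenvalue `ht i`.
    have hb : F.b i ∈ K := by
      rw [hK', F.lie_b _ (F.proj_mem x), F.wt_proj, h0, zero_smul]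
    have hr : F.rho ∈ K := by
      rw [hK']
      exact lie_eq_zero_of_mem (F.proj_mem x) F.rho_mem
    have := hK.nilpotent
    obtain ⟨k, hk⟩ := LieModule.isNilpotent_toEnd_of_isNilpotent ℂ K K (⟨F.rho, hr⟩ : K)
    have h3 : ∀ k : ℕ, (LieModule.toEnd ℂ K K ⟨F.rho, hr⟩ ^ k) ⟨F.b i, hb⟩ =
        ((F.ht i : ℂ) ^ k) • (⟨F.b i, hb⟩ : K) := by
      intro k
      induction k with
      | zero => simp
      | succ k ih =>
        rw [pow_succ', Module.End.mul_apply, ih, map_smul, pow_succ, mul_smul]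
        congr 1
        apply Subtype.ext
        have := F.lie_b _ F.rho_mem i
        rw [F.wt_rho] at this
        exact this
    have h4 := h3 k
    rw [hk, LinearMap.zero_apply] at h4
    have h5 : ((F.ht i : ℂ) ^ k) • F.b i = 0 := (congrArg Subtype.val h4).symm
    rcases smul_eq_zero.mp h5 with h6 | h6
    · exact hi (by exact_mod_cast eq_zero_of_pow_eq_zero h6)
    · exact F.b.ne_zero i h6
  · intro h
    have hyx : σ x = F.proj x := by
      apply F.b.ext_elem
      intro i
      rw [F.repr_proj]
      split_ifs with hi
      · have := h1 i (by omega)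
        rw [map_sub, Finsupp.sub_apply, F.repr_proj, if_pos hi] at this
        exact sub_eq_zero.mp this
      · exact h2 i (h i hi)
    have h3 : IsRegularSemisimple (σ x) := by
      rw [hyx]
      refine ⟨isSemisimple_ad_of_mem_isCartanSubalgebra (H := H) (F.proj_mem x), H, inferInstance,
        fun y => (F.lie_eq_zero_iff (F.proj_mem x) fun i hi => ?_).symm⟩
      rw [F.wt_proj]
      exact h i hi
    have := h3.map σ.symm
    rwa [LieEquiv.symm_apply_apply] at this

end Frame

end RegularSemisimple

/-! ### Multiplication by powers of z -/

section Shift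

variable {𝔤 : Type*} [LieRing 𝔤] [LieAlgebra ℂ 𝔤]

lemma coeff_single_smul (k m : ℤ) (X : Loop 𝔤) :
    coeff m (HahnSeries.single k (1 : ℂ) • X) = coeff (m - k) X := by
  induction X using TensorProduct.induction_on with
  | zero =>
    have : HahnSeries.single k (1 : ℂ) • (0 : Loop 𝔤) = 0 := smul_zero (A := Loop 𝔤) _
    rw [this, map_zero, map_zero]
  | add X Y hX hY =>
    have : HahnSeries.single k (1 : ℂ) • (X + Y : Loop 𝔤) = HahnSeries.single k (1 : ℂ) • X +
      HahnSeries.single k (1 : ℂ) • Y := smul_add (A := Loop 𝔤) _ _ _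
    rw [this, map_add, map_add, hX, hY]
  | tmul f x =>
    rw [TensorProduct.smul_tmul', coeff_tmul, coeff_tmul, smul_eq_mul, HahnSeries.coeff_single_mul,
      one_mul]

lemma mono_eq_single_smul (k : ℤ) (x : 𝔤) :
    mono k x = HahnSeries.single k (1 : ℂ) • mono 0 x := by
  rw [mono_apply, mono_apply, TensorProduct.smul_tmul', smul_eq_mul, HahnSeries.single_mul_single,
    add_zero, one_mul]

lemma mono_lie_mono_zero (x y : 𝔤) : mono 0 ⁅x, y⁆ = ⁅mono 0 x, mono 0 y⁆ := by
  rw [mono_apply, mono_apply, mono_apply, LieAlgebra.ExtendScalars.bracket_tmul,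
    HahnSeries.single_mul_single, add_zero, one_mul]

lemma sub_sum_mono_mem_O {a b : ℤ} {X : Loop 𝔤} (hX : X ∈ O a) :
    X - ∑ k ∈ Finset.Ico a b, mono k (coeff k X) ∈ O b := by
  intro m hm
  rw [coeff_sub, map_sum]
  simp only [coeff_mono]
  rw [Finset.sum_ite_eq]
  split_ifs with h
  · rw [sub_self]
  · rw [Finset.mem_Ico] at h
    rw [hX m (by omega), sub_zero]

lemma loop_sum_sub {ι : Type*} (s : Finset ι) (f f' : ι → Loop 𝔤) :
    ∑ i ∈ s, (f i - f' i) = ∑ i ∈ s, f i - ∑ i ∈ s, f' i :=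
  Finset.sum_sub_distrib f f'

end Shift

/-! ### Gauge transformations between connections with polar part in `H` -/

section Uniqueness

variable {N : ℕ} {𝔤 : LieSubalgebra ℂ (Matrix (Fin N) (Fin N) ℂ)} [LieAlgebra.IsSemisimple ℂ 𝔤]
  {H : LieSubalgebra ℂ 𝔤} [H.IsCartanSubalgebra] {Δ : (rootSystem H).Base} {F : Frame Δ} {n : ℕ}

namespace IsGaugeAction

variable {g : GL (Fin N) ℂ⸨X⸩} {Φ Ψ : Loop 𝔤 → Loop 𝔤} {c : Loop 𝔤}

lemma coeff_map_mono (hg : IsGaugeAction F n g Φ Ψ c) (k m : ℤ) (x : 𝔤) :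
    coeff m (Φ (mono k x)) = coeff (m - k) (Φ (mono 0 x)) := by
  rw [mono_eq_single_smul, hg.map_series_smul, coeff_single_smul]

lemma map_sum (hg : IsGaugeAction F n g Φ Ψ c) {ι : Type*} (s : Finset ι) (f : ι → Loop 𝔤) :
    Φ (∑ i ∈ s, f i) = ∑ i ∈ s, Φ (f i) :=
  _root_.map_sum (hg.lieEquiv : Loop 𝔤 →ₗ[ℂ⸨X⸩] Loop 𝔤) f s

/-- `Φ` is linear over ℂ((z)), so its deviation from the identity is controlled on constants. The
coefficients of `X` from z^(a + j) on lie in `O (a + j)` anyway, so finitely many monomials suffice.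
-/
lemma sub_mem_O (hg : IsGaugeAction F n g Φ Ψ c) {j : ℤ}
    (hj : ∀ x, Φ (mono 0 x) - mono 0 x ∈ O j) {a : ℤ} {X : Loop 𝔤} (hX : X ∈ O a) :
    Φ X - X ∈ O (a + j) := by
  have h1 := sub_sum_mono_mem_O (b := a + j) hX
  set R := X - ∑ k ∈ Finset.Ico a (a + j), mono k (coeff k X)
  have hXR : X = R + ∑ k ∈ Finset.Ico a (a + j), mono k (coeff k X) := (sub_add_cancel _ _).symm
  have h2 : Φ X - X = (Φ R - R) + ∑ k ∈ Finset.Ico a (a + j),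
      (Φ (mono k (coeff k X)) - mono k (coeff k X)) := by
    rw [loop_sum_sub, ← hg.map_sum]
    conv_lhs => rw [hXR, hg.map_add]
    abel
  rw [h2]
  refine add_mem (_root_.sub_mem (hg.map_mem_O h1) h1) (sum_mem fun k hk m hm => ?_)
  rw [Finset.mem_Ico] at hk
  have h3 := hj (coeff k X) (m - k) (by omega)
  rw [coeff_sub, coeff_mono] at h3 ⊢
  simp only [sub_eq_zero (b := k)] at h3
  rw [hg.coeff_map_mono, h3]

/-- On constants the conjugation solves a linear differential equation with coefficient `ad c`; this
links its Taylor coefficients to those of `c`. -/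
lemma loopDeriv_const (hg : IsGaugeAction F n g Φ Ψ c) (x : 𝔤) :
    loopDeriv (Φ (mono 0 x)) = ⁅c, Φ (mono 0 x)⁆ := by
  rw [hg.loopDeriv_map, loopDeriv_mono, Int.cast_zero, zero_smul]
  have h0 : Φ 0 = 0 := by simpa using hg.map_sum (∅ : Finset ℕ) (fun _ => 0)
  rw [h0, zero_add]

/-- The constant term of the conjugation is trivial if it maps a regular element of `H` to `H`. -/
lemma const_sub_mem_O_one (hg : IsGaugeAction F n g Φ Ψ c) (hn : 1 ≤ n) {x : 𝔤} (hx : x ∈ H)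
    (hreg : ∀ i, F.ht i ≠ 0 → F.wt i x ≠ 0) (hx' : coeff 0 (Φ (mono 0 x)) ∈ H) (y : 𝔤) :
    Φ (mono 0 y) - mono 0 y ∈ O 1 := by
  let φ : 𝔤 → 𝔤 := fun y => coeff 0 (Φ (mono 0 y))
  have hO : ∀ y : 𝔤, Φ (mono 0 y) ∈ O 0 := fun y => hg.map_mem_O (mono_mem_O le_rfl y)
  have hlie : ∀ y z, φ ⁅y, z⁆ = ⁅φ y, φ z⁆ := by
    intro y z
    have := coeff_lie_lowest (hO y) (hO z)
    simp only [φ]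
    rw [mono_lie_mono_zero, hg.map_lie, ← this, add_zero]
  have hadd : ∀ y z, φ (y + z) = φ y + φ z := fun y z => by
    simp only [φ]
    rw [_root_.map_add, hg.map_add, _root_.map_add]
  have hsmul : ∀ (t : ℂ) z, φ (t • z) = t • φ z := fun y z => by
    simp only [φ]
    rw [_root_.map_smul, hg.map_smul, _root_.map_smul]
  have hV : ∀ (h : ℤ), ∀ y ∈ F.V h, φ y - y ∈ F.V (h + 1) := by
    intro h y hy
    have := (hg.sub_mem 0 h _ (Frame.mono_mem_L hy 0)).2 0 (by omega)
    rwa [coeff_sub, coeff_mono, if_pos rfl] at this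
  have hxx : φ x = x := by
    refine sub_eq_zero.mp (F.eq_zero_of_mem_of_mem_V (_root_.sub_mem hx' hx) ?_)
    exact hV 0 x (F.H_le_V le_rfl hx)
  -- `φ y` commutes with `φ x = x`, which is regular, so it lies in `H`; and it differs from `y` by
  -- an element of `F.V 1`.
  have hH : ∀ y ∈ H, φ y = y := by
    intro y hy
    have h1 : φ y ∈ H := by
      rw [← F.lie_eq_zero_iff hx hreg, ← hxx, ← hlie, Frame.lie_eq_zero_of_mem hx hy]
      have := hsmul 0 0
      rwa [zero_smul, zero_smul] at this
    refine sub_eq_zero.mp (F.eq_zero_of_mem_of_mem_V (_root_.sub_mem h1 hy) ?_)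
    exact hV 0 y (F.H_le_V le_rfl hy)
  -- Since `φ` fixes `rho`, the difference `φ (b i) - b i` is homogeneous of height `ht i`, while
  -- `φ` changes `b i` only in larger heights.
  have hb : ∀ i, φ (F.b i) = F.b i := by
    intro i
    have h1 : ⁅F.rho, φ (F.b i) - F.b i⁆ = (F.ht i : ℂ) • (φ (F.b i) - F.b i) := by
      have h2 := F.lie_b _ F.rho_mem i
      rw [F.wt_rho] at h2
      have h3 := hlie F.rho (F.b i)
      rw [hH _ F.rho_mem, h2, hsmul] at h3
      rw [lie_sub, ← h3, h2, smul_sub]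
    refine sub_eq_zero.mp (F.b.ext_elem fun j => ?_)
    rw [map_zero, Finsupp.zero_apply]
    by_cases hj : F.ht j < F.ht i + 1
    · exact hV (F.ht i) _ (F.b_mem_V le_rfl) j hj
    · have h4 := F.repr_rho_lie (φ (F.b i) - F.b i) j
      rw [h1, _root_.map_smul, Finsupp.smul_apply, smul_eq_mul] at h4
      have h5 : ((F.ht j : ℂ) - F.ht i) * F.b.repr (φ (F.b i) - F.b i) j = 0 := by
        linear_combination -h4
      refine (mul_eq_zero.mp h5).resolve_left fun h6 => hj ?_
      have : F.ht j = F.ht i := by exact_mod_cast sub_eq_zero.mp h6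
      omega
  have hφ : ∀ y, φ y = y := by
    let φL : 𝔤 →ₗ[ℂ] 𝔤 := ⟨⟨φ, hadd⟩, hsmul⟩
    have : φL = LinearMap.id := F.b.ext hb
    exact fun y => LinearMap.congr_fun this y
  intro k hk
  rcases (show k < 0 ∨ k = 0 by omega) with h | rfl
  · rw [coeff_sub, hO y k h, mono_mem_O (le_refl 0) y k h, sub_zero]
  · rw [coeff_sub, coeff_mono, if_pos rfl]
    exact sub_eq_zero.mpr (hφ y)

/-- In the differential equation, the bracket of `c` with `Φ x - x` has order at least `2 j - 1`.
Below this order only `⁅c, x⁆` is left on the right. -/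
lemma smul_coeff_const (hg : IsGaugeAction F n g Φ Ψ c) {j : ℕ}
    (hΦ : ∀ x, Φ (mono 0 x) - mono 0 x ∈ O (j : ℤ)) (hc : c ∈ O ((j : ℤ) - 1)) (i : ℕ)
    (hi : i < 2 * j) (x : 𝔤) :
    (i : ℂ) • coeff i (Φ (mono 0 x)) = ⁅coeff ((i : ℤ) - 1) c, x⁆ := by
  have h1 := congrArg (coeff ((i : ℤ) - 1)) (hg.loopDeriv_const x)
  have h2 : Φ (mono 0 x) = mono 0 x + (Φ (mono 0 x) - mono 0 x) := by abel
  have h3 : coeff ((i : ℤ) - 1) ⁅c, Φ (mono 0 x) - mono 0 x⁆ = 0 :=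
    lie_mem_O hc (hΦ x) _ (by omega)
  have h4 : coeff ((i : ℤ) - 1) ⁅c, mono 0 x⁆ = ⁅coeff ((i : ℤ) - 1) c, x⁆ := by
    rw [← loop_lie_skew, coeff_neg, coeff_mono_lie, sub_zero, lie_skew]
  conv_rhs at h1 => rw [h2, loop_lie_add, _root_.map_add, h3, add_zero, h4]
  rw [← h1, coeff_loopDeriv, sub_add_cancel]
  congr 1
  push_cast
  ring

variable {B : Loop 𝔤}

/-- Induction on `j`. If `Φ` is trivial modulo z^j, its next coefficient is `ad (c_{j-1}) / j`. It
must map the leading coefficient `x` into `H`, while `c_{j-1}` lies in the nilpotent part for `j <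
n`. So it commutes with `x`, and regularity of `x` forces it to vanish. -/
lemma trivial_of_polar_mem (hg : IsGaugeAction F n g Φ Ψ c) (hn : 1 ≤ n) (hB : B ∈ O (-n : ℤ))
    (hBH : ∀ k < 0, coeff k B ∈ H) (hreg : ∀ i, F.ht i ≠ 0 → F.wt i (coeff (-n) B) ≠ 0)
    (hB' : ∀ k < 0, coeff k (Φ B - c) ∈ H) (j : ℕ) (hj : 1 ≤ j) (hjn : j ≤ n) :
    (∀ x, Φ (mono 0 x) - mono 0 x ∈ O (j : ℤ)) ∧ c ∈ O ((j : ℤ) - 1) := by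
  set x := coeff (-n) B
  have hxH : x ∈ H := hBH _ (by omega)
  -- At order `-n + j` only the leading term of `B` is affected by `Φ`, and `c` has no pole, so the
  -- polar condition on the image controls `Φ x` in degree `j`.
  have hlead : ∀ j : ℕ, j < n → (∀ x, Φ (mono 0 x) - mono 0 x ∈ O (j : ℤ)) →
      coeff j (Φ (mono 0 x)) ∈ H := by
    intro j hj hΦ
    have h1 := sub_sum_mono_mem_O (b := -n + 1) hB
    rw [show Finset.Ico (-n : ℤ) (-n + 1) = {-(n : ℤ)} by ext; simp; omega,
      Finset.sum_singleton] at h1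
    have h2 := hg.sub_mem_O hΦ h1 (-n + j) (by omega)
    have h3 : coeff (-n + j) (Φ B) ∈ H := by
      have := add_mem (hB' (-n + j) (by omega)) (zero_mem H)
      rwa [coeff_sub, hg.mem_O _ (by omega), sub_zero, add_zero] at this
    have h4 := hBH (-n + j) (by omega)
    rw [hg.map_sub, coeff_sub, coeff_sub, coeff_sub, hg.coeff_map_mono, coeff_mono] at h2
    have h5 : coeff j (Φ (mono 0 x)) = coeff (-n + j) (Φ B) -
        (coeff (-n + j) B - if (-n + j : ℤ) = -n then x else 0) := by
      have := sub_eq_zero.mp h2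
      rw [show (-n + j - -n : ℤ) = j by ring] at this
      rw [← this, sub_sub_cancel]
    rw [h5]
    refine _root_.sub_mem h3 (_root_.sub_mem h4 ?_)
    split_ifs
    · exact hxH
    · exact zero_mem _
  induction j, hj using Nat.le_induction with
  | base =>
    have h0 : ∀ x, Φ (mono 0 x) - mono 0 x ∈ O ((0 : ℕ) : ℤ) := fun x =>
      _root_.sub_mem (hg.map_mem_O (mono_mem_O le_rfl x)) (mono_mem_O le_rfl x)
    refine ⟨fun y => ?_, by simpa using hg.mem_O⟩
    have := hg.const_sub_mem_O_one hn hxH hreg (by simpa using hlead 0 (by omega) h0) y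
    simpa using this
  | succ j hj ih =>
    obtain ⟨ih1, ih2⟩ := ih (by omega)
    have h1 := hg.smul_coeff_const ih1 ih2 j (by omega)
    have hj0 : (j : ℂ) ≠ 0 := by exact_mod_cast (by omega : j ≠ 0)
    have h2 : ⁅coeff ((j : ℤ) - 1) c, x⁆ ∈ H := by
      rw [← h1]
      exact H.smul_mem _ (hlead j (by omega) ih1)
    have h3 : coeff ((j : ℤ) - 1) c ∈ F.V 1 := hg.mem_L.2 _ (by omega)
    have h4 : ⁅coeff ((j : ℤ) - 1) c, x⁆ = 0 :=
      F.eq_zero_of_mem_of_mem_V h2 (F.lie_mem_V h3 (F.H_le_V le_rfl hxH))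
    have h5 : coeff ((j : ℤ) - 1) c = 0 := by
      refine F.eq_zero_of_mem_of_mem_V ((F.lie_eq_zero_iff hxH hreg).mp ?_) h3
      rw [← lie_skew, h4, neg_zero]
    refine ⟨fun y k hk => ?_, fun k hk => ?_⟩
    · rcases (show k < j ∨ k = j by push_cast at hk; omega) with h | rfl
      · exact ih1 y k h
      · have := h1 y
        rw [h5, zero_lie] at this
        rw [coeff_sub, coeff_mono, if_neg (by omega), sub_zero]
        exact (smul_eq_zero.mp this).resolve_left hj0
    · rcases (show k < (j : ℤ) - 1 ∨ k = (j : ℤ) - 1 by push_cast at hk; omega) with h | rfl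
      · exact ih2 k h
      · exact h5

/-- Gauge transformations do not change the `H`-parts of the coefficients of connections with polar
part in `H`. -/
lemma proj_coeff_eq (hg : IsGaugeAction F n g Φ Ψ c) (hn : 1 ≤ n) (hB : B ∈ O (-n : ℤ))
    (hBH : ∀ k < 0, coeff k B ∈ H) (hreg : ∀ i, F.ht i ≠ 0 → F.wt i (coeff (-n) B) ≠ 0)
    (hB' : ∀ k < 0, coeff k (Φ B - c) ∈ H) {m : ℤ} (hm : m ≤ n - 2) :
    F.proj (coeff m (Φ B - c)) = F.proj (coeff m B) := by
  obtain ⟨h1, h2⟩ := hg.trivial_of_polar_mem hn hB hBH hreg hB' n hn le_rfl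
  have h3 := sub_sum_mono_mem_O (b := 0) hB
  set R := B - ∑ k ∈ Finset.Ico (-n : ℤ) 0, mono k (coeff k B)
  have hBR : B = R + ∑ k ∈ Finset.Ico (-n : ℤ) 0, mono k (coeff k B) := (sub_add_cancel _ _).symm
  have h4 : Φ B - c = B + (Φ R - R) + ∑ k ∈ Finset.Ico (-n : ℤ) 0,
      (Φ (mono k (coeff k B)) - mono k (coeff k B)) - c := by
    rw [loop_sum_sub, ← hg.map_sum]
    have h5 : Φ B = Φ R + Φ (∑ k ∈ Finset.Ico (-n : ℤ) 0, mono k (coeff k B)) := by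
      conv_lhs => rw [hBR, hg.map_add]
    have h6 : ∑ k ∈ Finset.Ico (-n : ℤ) 0, mono k (coeff k B) = B - R := (sub_sub_cancel _ _).symm
    rw [h5, h6]
    abel
  have h5 : coeff m c = 0 := h2 m (by omega)
  have h6 : coeff m (Φ R - R) = 0 := hg.sub_mem_O h1 h3 m (by omega)
  rw [h4, coeff_sub, h5, sub_zero, _root_.map_add, _root_.map_add (coeff m) B, h6, add_zero,
    _root_.map_add, _root_.map_sum, _root_.map_sum, add_eq_left]
  refine Finset.sum_eq_zero fun k hk => ?_
  rw [Finset.mem_Ico] at hk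
  rw [coeff_sub, hg.coeff_map_mono, coeff_mono]
  -- The bound `m ≤ n - 2` and `k ≥ -n` give `i = m - k ≤ 2 n - 2`, within the range of
  -- `smul_coeff_const`. Brackets with elements of `H` have no component in `H`.
  have h7 : ∀ i : ℤ, i ≤ 2 * n - 2 → ∀ x ∈ H,
      F.proj (coeff i (Φ (mono 0 x)) - if i = 0 then x else 0) = 0 := by
    intro i hi x hx
    by_cases hin : i < n
    · have := h1 x i hin
      rw [coeff_sub, coeff_mono] at this
      rw [this, map_zero]
    · obtain ⟨j, rfl⟩ := Int.eq_ofNat_of_zero_le (show 0 ≤ i by omega)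
      have hj0 : (j : ℂ) ≠ 0 := by exact_mod_cast (by omega : j ≠ 0)
      have h8 := hg.smul_coeff_const h1 h2 j (by omega) x
      rw [if_neg (by omega), sub_zero]
      have h9 := congrArg F.proj h8
      rw [_root_.map_smul] at h9
      refine (smul_eq_zero.mp (h9.trans (F.proj_eq_zero fun i hi => ?_))).resolve_left hj0
      rw [← lie_skew, map_neg, Finsupp.neg_apply, F.repr_lie_of_mem hx, F.wt_of_ht_eq_zero hi,
        zero_mul, neg_zero]
  have := h7 (m - k) (by omega) _ (hBH k hk.2)
  simp only [sub_eq_zero (b := k)] at this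
  exact this

end IsGaugeAction

end Uniqueness

/-! ### Regular functions and regular families of loops -/

section RegularFunctions

variable {𝔤 : Type*} [LieRing 𝔤] [LieAlgebra ℂ 𝔤] [FiniteDimensional ℂ 𝔤]
  [LieAlgebra.IsSemisimple ℂ 𝔤] {H : LieSubalgebra ℂ 𝔤} [H.IsCartanSubalgebra]
  {Δ : (rootSystem H).Base} {n : ℕ}

variable (Δ n) in
/-- The regular functions on `Conn_n^B`. -/
def regFun : Subalgebra ℂ (connB Δ n → ℂ) where
  carrier := {φ | ∀ A : connB Δ n, ∃ P ∈ polyFun 𝔤, ∃ Q ∈ polyFun 𝔤, Q A.1 ≠ 0 ∧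
    ∀ A' : connB Δ n, Q A'.1 ≠ 0 → φ A' = P A'.1 / Q A'.1}
  mul_mem' := by
    intro φ ψ hφ hψ A
    obtain ⟨P, hP, Q, hQ, h1, h2⟩ := hφ A
    obtain ⟨P', hP', Q', hQ', h1', h2'⟩ := hψ A
    refine ⟨P * P', mul_mem hP hP', Q * Q', mul_mem hQ hQ', mul_ne_zero h1 h1', fun A' hA' => ?_⟩
    have := mul_ne_zero_iff.mp hA'
    rw [Pi.mul_apply, h2 A' this.1, h2' A' this.2, Pi.mul_apply, Pi.mul_apply, div_mul_div_comm]
  add_mem' := by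
    intro φ ψ hφ hψ A
    obtain ⟨P, hP, Q, hQ, h1, h2⟩ := hφ A
    obtain ⟨P', hP', Q', hQ', h1', h2'⟩ := hψ A
    refine ⟨P * Q' + Q * P', add_mem (mul_mem hP hQ') (mul_mem hQ hP'), Q * Q', mul_mem hQ hQ',
      mul_ne_zero h1 h1', fun A' hA' => ?_⟩
    have := mul_ne_zero_iff.mp hA'
    rw [Pi.add_apply, h2 A' this.1, h2' A' this.2, div_add_div _ _ this.1 this.2]
    rfl
  algebraMap_mem' c A := ⟨algebraMap ℂ _ c, Subalgebra.algebraMap_mem _ c, 1, one_mem _,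
    one_ne_zero, fun A' _ => by simp⟩

lemma mem_regFun_of_polyFun {P : Loop 𝔤 → ℂ} (hP : P ∈ polyFun 𝔤) :
    (fun A : connB Δ n => P A.1) ∈ regFun Δ n :=
  fun _ => ⟨P, hP, 1, one_mem _, one_ne_zero, fun A' _ => by simp⟩

lemma inv_mem_regFun {φ : connB Δ n → ℂ} (hφ : φ ∈ regFun Δ n) (h0 : ∀ A, φ A ≠ 0) :
    (fun A => (φ A)⁻¹) ∈ regFun Δ n := by
  intro A
  obtain ⟨P, hP, Q, hQ, h1, h2⟩ := hφ A
  have h3 : P A.1 ≠ 0 := by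
    have := h0 A
    rw [h2 A h1] at this
    exact (div_ne_zero_iff.mp this).1
  -- The extra factor `Q` in numerator and denominator restricts to the set where `φ = P / Q` is
  -- known.
  refine ⟨Q * Q, mul_mem hQ hQ, P * Q, mul_mem hP hQ, mul_ne_zero h3 h1, fun A' hA' => ?_⟩
  have := mul_ne_zero_iff.mp hA'
  have h4 := this.1
  have h5 := this.2
  show (φ A')⁻¹ = _
  rw [h2 A' h5, Pi.mul_apply, Pi.mul_apply]
  field_simp

/-- Regular maps from `Conn_n^B` to `𝔤`. -/
def RegVec (v : connB Δ n → 𝔤) : Prop := ∀ l : Dual ℂ 𝔤, (fun A => l (v A)) ∈ regFun Δ n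

/-- Maps from `Conn_n^B` to `𝔤((z))` with regular coefficients. -/
def RegLoop (B : connB Δ n → Loop 𝔤) : Prop := ∀ k, RegVec fun A => coeff k (B A)

variable {v w : connB Δ n → 𝔤} {B : connB Δ n → Loop 𝔤}

lemma const_mem_regFun (c : ℂ) : (fun _ => c) ∈ regFun Δ n := (regFun Δ n).algebraMap_mem c

lemma RegVec.const (x : 𝔤) : RegVec (fun _ : connB Δ n => x) := fun _ => const_mem_regFun _

lemma RegVec.add (hv : RegVec v) (hw : RegVec w) : RegVec fun A => v A + w A := fun l => by
  simp only [map_add]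
  exact add_mem (hv l) (hw l)

lemma RegVec.sub (hv : RegVec v) (hw : RegVec w) : RegVec fun A => v A - w A := fun l => by
  simp only [map_sub]
  exact sub_mem (hv l) (hw l)

lemma RegVec.smul {φ : connB Δ n → ℂ} (hφ : φ ∈ regFun Δ n) (hv : RegVec v) :
    RegVec fun A => φ A • v A := fun l => by
  simp only [map_smul, smul_eq_mul]
  exact mul_mem hφ (hv l)

lemma RegVec.sum {ι : Type*} (s : Finset ι) {v : ι → connB Δ n → 𝔤} (hv : ∀ i ∈ s, RegVec (v i)) :
    RegVec fun A => ∑ i ∈ s, v i A := fun l => by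
  have h : (fun A => l (∑ i ∈ s, v i A)) = ∑ i ∈ s, fun A => l (v i A) := by
    ext A
    rw [map_sum, Finset.sum_apply]
  rw [h]
  exact sum_mem fun i hi => hv i hi l

lemma RegVec.lie (hv : RegVec v) (hw : RegVec w) : RegVec fun A => ⁅v A, w A⁆ := by
  let b := Module.finBasis ℂ 𝔤
  have h : (fun A => ⁅v A, w A⁆) = fun A => ∑ i, ∑ j, (b.coord i (w A) * b.coord j (v A)) •
      ⁅b j, b i⁆ := by
    ext A
    conv_lhs => rw [← b.sum_repr (v A), ← b.sum_repr (w A)]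
    simp only [sum_lie, lie_sum, smul_lie, lie_smul, Finset.smul_sum, smul_smul, Basis.coord_apply]
  rw [h]
  exact .sum _ fun i _ => .sum _ fun j _ => .smul (mul_mem (hw _) (hv _)) (.const _)

lemma RegLoop.coe : RegLoop fun A : connB Δ n => A.1 := fun k l =>
  mem_regFun_of_polyFun (Algebra.subset_adjoin ⟨k, l, rfl⟩)

lemma RegLoop.gseq_mono (hw : RegVec w) (hB : RegLoop B) (k : ℤ) (ε : ℂ) (j : ℕ) :
    RegLoop fun A => gseq (mono k (w A)) ε (B A) j := by
  have hε : ∀ m, RegVec fun A => coeff m (ε • loopDeriv (mono k (w A))) := by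
    intro m
    simp only [loopDeriv_mono, map_smul, coeff_mono]
    refine .smul (const_mem_regFun _) (.smul (const_mem_regFun _) ?_)
    split_ifs
    · exact hw
    · exact .const _
  induction j with
  | zero => exact hB
  | succ j ih =>
    intro m
    simp only [gseq, map_smul, coeff_sub, coeff_mono_lie]
    refine .smul (const_mem_regFun _) (.sub (.lie hw (ih _)) ?_)
    split_ifs
    · exact hε m
    · simp only [map_zero]
      exact .const _

end RegularFunctions

/-! ### Regular reduction of the polar part to `H` -/

section PolarReduction

namespace Frame

variable {𝔤 : Type*} [LieRing 𝔤] [LieAlgebra ℂ 𝔤] [FiniteDimensional ℂ 𝔤]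
  [LieAlgebra.IsSemisimple ℂ 𝔤] {H : LieSubalgebra ℂ 𝔤} [H.IsCartanSubalgebra]
  {Δ : (rootSystem H).Base} {F : Frame Δ} {n : ℕ}

variable {X S : Loop 𝔤} {w : 𝔤} {j k : ℕ}

/-- The effect of a gauge transformation by `exp (z ^ j w)` up to higher order and height. -/
lemma gauge_step (hn : 1 ≤ n) (hk : 1 ≤ k) (hw : w ∈ F.V k) (hX : X ∈ F.L n (-n) 0)
    (hS : HasZSum O (gseq (mono j w) 1 X) S) :
    ⁅mono (j : ℤ) w, X⁆ - loopDeriv (mono (j : ℤ) w) ∈ F.L n (j - n) k ∧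
    S - X - (⁅mono (j : ℤ) w, X⁆ - loopDeriv (mono (j : ℤ) w)) ∈ F.L n (j - n) (k + 1) := by
  have hY : mono (j : ℤ) w ∈ F.L n j k := mono_mem_L hw j
  have h1 : gseq (mono (j : ℤ) w) 1 X 1 ∈ F.L n (j - n) k := by
    rw [gseq_one, one_smul]
    refine sub_mem ?_ (L_mono (by omega) le_rfl (loopDeriv_mem_L hY))
    have := lie_mem_L hY hX
    rwa [add_zero, ← sub_eq_add_neg] at this
  have h2 : ∀ r : ℕ, gseq (mono (j : ℤ) w) 1 X (r + 1 + 1) ∈ F.L n (j - n) (k + 1) := by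
    intro r
    induction r with
    | zero =>
      rw [gseq_succ_succ]
      refine Submodule.smul_mem _ _ (L_mono ?_ ?_ (lie_mem_L hY h1))
      · omega
      · omega
    | succ r ih =>
      rw [gseq_succ_succ]
      refine Submodule.smul_mem _ _ (L_mono ?_ ?_ (lie_mem_L hY ih))
      · omega
      · omega
  have h3 := hasZSum_mem_L hS.tail.tail h2
  rw [gseq_zero, gseq_one, one_smul] at h3
  rw [gseq_one, one_smul] at h1
  exact ⟨h1, h3⟩


lemma gauge_step_mem (hn : 1 ≤ n) (hk : 1 ≤ k) (hw : w ∈ F.V k) (hX : X ∈ F.L n (-n) 0)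
    (hS : HasZSum O (gseq (mono j w) 1 X) S) : S - X ∈ F.L n (j - n) k := by
  obtain ⟨h1, h2⟩ := gauge_step hn hk hw hX hS
  have := add_mem (L_mono le_rfl (by omega) h2) h1
  rwa [sub_add_cancel] at this

/-- The derivative of z^j w has order `j - 1`, which differs from `j - n` because `n ≥ 2`. Hence
only the bracket with the leading coefficient is felt. -/
lemma gauge_step_coeff (hn : 2 ≤ n) (hj : j < n) (hk : 1 ≤ k) (hw : w ∈ F.V k)
    (hX : X ∈ F.L n (-n) 0) (hS : HasZSum O (gseq (mono j w) 1 X) S) :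
    coeff (j - n) S - (coeff (j - n) X + ⁅w, coeff (-n) X⁆) ∈ F.V (k + 1) := by
  have h1 := (gauge_step (by omega) hk hw hX hS).2.2 (j - n) (by omega)
  have h2 : coeff ((j : ℤ) - n) (loopDeriv (mono (j : ℤ) w)) = 0 := by
    rw [loopDeriv_mono, map_smul, coeff_mono, if_neg (by omega), smul_zero]
  rw [coeff_sub, coeff_sub, coeff_sub, coeff_mono_lie, h2, sub_zero,
    show ((j : ℤ) - n - j) = -n by ring, sub_sub] at h1
  exact h1

end Frame

variable {N : ℕ} {G : Subgroup (GL (Fin N) ℂ)} [LieAlgebra.IsSemisimple ℂ (lieAlg G)]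
  {H : LieSubalgebra ℂ (lieAlg G)} [H.IsCartanSubalgebra] {Δ : (rootSystem H).Base} {n : ℕ}
  {F : Frame Δ}

/-- A regular family of connections gauge equivalent to the connections in `Conn_n^B`. -/
structure IsReduction (F : Frame Δ) (B : connB Δ n → Loop (lieAlg G)) : Prop where
  reg : RegLoop B
  mem : ∀ A, B A ∈ F.L n (-n) 0
  lead : ∀ A, F.proj (coeff (-n) (B A)) = F.proj (coeff (-n) A.1)
  equiv : ∀ A, ∃ g ∈ GU G Δ n, toMat (B A) = gauge g (toMat A.1)

variable {B : connB Δ n → Loop (lieAlg G)}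

lemma wt_coeff_ne_zero (F : Frame Δ) (hn : 1 ≤ n) (A : connB Δ n) {i} (hi : F.ht i ≠ 0) :
    F.wt i (coeff (-n) A.1) ≠ 0 :=
  (F.isRegularSemisimple_iff ((Frame.mem_polarBorel.mp A.2.1).2 _ (by omega))).mp A.2.2 i hi

namespace IsReduction

lemma wt (hB : IsReduction F B) (A : connB Δ n) (i) :
    F.wt i (coeff (-n) (B A)) = F.wt i (coeff (-n) A.1) := by
  rw [← F.wt_proj, hB.lead, F.wt_proj]

/-- The coordinates of `w` are those of the coefficient to be cleared, divided by the weights of the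
leading coefficient of `A`. These weights vanish nowhere on `connB` and are unchanged by the
reduction, so `w` is regular. -/
lemma step (hB : IsReduction F B) (hn : 2 ≤ n) {j k : ℕ} (hj : j < n) (hk : 1 ≤ k)
    (h1 : ∀ A, ∀ m < (j - n : ℤ), coeff m (B A) ∈ H)
    (h2 : ∀ A, coeff (j - n) (B A) - F.proj (coeff (j - n) (B A)) ∈ F.V k) :
    ∃ B' : connB Δ n → Loop (lieAlg G), IsReduction F B' ∧
      (∀ A, ∀ m < (j - n : ℤ), coeff m (B' A) ∈ H) ∧
      ∀ A, coeff (j - n) (B' A) - F.proj (coeff (j - n) (B' A)) ∈ F.V (k + 1) := by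
  let w : connB Δ n → lieAlg G := fun A => ∑ i, if F.ht i = k then
    ((F.wt i (coeff (-n) A.1))⁻¹ * F.b.coord i (coeff (j - n) (B A))) • F.b i else 0
  have hwreg : RegVec w := by
    refine .sum _ fun i _ => ?_
    split_ifs with hi
    · exact .smul (mul_mem (inv_mem_regFun (RegLoop.coe _ _)
        fun A => wt_coeff_ne_zero F (by omega) A (by omega)) (hB.reg _ _)) (.const _)
    · exact .const _
  have hwr : ∀ A i, F.b.repr (w A) i = if F.ht i = k then
      (F.wt i (coeff (-n) A.1))⁻¹ * F.b.repr (coeff (j - n) (B A)) i else 0 := by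
    intro A i
    simp only [w, map_sum, Finsupp.coe_finsetSum, Finset.sum_apply]
    rw [Finset.sum_eq_single i]
    · split_ifs <;> simp
    · intro j _ hj
      split_ifs <;> simp [hj]
    · simp
  have hw : ∀ A, w A ∈ F.V k := fun A i hi => by rw [hwr, if_neg (by omega)]
  have hY : ∀ A, mono (j : ℤ) (w A) ∈ F.L n 0 1 := fun A =>
    Frame.L_mono (by omega) (by omega) (F.mono_mem_L (hw A) j)
  choose B' hB' using fun A => Frame.exists_gseq_sum (by omega) (hY A) 1 (B A)
  have hmem : ∀ A, B' A - B A ∈ F.L n (j - n) k := fun A =>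
    Frame.gauge_step_mem (by omega) hk (hw A) (hB.mem A) (hB' A)
  have hmem' : ∀ A, B' A ∈ F.L n (-n) 0 := fun A => by
    have := add_mem (Frame.L_mono (by omega) (by omega) (hmem A)) (hB.mem A)
    rwa [sub_add_cancel] at this
  have hV : ∀ A, coeff (j - n) (B' A) - F.proj (coeff (j - n) (B' A)) ∈ F.V (k + 1) := by
    intro A i hi
    have e1 := Frame.gauge_step_coeff hn hj hk (hw A) (hB.mem A) (hB' A) i hi
    rw [map_sub, Finsupp.sub_apply, F.repr_proj]
    split_ifs with hi0
    · rw [sub_self]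
    rw [sub_zero]
    set x := coeff (-n) (B A)
    have hx : x ∈ F.V 0 := (hB.mem A).2 _ (by omega)
    have e2 : F.b.repr ⁅w A, x - F.proj x⁆ i = 0 := F.lie_mem_V (hw A) (F.sub_proj_mem_V hx) i hi
    have e3 := F.repr_lie_of_mem (F.proj_mem x) (w A) i
    have e4 : F.wt i x = F.wt i (coeff (-n) A.1) := hB.wt A i
    rw [F.wt_proj, e4, ← lie_skew] at e3
    simp only [map_sub, map_add, map_neg, lie_sub, Finsupp.sub_apply, Finsupp.add_apply,
      Finsupp.neg_apply] at e1 e2 e3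
    have e5 : F.b.repr (coeff (j - n) (B' A)) i = F.b.repr (coeff (j - n) (B A)) i -
        F.wt i (coeff (-n) A.1) * F.b.repr (w A) i := by
      linear_combination e1 + e2 - e3
    rw [e5, hwr]
    split_ifs with h
    · rw [mul_inv_cancel_left₀ (wt_coeff_ne_zero F (by omega) A hi0), sub_self]
    · rw [mul_zero, sub_zero]
      have := h2 A i (by omega)
      rwa [map_sub, Finsupp.sub_apply, F.repr_proj, if_neg hi0, sub_zero] at this
  refine ⟨B', ⟨?_, hmem', fun A => ?_, fun A => ?_⟩, fun A m hm => ?_, hV⟩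
  · intro m
    -- The number of terms that contribute to a coefficient is bounded uniformly in `A`, so the
    -- limit is a finite sum of regular maps.
    have hgm : ∀ A r, r ≥ (m + 1 - -n).toNat * (2 * F.m + 1) + 1 →
        gseq (mono (j : ℤ) (w A)) 1 (B A) r ∈ O (m + 1) := by
      intro A r hr
      refine Frame.gseq_eventually_mem_O (a := -n) (by omega) (hY A) ?_ (m + 1) r hr
      rw [gseq_one, one_smul]
      exact O_anti (by omega) (Frame.gauge_step (by omega) hk (hw A) (hB.mem A) (hB' A)).1.1
    have : (fun A => coeff m (B' A)) = fun A => ∑ r ∈ Finset.range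
        ((m + 1 - -n).toNat * (2 * F.m + 1) + 1), coeff m (gseq (mono (j : ℤ) (w A)) 1 (B A) r) :=
      funext fun A => (hB' A).coeff_eq (hgm A)
    rw [this]
    exact .sum _ fun r _ => RegLoop.gseq_mono hwreg hB.reg j 1 r m
  · rw [← hB.lead, ← sub_eq_zero, ← map_sub, ← coeff_sub]
    exact F.proj_of_mem_V (F.V_anti (show (1 : ℤ) ≤ k by exact_mod_cast hk) ((hmem A).2 _ (by omega)))
  · obtain ⟨g, hg, h⟩ := hB.equiv A
    obtain ⟨g', hg', h'⟩ := exists_gauge_exp F (by omega) (hY A)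
    exact ⟨g' * g, mul_mem hg' hg, by rw [h' _ _ (hB' A), h, gauge_mul]⟩
  · have := (hmem A).1 m hm
    rw [coeff_sub] at this
    rw [sub_eq_zero.mp this]
    exact h1 A m hm

lemma clear (hB : IsReduction F B) (hn : 2 ≤ n) {j : ℕ} (hj : j < n)
    (h1 : ∀ A, ∀ m < (j - n : ℤ), coeff m (B A) ∈ H) (k : ℕ) :
    ∃ B' : connB Δ n → Loop (lieAlg G), IsReduction F B' ∧
      (∀ A, ∀ m < (j - n : ℤ), coeff m (B' A) ∈ H) ∧
      ∀ A, coeff (j - n) (B' A) - F.proj (coeff (j - n) (B' A)) ∈ F.V (k + 1) := by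
  induction k with
  | zero =>
    refine ⟨B, hB, h1, fun A => ?_⟩
    exact F.V_anti (by simp) (F.sub_proj_mem_V ((hB.mem A).2 _ (by omega)))
  | succ k ih =>
    obtain ⟨B', hB', h2, h3⟩ := ih
    simpa using hB'.step (k := k + 1) hn hj (by omega) h2 (by simpa using h3)

end IsReduction

/-- The polar parts can be moved to `H`, regularly on `Conn_n^B`. -/
lemma exists_polar_reduction (F : Frame Δ) (hn : 2 ≤ n) :
    ∃ B : connB Δ n → Loop (lieAlg G), IsReduction F B ∧ ∀ A, ∀ m < (0 : ℤ), coeff m (B A) ∈ H := by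
  suffices h : ∀ j ≤ n, ∃ B : connB Δ n → Loop (lieAlg G), IsReduction F B ∧
      ∀ A, ∀ m < (j - n : ℤ), coeff m (B A) ∈ H by
    simpa using h n le_rfl
  intro j hj
  induction j with
  | zero =>
    refine ⟨fun A => A.1, ⟨RegLoop.coe, fun A => Frame.mem_polarBorel.mp A.2.1, fun A => rfl,
      fun A => ⟨1, one_mem _, (gauge_one _).symm⟩⟩, fun A m hm => ?_⟩
    rw [A.2.1.1 m (by simpa using hm)]
    exact zero_mem _
  | succ j ih =>
    obtain ⟨B, hB, h1⟩ := ih (by omega)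
    -- Clearing up to the maximal height `F.m` leaves only the part in `H`.
    obtain ⟨B', hB', h2, h3⟩ := hB.clear hn (by omega) h1 F.m
    refine ⟨B', hB', fun A m hm => ?_⟩
    rcases (show m < (j - n : ℤ) ∨ m = j - n by push_cast at hm; omega) with h | rfl
    · exact h2 A m h
    · rw [sub_eq_zero.mp (F.eq_zero_of_mem_V (by omega) (h3 A))]
      exact F.proj_mem _

end PolarReduction

/-! ### Removal of the remaining terms by one exponential -/

section NormalForm

variable {𝔤 : Type*} [LieRing 𝔤] [LieAlgebra ℂ 𝔤] [FiniteDimensional ℂ 𝔤]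

/-- Terms of degree at least two contain a further bracket with `Y` or `D`, which pushes the effect
of `D` to order `p + 1`. So in degree `p` the transform changes by the linear term `⁅D, X⁆ - D'`
alone. -/
lemma gseq_sub_mem_O {X Y D : Loop 𝔤} {p : ℕ} (hY : Y ∈ O 1)
    (hYX : ⁅Y, X⁆ - loopDeriv Y ∈ O 0) (hD : D ∈ O (p + 1)) (hDX : ⁅D, X⁆ - loopDeriv D ∈ O p)
    (r : ℕ) : gseq (Y + D) 1 X (r + 2) - gseq Y 1 X (r + 2) ∈ O (p + 1) := by
  have h0 : ∀ r : ℕ, gseq Y 1 X (r + 1) ∈ O 0 := by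
    intro r
    induction r with
    | zero => rw [gseq_one, one_smul]; exact hYX
    | succ r ih =>
      rw [gseq_succ_succ]
      exact Submodule.smul_mem _ _ (O_anti (by omega) (lie_mem_O hY ih))
  have key : ∀ r : ℕ, gseq (Y + D) 1 X (r + 1) - gseq Y 1 X (r + 1) ∈ O p →
      gseq (Y + D) 1 X (r + 2) - gseq Y 1 X (r + 2) ∈ O (p + 1) := by
    intro r hr
    have h1 : gseq (Y + D) 1 X (r + 2) - gseq Y 1 X (r + 2) = ((r : ℂ) + 2)⁻¹ •
        (⁅Y, gseq (Y + D) 1 X (r + 1) - gseq Y 1 X (r + 1)⁆ +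
        (⁅D, gseq (Y + D) 1 X (r + 1) - gseq Y 1 X (r + 1)⁆ + ⁅D, gseq Y 1 X (r + 1)⁆)) := by
      rw [gseq_succ_succ, gseq_succ_succ, ← loop_smul_sub, loop_add_lie, loop_lie_sub, loop_lie_sub]
      congr 1
      abel
    rw [h1]
    refine Submodule.smul_mem _ _ (add_mem (O_anti (by omega) (lie_mem_O hY hr)) (add_mem
      (O_anti (by omega) (lie_mem_O hD hr)) (O_anti (by omega) (lie_mem_O hD (h0 r)))))
  induction r with
  | zero =>
    refine key 0 ?_
    rw [gseq_one, gseq_one, one_smul, one_smul, loop_add_lie, map_add]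
    convert hDX using 1
    abel
  | succ r ih => exact key (r + 1) (O_anti (by omega) ih)

lemma hasZSum_gseq_sub_mem_O {X Y D S S' : Loop 𝔤} {p : ℕ} (hY : Y ∈ O 1)
    (hYX : ⁅Y, X⁆ - loopDeriv Y ∈ O 0) (hD : D ∈ O (p + 1)) (hDX : ⁅D, X⁆ - loopDeriv D ∈ O p)
    (hS : HasZSum O (gseq Y 1 X) S) (hS' : HasZSum O (gseq (Y + D) 1 X) S') :
    S' - S - (⁅D, X⁆ - loopDeriv D) ∈ O (p + 1) := by
  have h1 := (hS'.sub hS).tail.tail.mem (a := p + 1) fun r => gseq_sub_mem_O hY hYX hD hDX r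
  rw [gseq_zero, gseq_zero, sub_self, zero_add, gseq_one, gseq_one, one_smul, one_smul,
    loop_add_lie, map_add] at h1
  convert h1 using 1
  abel

variable [LieAlgebra.IsSemisimple ℂ 𝔤] {H : LieSubalgebra ℂ 𝔤} [H.IsCartanSubalgebra]
  {Δ : (rootSystem H).Base} (F : Frame Δ) {n : ℕ} {X : Loop 𝔤}

namespace Frame

/-- Correction of the coefficient of `z ^ p`. -/
lemma exists_correction (hn : 2 ≤ n) (hX : X ∈ O (-n : ℤ)) (hXH : ∀ k < 0, coeff k X ∈ H)
    (hreg : ∀ i, F.ht i ≠ 0 → F.wt i (coeff (-n) X) ≠ 0) (p : ℕ) (y : 𝔤) :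
    ∃ D : Loop 𝔤, D ∈ O (n : ℤ) ∧ D ∈ O ((p : ℤ) + 1) ∧ ⁅D, X⁆ - loopDeriv D ∈ O (p : ℤ) ∧
      (y + coeff p (⁅D, X⁆ - loopDeriv D) ∈ H) ∧
      ((n : ℤ) - 2 < p → y + coeff p (⁅D, X⁆ - loopDeriv D) = 0) := by
  set x := coeff (-n) X
  have hx : x ∈ H := hXH _ (by omega)
  -- z^(p+n) δ meets the leading coefficient at z^p; `δ` is the solution of `y + ⁅δ, x⁆ = F.proj y`.
  let δ : 𝔤 := ∑ i, if F.ht i ≠ 0 then ((F.wt i x)⁻¹ * F.b.repr y i) • F.b i else 0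
  have hδr : ∀ i, F.b.repr δ i = if F.ht i ≠ 0 then (F.wt i x)⁻¹ * F.b.repr y i else 0 := by
    intro i
    simp only [δ, map_sum, Finsupp.coe_finsetSum, Finset.sum_apply]
    rw [Finset.sum_eq_single i]
    · split_ifs <;> simp
    · intro j _ hj
      split_ifs <;> simp [hj]
    · simp
  have hδ : y + ⁅δ, x⁆ = F.proj y := by
    apply F.b.ext_elem
    intro i
    rw [← lie_skew, map_add, map_neg, Finsupp.add_apply, Finsupp.neg_apply, F.repr_lie_of_mem hx,
      F.repr_proj, hδr]
    by_cases hi : F.ht i = 0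
    · rw [if_neg (not_not.mpr hi), if_pos hi, mul_zero, neg_zero, add_zero]
    · rw [if_pos hi, if_neg hi, mul_inv_cancel_left₀ (hreg i hi), add_neg_cancel]
  -- z^(p+1) η removes the part in `H` through its derivative. It is available only if `p + 1 ≥ n`,
  -- which is why the coefficients up to z^(n-2) survive. It commutes with the polar part, so its
  -- bracket with `X` starts beyond z^p.
  let η : 𝔤 := if (n : ℤ) - 2 < p then ((p : ℂ) + 1)⁻¹ • F.proj y else 0
  have hη : η ∈ H := by
    simp only [η]
    split_ifs
    · exact H.smul_mem _ (F.proj_mem y)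
    · exact H.zero_mem
  have h1 : mono ((p : ℤ) + 1) η ∈ O (n : ℤ) := by
    simp only [η]
    split_ifs with h
    · exact mono_mem_O (by omega) _
    · rw [map_zero]; exact zero_mem _
  have h2 : ∀ m : ℤ, m ≤ p → coeff m ⁅mono ((p : ℤ) + 1) η, X⁆ = 0 := fun m hm => by
    rw [coeff_mono_lie]
    exact lie_eq_zero_of_mem hη (hXH _ (by omega))
  have h3 : ∀ m : ℤ, m ≤ p → coeff m (⁅mono ((p : ℤ) + 1) η + mono ((p : ℤ) + n) δ, X⁆ -
      loopDeriv (mono ((p : ℤ) + 1) η + mono ((p : ℤ) + n) δ)) =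
      if m = p then ⁅δ, x⁆ - ((p : ℂ) + 1) • η else 0 := by
    intro m hm
    rw [loop_add_lie, map_add loopDeriv, loopDeriv_mono, loopDeriv_mono, coeff_sub, map_add,
      map_add, h2 m hm, map_smul, map_smul, coeff_mono, coeff_mono, coeff_mono_lie, zero_add,
      if_neg (show ¬ m = (p : ℤ) + n - 1 by omega), smul_zero, add_zero]
    by_cases hmp : m = p
    · subst hmp
      rw [if_pos (by ring), if_pos rfl, show (p : ℤ) - (p + n) = -n by ring]
      push_cast
      rfl
    · rw [if_neg (by omega), if_neg hmp, hX _ (by omega), lie_zero, smul_zero, sub_zero]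
  have h4 := h3 p le_rfl
  rw [if_pos rfl] at h4
  have hp : (p : ℂ) + 1 ≠ 0 := by exact_mod_cast Nat.succ_ne_zero p
  refine ⟨mono ((p : ℤ) + 1) η + mono ((p : ℤ) + n) δ, add_mem h1 (mono_mem_O (by omega) _),
    add_mem (mono_mem_O le_rfl _) (mono_mem_O (by omega) _), fun m hm => ?_, ?_, fun hp' => ?_⟩
  · rw [h3 m hm.le, if_neg hm.ne]
  · rw [h4, ← add_sub_assoc, hδ]
    exact H.sub_mem (F.proj_mem y) (H.smul_mem _ hη)
  · rw [h4, ← add_sub_assoc, hδ]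
    simp only [η]
    rw [if_pos hp', smul_inv_smul₀ hp, sub_self]

/-- Connections with polar part in `H` can be brought to normal form. -/
lemma exists_normalForm (hn : 2 ≤ n) (hX : X ∈ O (-n : ℤ)) (hXH : ∀ k < 0, coeff k X ∈ H)
    (hreg : ∀ i, F.ht i ≠ 0 → F.wt i (coeff (-n) X) ≠ 0) :
    ∃ Y S : Loop 𝔤, Y ∈ F.L n 0 1 ∧ HasZSum O (gseq Y 1 X) S ∧ S - X ∈ O 0 ∧
      (∀ k : ℤ, coeff k S ∈ H) ∧ ∀ k : ℤ, (n : ℤ) - 2 < k → coeff k S = 0 := by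
  have hL : ∀ Y ∈ (O (n : ℤ) : Submodule ℂ (Loop 𝔤)), Y ∈ F.L n 0 1 := fun Y hY =>
    O_le_L' (by rwa [zero_add])
  have hE : ∀ Y ∈ (O (n : ℤ) : Submodule ℂ (Loop 𝔤)), ⁅Y, X⁆ - loopDeriv Y ∈ O 0 := fun Y hY =>
    sub_mem (O_anti (by omega) (lie_mem_O hY hX)) (O_anti (by omega) (loopDeriv_mem_O hY))
  have hsum : ∀ Y : (O (n : ℤ) : Submodule ℂ (Loop 𝔤)), ∃ S, HasZSum O (gseq Y.1 1 X) S := fun Y =>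
    exists_gseq_sum (by omega) (hL _ Y.2) 1 X
  choose S hS using hsum
  choose D hD1 hD2 hD3 hD4 hD5 using F.exists_correction hn hX hXH hreg
  -- Each correction is computed from the transform by the current partial sum. The corrections are
  -- added inside one exponential, so no infinite product of group elements is formed.
  let Y : ℕ → (O (n : ℤ) : Submodule ℂ (Loop 𝔤)) := fun p =>
    Nat.rec 0 (fun p Yp => ⟨Yp.1 + D p (coeff p (S Yp)), add_mem Yp.2 (hD1 _ _)⟩) p
  let d : ℕ → Loop 𝔤 := fun p => D p (coeff p (S (Y p)))
  have hYs : ∀ p, (Y (p + 1)).1 = (Y p).1 + d p := fun p => rfl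
  have hYsum : ∀ p, (Y p).1 = ∑ q ∈ Finset.range p, d q := by
    intro p
    induction p with
    | zero => rfl
    | succ p ih => rw [hYs, ih, Finset.sum_range_succ]
  obtain ⟨Z, hZ⟩ := exists_hasZSum (s := d) (a₀ := n) (fun p => hD1 _ _) fun a =>
    ⟨a.toNat, fun p hp => O_anti (by omega) (hD2 _ _)⟩
  have hZn : Z ∈ O (n : ℤ) := hZ.mem fun p => hD1 _ _
  have hZY : ∀ p : ℕ, Z - (Y p).1 ∈ O ((p : ℤ) + 1) := fun p => by
    rw [hYsum]
    exact hZ.sub_sum_mem fun q hq => O_anti (by omega) (hD2 _ _)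
  have hZY' : ∀ p : ℕ, ⁅Z - (Y p).1, X⁆ - loopDeriv (Z - (Y p).1) ∈ O (p : ℤ) := by
    intro p
    -- The pole of `X` would cost `n` orders in a direct estimate. So `n` further corrections are
    -- split off, for which the linear term was bounded by construction, and the remainder has order
    -- beyond `p + n`.
    have h1 : Z - (Y p).1 = (Z - (Y (p + n)).1) + ∑ i ∈ Finset.range n, d (p + i) := by
      rw [hYsum, hYsum, Finset.sum_range_add]
      abel
    have h2 : ∀ s : ℕ, ⁅∑ i ∈ Finset.range s, d (p + i), X⁆ -
        loopDeriv (∑ i ∈ Finset.range s, d (p + i)) ∈ O (p : ℤ) := by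
      intro s
      induction s with
      | zero =>
        rw [Finset.sum_range_zero, loop_zero_lie, map_zero, sub_self]
        exact zero_mem _
      | succ s ih =>
        rw [Finset.sum_range_succ, loop_add_lie, map_add]
        have h3 : ⁅d (p + s), X⁆ - loopDeriv (d (p + s)) ∈ O ((p + s : ℕ) : ℤ) := hD3 _ _
        have := add_mem ih (O_anti (by push_cast; omega) h3)
        convert this using 1
        abel
    have h4 := hZY (p + n)
    have h5 := sub_mem (O_anti (show (p : ℤ) ≤ _ by push_cast; omega) (lie_mem_O h4 hX))
      (O_anti (show (p : ℤ) ≤ _ by push_cast; omega) (loopDeriv_mem_O h4))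
    rw [h1, loop_add_lie, map_add]
    convert add_mem h5 (h2 n) using 1
    abel
  have hstep : ∀ p : ℕ, coeff p (S (Y (p + 1))) = coeff p (S (Y p)) +
      coeff p (⁅d p, X⁆ - loopDeriv (d p)) := by
    intro p
    have := hasZSum_gseq_sub_mem_O (O_anti (by omega) (Y p).2) (hE _ (Y p).2) (hD2 _ _)
      (hD3 _ _) (hS (Y p)) (hS (Y (p + 1))) p (by omega)
    rw [coeff_sub, coeff_sub, sub_eq_zero, sub_eq_iff_eq_add'] at this
    exact this
  have hlim : ∀ p : ℕ, coeff p (S ⟨Z, hZn⟩) = coeff p (S (Y (p + 1))) := by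
    intro p
    have h1 : HasZSum O (gseq ((Y (p + 1)).1 + (Z - (Y (p + 1)).1)) 1 X) (S ⟨Z, hZn⟩) := by
      rw [add_sub_cancel]
      exact hS ⟨Z, hZn⟩
    have h2 := hasZSum_gseq_sub_mem_O (O_anti (by omega) (Y (p + 1)).2) (hE _ (Y (p + 1)).2)
      (hZY (p + 1)) (hZY' (p + 1)) (hS (Y (p + 1))) h1 p (by push_cast; omega)
    rw [coeff_sub, coeff_sub, hZY' (p + 1) p (by push_cast; omega), sub_zero] at h2
    exact sub_eq_zero.mp h2
  have hS0 : S ⟨Z, hZn⟩ - X ∈ O 0 := by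
    refine (hS ⟨Z, hZn⟩).tail.mem fun r => ?_
    have h1 : gseq Z 1 X 1 ∈ O 0 := by
      rw [gseq_one, one_smul]
      exact hE Z hZn
    simpa using gseq_mem_O (hL Z hZn) h1 0 r (by simp)
  refine ⟨Z, S ⟨Z, hZn⟩, hL Z hZn, hS ⟨Z, hZn⟩, hS0, fun k => ?_, fun k hk => ?_⟩
  · by_cases hk : k < 0
    · have := hS0 k hk
      rw [coeff_sub] at this
      rw [sub_eq_zero.mp this]
      exact hXH k hk
    · obtain ⟨p, rfl⟩ := Int.eq_ofNat_of_zero_le (not_lt.mp hk)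
      rw [hlim, hstep]
      exact hD4 _ _
  · obtain ⟨p, rfl⟩ := Int.eq_ofNat_of_zero_le (show 0 ≤ k by omega)
    rw [hlim, hstep]
    exact hD5 _ _ hk

end Frame

end NormalForm

/-! ### The normal form as a regular map on the quotient -/

section NormalFormMap

lemma Frame.mem_connB_iff {𝔤 : Type*} [LieRing 𝔤] [LieAlgebra ℂ 𝔤] [FiniteDimensional ℂ 𝔤]
    [LieAlgebra.IsSemisimple ℂ 𝔤] {H : LieSubalgebra ℂ 𝔤} [H.IsCartanSubalgebra]
    {Δ : (rootSystem H).Base} (F : Frame Δ) {n : ℕ} (hn : 1 ≤ n) {X : Loop 𝔤} :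
    X ∈ connB Δ n ↔ X ∈ F.L n (-n) 0 ∧ ∀ i, F.ht i ≠ 0 → F.wt i (coeff (-n) X) ≠ 0 := by
  show X ∈ polarBorel Δ n ∧ _ ↔ _
  rw [Frame.mem_polarBorel (F := F)]
  exact and_congr_right fun h => F.isRegularSemisimple_iff (h.2 _ (by omega))

variable {N : ℕ} {G : Subgroup (GL (Fin N) ℂ)} [LieAlgebra.IsSemisimple ℂ (lieAlg G)]
  {H : LieSubalgebra ℂ (lieAlg G)} [H.IsCartanSubalgebra] {Δ : (rootSystem H).Base} {n : ℕ}

lemma proj_coeff_eq_of_gauge (F : Frame Δ) (hn : 1 ≤ n) {X X' : Loop (lieAlg G)}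
    (hX : X ∈ O (-n : ℤ)) (hXH : ∀ k < 0, coeff k X ∈ H)
    (hreg : ∀ i, F.ht i ≠ 0 → F.wt i (coeff (-n) X) ≠ 0) (hXH' : ∀ k < 0, coeff k X' ∈ H)
    {g : GL (Fin N) ℂ⸨X⸩} (hg : g ∈ GU G Δ n) (h : toMat X' = gauge g (toMat X))
    {m : ℤ} (hm : m ≤ n - 2) : F.proj (coeff m X') = F.proj (coeff m X) := by
  obtain ⟨Φ, Ψ, c, hΦ⟩ := exists_isGaugeAction F hn hg
  have hX' : X' = Φ X - c := toMat_injective (by rw [h, hΦ.gauge_eq])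
  rw [hX'] at hXH' ⊢
  exact hΦ.proj_coeff_eq hn hX hXH hreg hXH' hm

lemma ConnQuot.mk_eq_iff {A A' : connB Δ n} :
    (ConnQuot.mk A : ConnQuot G Δ n) = .mk A' ↔
      ∃ g ∈ GU G Δ n, toMat A'.1 = gauge g (toMat A.1) := Quotient.eq (r := gaugeSetoid G Δ n)

variable (G) in
/-- The normal form of points of the quotient. -/
lemma exists_normalForm_map (F : Frame Δ) (hn : 2 ≤ n) :
    ∃ ν : ConnQuot G Δ n → connB Δ n, (∀ p, IsNormalForm Δ n (ν p)) ∧ (∀ p, ConnQuot.mk (ν p) = p) ∧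
      (∀ A, IsNormalForm Δ n A → ν (.mk A) = A) ∧
      ∀ (m : ℤ) (l : Dual ℂ (lieAlg G)), IsRegularFun fun p => l (coeff m (ν p).1) := by
  obtain ⟨B, hB, hBH⟩ := exists_polar_reduction F hn
  have hBreg : ∀ A i, F.ht i ≠ 0 → F.wt i (coeff (-n) (B A)) ≠ 0 := fun A i hi => by
    rw [hB.wt]
    exact wt_coeff_ne_zero F (by omega) A hi
  have hex : ∀ p : ConnQuot G Δ n, ∃ A, IsNormalForm Δ n A ∧ ConnQuot.mk A = p := by
    intro p
    induction p using Quotient.inductionOn with | _ A => ?_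
    obtain ⟨Y, S, hY, hS, hS0, hSH, hSn⟩ :=
      F.exists_normalForm hn (hB.mem A).1 (hBH A) (hBreg A)
    have hlt : ∀ k < 0, coeff k S = coeff k (B A) := fun k hk => by
      have := hS0 k hk
      rw [coeff_sub] at this
      exact sub_eq_zero.mp this
    have hSc : S ∈ connB Δ n := by
      rw [F.mem_connB_iff (by omega)]
      refine ⟨⟨fun k hk => ?_, fun k hk => ?_⟩, fun i hi => ?_⟩
      · rw [hlt k (by omega), (hB.mem A).1 k hk]
      · rw [hlt k (by omega)]
        exact (hB.mem A).2 k hk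
      · rw [hlt _ (by omega)]
        exact hBreg A i hi
    refine ⟨⟨S, hSc⟩, ⟨hSH, hSn⟩, ?_⟩
    obtain ⟨g, hg, h⟩ := hB.equiv A
    obtain ⟨g', hg', h'⟩ := exists_gauge_exp F (by omega) hY
    exact (ConnQuot.mk_eq_iff.mpr ⟨g' * g, mul_mem hg' hg,
      by rw [h' _ _ hS, h, gauge_mul]⟩).symm
  -- The coordinates of the normal form are already visible in the polar reduction. This gives
  -- uniqueness and regularity without following the second, infinite reduction.
  have hproj : ∀ (A A' : connB Δ n), IsNormalForm Δ n A' →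
      (ConnQuot.mk A : ConnQuot G Δ n) = .mk A' →
      ∀ m : ℤ, m ≤ n - 2 → coeff m A'.1 = F.proj (coeff m (B A)) := by
    intro A A' hA' h m hm
    obtain ⟨g, hg, h⟩ := ConnQuot.mk_eq_iff.mp h
    obtain ⟨g', hg', h'⟩ := hB.equiv A
    rw [← F.proj_of_mem (hA'.1 m)]
    refine proj_coeff_eq_of_gauge F (by omega) (hB.mem A).1 (hBH A) (hBreg A) (fun k _ => hA'.1 k)
      (mul_mem hg (inv_mem hg')) ?_ hm
    rw [gauge_mul, h', ← gauge_mul g'⁻¹, inv_mul_cancel, gauge_one, h]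
  have huniq : ∀ A A' : connB Δ n, IsNormalForm Δ n A → IsNormalForm Δ n A' →
      (ConnQuot.mk A : ConnQuot G Δ n) = .mk A' → A = A' := by
    intro A A' hA hA' h
    refine Subtype.ext (loop_ext fun m => ?_)
    by_cases hm : m ≤ n - 2
    · rw [hproj A A' hA' h m hm, hproj A A hA rfl m hm]
    · rw [hA.2 m (by omega), hA'.2 m (by omega)]
  choose ν h1 h2 using hex
  refine ⟨ν, h1, h2, fun A hA => huniq _ _ (h1 _) hA (h2 _), fun m l => ?_⟩
  show (fun A => l (coeff m (ν (.mk A)).1)) ∈ regFun Δ n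
  by_cases hm : m ≤ n - 2
  · have : (fun A => l (coeff m (ν (.mk A)).1)) = fun A => (l ∘ₗ F.proj) (coeff m (B A)) :=
      funext fun A => by rw [hproj A _ (h1 _) (h2 _).symm m hm]; rfl
    rw [this]
    exact hB.reg m _
  · have : (fun A => l (coeff m (ν (ConnQuot.mk A)).1)) = fun A : connB Δ n => (0 : ℂ) :=
      funext fun A => by rw [(h1 _).2 m (by omega), map_zero]
    rw [this]
    exact const_mem_regFun _

end NormalFormMap

/-! ### Gradients of polynomial functions and orthogonality -/

section Gradient

variable {𝔤 : Type*} [LieRing 𝔤] [LieAlgebra ℂ 𝔤] [FiniteDimensional ℂ 𝔤]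

/-- The coefficients of the curve `γ` have the derivatives at `0` given by `v`. -/
def HasLoopDerivAt (γ : ℂ → Loop 𝔤) (v : Loop 𝔤) : Prop :=
  ∀ (k : ℤ) (l : Dual ℂ 𝔤), HasDerivAt (fun t => l (coeff k (γ t))) (l (coeff k v)) 0

lemma hasLoopDerivAt_line (A v : Loop 𝔤) : HasLoopDerivAt (fun t => A + t • v) v := by
  intro k l
  simp only [map_add, map_smul, smul_eq_mul]
  simpa using ((hasDerivAt_id (0 : ℂ)).mul_const (l (coeff k v))).const_add (l (coeff k A))

variable [LieAlgebra.IsSemisimple ℂ 𝔤]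

lemma exists_killing_eq_dual (l : Dual ℂ 𝔤) : ∃ w, ∀ x, killingForm ℂ 𝔤 w x = l x := by
  have hnd := LieAlgebra.IsKilling.killingForm_nondegenerate (R := ℂ) (L := 𝔤)
  exact ⟨(LinearMap.BilinForm.toDual (killingForm ℂ 𝔤) hnd).symm l, fun x =>
    LinearMap.BilinForm.apply_toDual_symm_apply ..⟩

variable {H : LieSubalgebra ℂ 𝔤} [H.IsCartanSubalgebra] {Δ : (rootSystem H).Base} {n : ℕ}

lemma RegLoop.add {ξ η : connB Δ n → Loop 𝔤} (hξ : RegLoop ξ) (hη : RegLoop η) :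
    RegLoop fun A => ξ A + η A := fun k => by
  simp only [map_add]
  exact (hξ k).add (hη k)

lemma RegLoop.sub {ξ η : connB Δ n → Loop 𝔤} (hξ : RegLoop ξ) (hη : RegLoop η) :
    RegLoop fun A => ξ A - η A := fun k => by
  simp only [coeff_sub]
  exact (hξ k).sub (hη k)

lemma RegLoop.smul {φ : connB Δ n → ℂ} {ξ : connB Δ n → Loop 𝔤} (hφ : φ ∈ regFun Δ n)
    (hξ : RegLoop ξ) : RegLoop fun A => φ A • ξ A := fun k => by
  simp only [map_smul]
  exact (hξ k).smul hφ

lemma RegLoop.const (X : Loop 𝔤) : RegLoop fun _ : connB Δ n => X := fun _ => .const _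

variable (Δ n) in
/-- The gradient of a polynomial function. -/
lemma exists_gradient {P : Loop 𝔤 → ℂ} (hP : P ∈ polyFun 𝔤) :
    ∃ ξ : Loop 𝔤 → Loop 𝔤, RegLoop (fun A : connB Δ n => ξ A.1) ∧ (∃ a, ∀ A, ξ A ∈ O a) ∧
      ∀ γ v, HasLoopDerivAt γ v → HasDerivAt (fun t => P (γ t)) (resPairing (ξ (γ 0)) v) 0 := by
  induction hP using Algebra.adjoin_induction with
  | mem P hP =>
    obtain ⟨k, l, rfl⟩ := hP
    obtain ⟨w, hw⟩ := exists_killing_eq_dual l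
    refine ⟨fun _ => mono (-1 - k) w, RegLoop.const _, ⟨_, fun _ => mono_mem_O le_rfl _⟩,
      fun γ v h => ?_⟩
    rw [resPairing_mono, hw, sub_sub_cancel]
    exact h k l
  | algebraMap c =>
    refine ⟨fun _ => 0, RegLoop.const _, ⟨0, fun _ => zero_mem _⟩, fun γ v _ => ?_⟩
    have : resPairing (0 : Loop 𝔤) v = 0 := by simpa using resPairing_smul_left 0 (0 : Loop 𝔤) v
    rw [this]
    exact hasDerivAt_const _ _
  | add P Q hP hQ ihP ihQ =>
    obtain ⟨ξ, h1, ⟨a, h2⟩, h3⟩ := ihP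
    obtain ⟨η, h1', ⟨a', h2'⟩, h3'⟩ := ihQ
    refine ⟨fun A => ξ A + η A, h1.add h1', ⟨min a a', fun A => add_mem
      (O_anti (min_le_left _ _) (h2 A)) (O_anti (min_le_right _ _) (h2' A))⟩, fun γ v h => ?_⟩
    rw [resPairing_add_left]
    exact (h3 γ v h).add (h3' γ v h)
  | mul P Q hP hQ ihP ihQ =>
    obtain ⟨ξ, h1, ⟨a, h2⟩, h3⟩ := ihP
    obtain ⟨η, h1', ⟨a', h2'⟩, h3'⟩ := ihQ
    refine ⟨fun A => Q A • ξ A + P A • η A, (h1.smul (mem_regFun_of_polyFun hQ)).add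
      (h1'.smul (mem_regFun_of_polyFun hP)), ⟨min a a', fun A => add_mem
      (Submodule.smul_mem _ _ (O_anti (min_le_left _ _) (h2 A)))
      (Submodule.smul_mem _ _ (O_anti (min_le_right _ _) (h2' A)))⟩, fun γ v h => ?_⟩
    rw [resPairing_add_left, resPairing_smul_left, resPairing_smul_left]
    exact ((h3 γ v h).mul (h3' γ v h)).congr_deriv (by ring)

lemma killing_mem_regFun {v w : connB Δ n → 𝔤} (hv : RegVec v) (hw : RegVec w) :
    (fun A => killingForm ℂ 𝔤 (v A) (w A)) ∈ regFun Δ n := by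
  let b := Module.finBasis ℂ 𝔤
  have h : (fun A => killingForm ℂ 𝔤 (v A) (w A)) =
      ∑ i, ∑ j, fun A => b.coord i (v A) * b.coord j (w A) * killingForm ℂ 𝔤 (b i) (b j) := by
    ext A
    rw [← LinearMap.sum_repr_mul_repr_mul b b (v A) (w A)]
    simp only [Finset.sum_apply, Basis.coord_apply, smul_eq_mul]
    rw [Finsupp.sum_fintype _ _ (by simp)]
    refine Finset.sum_congr rfl fun i _ => ?_
    rw [Finsupp.sum_fintype _ _ (by simp)]
    exact Finset.sum_congr rfl fun j _ => by ring
  rw [h]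
  exact sum_mem fun i _ => sum_mem fun j _ => mul_mem (mul_mem (hv _) (hw _)) (const_mem_regFun _)

lemma RegLoop.lie {ξ η : connB Δ n → Loop 𝔤} (hξ : RegLoop ξ) (hη : RegLoop η) {a b : ℤ}
    (ha : ∀ A, ξ A ∈ O a) (hb : ∀ A, η A ∈ O b) : RegLoop fun A => ⁅ξ A, η A⁆ := fun k => by
  simp only [fun A => coeff_lie (ha A) (hb A) k]
  exact .sum _ fun i _ => (hξ i).lie (hη _)

lemma RegLoop.loopDeriv {ξ : connB Δ n → Loop 𝔤} (hξ : RegLoop ξ) :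
    RegLoop fun A => loopDeriv (ξ A) := fun k => by
  simp only [coeff_loopDeriv]
  exact (hξ _).smul (const_mem_regFun _)

lemma resPairing_mem_regFun {ξ η : connB Δ n → Loop 𝔤} (hξ : RegLoop ξ) (hη : RegLoop η) {a b : ℤ}
    (ha : ∀ A, ξ A ∈ O a) (hb : ∀ A, η A ∈ O b) :
    (fun A => resPairing (ξ A) (η A)) ∈ regFun Δ n := by
  have h : (fun A => resPairing (ξ A) (η A)) = ∑ i ∈ Finset.Icc a (-1 - b), fun A =>
      killingForm ℂ 𝔤 (coeff i (ξ A)) (coeff (-1 - i) (η A)) := by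
    ext A
    rw [resPairing_eq (ha A) (hb A), Finset.sum_apply]
  rw [h]
  exact sum_mem fun i _ => killing_mem_regFun (hξ _) (hη _)

lemma poissonTensor_mem_regFun {ξ η : connB Δ n → Loop 𝔤} (hξ : RegLoop ξ) (hη : RegLoop η)
    {a b : ℤ} (ha : ∀ A, ξ A ∈ O a) (hb : ∀ A, η A ∈ O b) :
    (fun A : connB Δ n => poissonTensor A.1 (ξ A) (η A)) ∈ regFun Δ n := by
  have h1 : ∀ A : connB Δ n, A.1 ∈ O (-n : ℤ) := fun A => A.2.1.1
  simp only [poissonTensor_eq]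
  refine resPairing_mem_regFun (((RegLoop.coe.lie hξ h1 ha)).add hξ.loopDeriv) hη
    (a := min (-n + a) (a - 1)) (fun A => ?_) hb
  exact add_mem (O_anti (min_le_left _ _) (lie_mem_O (h1 A) (ha A)))
    (O_anti (min_le_right _ _) (loopDeriv_mem_O (ha A)))

lemma mem_regFun_of_local {φ : connB Δ n → ℂ}
    (h : ∀ A : connB Δ n, ∃ Q ∈ polyFun 𝔤, Q A.1 ≠ 0 ∧ ∃ ψ ∈ regFun Δ n, ∀ A' : connB Δ n,
      Q A'.1 ≠ 0 → φ A' = ψ A' / Q A'.1) : φ ∈ regFun Δ n := by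
  intro A
  obtain ⟨Q, hQ, h1, ψ, hψ, h2⟩ := h A
  obtain ⟨P, hP, R, hR, h3, h4⟩ := hψ A
  refine ⟨P, hP, R * Q, mul_mem hR hQ, mul_ne_zero h3 h1, fun A' hA' => ?_⟩
  have := mul_ne_zero_iff.mp hA'
  rw [h2 A' this.2, h4 A' this.1, div_div]
  rfl

/-- The orthogonal complements of spaces of loops for the residue pairing. -/
lemma Frame.mem_L_of_resPairing {F : Frame Δ} {D : Loop 𝔤} {a h : ℤ}
    (hD : ∀ v ∈ F.L n a h, resPairing D v = 0) : D ∈ F.L n (-a - n) (1 - h) := by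
  have h1 : ∀ (k : ℤ) (y : 𝔤), mono k y ∈ F.L n a h →
      killingForm ℂ 𝔤 (coeff (-1 - k) D) y = 0 := fun k y hy => by
    have := hD _ hy
    rw [resPairing_comm, resPairing_mono] at this
    rwa [LieModule.traceForm_comm]
  refine ⟨fun m hm => ?_, fun m hm => ?_⟩
  · have hnd := LieAlgebra.IsKilling.killingForm_nondegenerate (R := ℂ) (L := 𝔤)
    refine hnd.1 _ fun y => ?_
    have := h1 (-1 - m) y (O_le_L' (mono_mem_O (by omega) y))
    rwa [sub_sub_cancel] at this
  · refine F.mem_V_of_killing fun y hy => ?_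
    rw [sub_sub_cancel] at hy
    have := h1 (-1 - m) y (L_mono (by omega) le_rfl (mono_mem_L hy _))
    rwa [sub_sub_cancel] at this

end Gradient

/-! ### Curves in the space of connections -/

section Curves

open Topology

variable {𝔤 : Type*} [LieRing 𝔤] [LieAlgebra ℂ 𝔤] [FiniteDimensional ℂ 𝔤]
  [LieAlgebra.IsSemisimple ℂ 𝔤] {H : LieSubalgebra ℂ 𝔤} [H.IsCartanSubalgebra]
  {Δ : (rootSystem H).Base} {F : Frame Δ} {n : ℕ}

lemma Frame.eventually_mem_connB (F : Frame Δ) (hn : 1 ≤ n) (A : connB Δ n) {v : Loop 𝔤}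
    (hv : v ∈ polarBorel Δ n) : ∀ᶠ t : ℂ in 𝓝 0, A.1 + t • v ∈ connB Δ n := by
  have hA := (F.mem_connB_iff hn).mp A.2
  have h1 : ∀ i, F.ht i ≠ 0 → ∀ᶠ t : ℂ in 𝓝 0, F.wt i (coeff (-n) (A.1 + t • v)) ≠ 0 := by
    intro i hi
    have hc := (hasLoopDerivAt_line A.1 v (-n) (F.wt i)).continuousAt
    refine hc.eventually_ne ?_
    show F.wt i (coeff (-n) (A.1 + (0 : ℂ) • v)) ≠ 0
    rw [zero_smul, add_zero]
    exact hA.2 i hi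
  filter_upwards [Filter.eventually_all.mpr fun i => Filter.eventually_all.mpr (h1 i)] with t ht
  rw [F.mem_connB_iff hn]
  exact ⟨add_mem hA.1 (Submodule.smul_mem _ _ (Frame.mem_polarBorel.mp hv)), ht⟩

lemma Frame.mem_connB_of_sub_mem (F : Frame Δ) (hn : 1 ≤ n) {A S : Loop 𝔤} (hA : A ∈ connB Δ n)
    (hS : S - A ∈ F.L n (-n) 1) : S ∈ connB Δ n := by
  rw [F.mem_connB_iff hn] at hA ⊢
  refine ⟨?_, fun i hi => ?_⟩
  · have := add_mem (Frame.L_mono le_rfl zero_le_one hS) hA.1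
    rwa [sub_add_cancel] at this
  · have h1 : F.wt i (coeff (-n) (S - A)) = 0 := F.wt_of_mem_V i (hS.2 _ (by omega))
    rw [coeff_sub, map_sub, sub_eq_zero] at h1
    rw [h1]
    exact hA.2 i hi

end Curves

/-! ### Lifted differentials and the Poisson bracket -/

section Lifts

open Topology

variable {N : ℕ} {G : Subgroup (GL (Fin N) ℂ)} [LieAlgebra.IsSemisimple ℂ (lieAlg G)]
  {H : LieSubalgebra ℂ (lieAlg G)} [H.IsCartanSubalgebra] {Δ : (rootSystem H).Base} {n : ℕ}

lemma pullback_of_mem (f : ConnQuot G Δ n → ℂ) {A : Loop (lieAlg G)} (h : A ∈ connB Δ n) :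
    pullback f A = f (.mk ⟨A, h⟩) := dif_pos h

lemma pullback_of_notMem (f : ConnQuot G Δ n → ℂ) {A : Loop (lieAlg G)} (h : A ∉ connB Δ n) :
    pullback f A = 0 := dif_neg h

lemma gauge_mem_connB (F : Frame Δ) (hn : 1 ≤ n) {A A' : Loop (lieAlg G)} (hA : A ∈ connB Δ n)
    {g : GL (Fin N) ℂ⸨X⸩} (hg : g ∈ GU G Δ n) (h : toMat A' = gauge g (toMat A)) :
    A' ∈ connB Δ n := by
  obtain ⟨Φ, Ψ, c, hΦ⟩ := exists_isGaugeAction F hn hg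
  have hA' : A' = Φ A - c := toMat_injective (by rw [h, hΦ.gauge_eq])
  refine F.mem_connB_of_sub_mem hn hA ?_
  rw [hA', show Φ A - c - A = Φ A - A - c by abel]
  exact sub_mem (hΦ.sub_mem _ _ _ ((F.mem_connB_iff hn).mp hA).1)
    (Frame.L_mono (by omega) le_rfl hΦ.mem_L)

/-- The curve `exp (t Y)` applied to a connection. -/
lemma exists_gauge_curve (F : Frame Δ) (hn : 1 ≤ n) (A : connB Δ n) {Y : Loop (lieAlg G)}
    (hY : Y ∈ F.L n 0 1) :
    ∃ γ : ℂ → Loop (lieAlg G), HasLoopDerivAt γ (⁅Y, A.1⁆ - loopDeriv Y) ∧ γ 0 = A.1 ∧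
      ∀ t, ∃ h : γ t ∈ connB Δ n, (ConnQuot.mk ⟨γ t, h⟩ : ConnQuot G Δ n) = .mk A := by
  have hY' : ∀ t : ℂ, t • Y ∈ F.L n 0 1 := fun t => Submodule.smul_mem _ t hY
  choose γ hγ using fun t : ℂ => Frame.exists_gseq_sum hn (hY' t) 1 A.1
  have hlim : ∀ k : ℤ, ∃ K : ℕ, ∀ t, coeff k (γ t) =
      ∑ j ∈ Finset.range (K + 2), t ^ j • coeff k (gseq Y 1 A.1 j) := by
    intro k
    obtain ⟨K, hK⟩ := Frame.gseq_tendsto hn hY 1 A.1 (k + 1)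
    refine ⟨K, fun t => ?_⟩
    rw [(hγ t).coeff_eq (L := K + 2) fun j hj => ?_]
    · simp only [gseq_smul, map_smul]
    · rw [gseq_smul]
      exact Submodule.smul_mem _ _ (hK j (by omega))
  refine ⟨γ, fun k l => ?_, loop_ext fun k => ?_, fun t => ?_⟩
  · obtain ⟨K, hK⟩ := hlim k
    have h1 : (fun t => l (coeff k (γ t))) =
        fun t => ∑ j ∈ Finset.range (K + 2), t ^ j * l (coeff k (gseq Y 1 A.1 j)) := by
      funext t
      rw [hK, map_sum]
      simp only [map_smul, smul_eq_mul]
    rw [h1]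
    have h2 : HasDerivAt
        (fun t : ℂ => ∑ j ∈ Finset.range (K + 2), t ^ j * l (coeff k (gseq Y 1 A.1 j)))
        (∑ j ∈ Finset.range (K + 2), ((j : ℂ) * 0 ^ (j - 1)) * l (coeff k (gseq Y 1 A.1 j))) 0 :=
      HasDerivAt.fun_sum fun j _ => (hasDerivAt_pow j 0).mul_const _
    refine h2.congr_deriv ?_
    rw [Finset.sum_eq_single 1]
    · rw [gseq_one, one_smul]
      simp
    · rintro (_ | _ | j) _ hj
      · simp
      · exact absurd rfl hj
      · simp
    · simp
  · obtain ⟨K, hK⟩ := hlim k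
    rw [hK, Finset.sum_eq_single 0]
    · rw [pow_zero, one_smul, gseq_zero]
    · intro j _ hj
      rw [zero_pow hj, zero_smul]
    · simp
  · obtain ⟨g, hg, h⟩ := exists_gauge_exp F hn (hY' t)
    have h1 := h _ _ (hγ t)
    exact ⟨gauge_mem_connB F hn A.2 hg h1, (ConnQuot.mk_eq_iff.mpr ⟨g, hg, h1⟩).symm⟩

/-- `ξ` is a differential of `f` along all curves in `Conn_n^B` through `A`. -/
def IsCurveDifferential (f : ConnQuot G Δ n → ℂ) (A : connB Δ n) (ξ : Loop (lieAlg G)) : Prop :=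
  ∀ γ v, HasLoopDerivAt γ v → γ 0 = A.1 → (∀ᶠ t in 𝓝 0, γ t ∈ connB Δ n) →
    HasDerivAt (fun t : ℂ => pullback f (γ t)) (resPairing ξ v) 0

variable {f : ConnQuot G Δ n → ℂ} {A : connB Δ n} {ξ ξ' η η' : Loop (lieAlg G)}

lemma IsCurveDifferential.isLiftedDifferential (F : Frame Δ) (hn : 1 ≤ n)
    (h : IsCurveDifferential f A ξ) : IsLiftedDifferential f A ξ := fun v hv =>
  h _ v (hasLoopDerivAt_line A.1 v) (by rw [zero_smul, add_zero]) (F.eventually_mem_connB hn A hv)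

/-- Regular functions have differentials, locally given by regular formulas. -/
lemma exists_local_differential (hf : IsRegularFun f) (A : connB Δ n) :
    ∃ Q ∈ polyFun (lieAlg G), Q A.1 ≠ 0 ∧ ∃ ζ : connB Δ n → Loop (lieAlg G), RegLoop ζ ∧
      (∃ a, ∀ A', ζ A' ∈ O a) ∧ ∀ A' : connB Δ n, Q A'.1 ≠ 0 →
        IsCurveDifferential f A' ((Q A'.1)⁻¹ • ζ A') := by
  obtain ⟨P, hP, Q, hQ, h1, h2⟩ := hf A
  obtain ⟨ξ, hξ, ⟨a, ha⟩, hξ'⟩ := exists_gradient Δ n hP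
  obtain ⟨η, hη, ⟨b, hb⟩, hη'⟩ := exists_gradient Δ n hQ
  -- The quotient rule: the numerator of d(P / Q) is Q dP - P dQ, with denominator Q².
  refine ⟨Q ^ 2, pow_mem hQ 2, pow_ne_zero 2 h1, fun A' => Q A'.1 • ξ A'.1 - P A'.1 • η A'.1,
    (hξ.smul (mem_regFun_of_polyFun hQ)).sub (hη.smul (mem_regFun_of_polyFun hP)),
    ⟨min a b, fun A' => sub_mem (Submodule.smul_mem _ _ (O_anti (min_le_left _ _) (ha _)))
      (Submodule.smul_mem _ _ (O_anti (min_le_right _ _) (hb _)))⟩, fun A' hA' γ v hγ h0 hmem => ?_⟩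
  have hQ0 : Q (γ 0) ≠ 0 := by
    rw [h0]
    intro h
    exact hA' (by rw [Pi.pow_apply, h, zero_pow two_ne_zero])
  have h3 := hξ' γ v hγ
  have h4 := hη' γ v hγ
  have h5 := h3.div h4 hQ0
  have h6 : (fun t => pullback f (γ t)) =ᶠ[𝓝 0] fun t => P (γ t) / Q (γ t) := by
    filter_upwards [hmem, h4.continuousAt.eventually_ne hQ0] with t ht ht'
    rw [pullback_of_mem f ht]
    exact h2 ⟨γ t, ht⟩ ht'
  refine (h5.congr_of_eventuallyEq h6).congr_deriv ?_
  rw [resPairing_smul_left, resPairing_sub_left, resPairing_smul_left, resPairing_smul_left, h0,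
    Pi.pow_apply]
  field_simp

/-- `f` is constant along the orbit curve of `exp (t Y)`, whose velocity is the gauge direction.
This curve is not a line, which is why differentials along arbitrary curves are used. -/
lemma IsCurveDifferential.resPairing_eq_zero (F : Frame Δ) (hn : 1 ≤ n)
    (h : IsCurveDifferential f A ξ) {Y : Loop (lieAlg G)} (hY : Y ∈ F.L n 0 1) :
    resPairing ξ (⁅Y, A.1⁆ - loopDeriv Y) = 0 := by
  obtain ⟨γ, h1, h2, h3⟩ := exists_gauge_curve F hn A hY
  have h4 := h γ _ h1 h2 (Filter.Eventually.of_forall fun t => (h3 t).1)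
  have h5 : (fun t => pullback f (γ t)) = fun _ => f (.mk A) := by
    funext t
    obtain ⟨h6, h7⟩ := h3 t
    rw [pullback_of_mem f h6, h7]
  rw [h5] at h4
  exact h4.unique (hasDerivAt_const _ _)

lemma exists_isCurveDifferential (hf : IsRegularFun f) (A : connB Δ n) :
    ∃ ξ, IsCurveDifferential f A ξ := by
  obtain ⟨Q, -, h1, ζ, -, -, h⟩ := exists_local_differential hf A
  exact ⟨_, h A h1⟩

/-- The two lifts agree on the tangent space `F.L n (-n) 0`, whose annihilator is the Lie algebra of
the group. -/
lemma IsLiftedDifferential.sub_mem (F : Frame Δ) (h : IsLiftedDifferential f A ξ)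
    (h' : IsLiftedDifferential f A ξ') : ξ - ξ' ∈ F.L n 0 1 := by
  have := Frame.mem_L_of_resPairing (F := F) (n := n) (a := -n) (h := 0) (D := ξ - ξ') fun v hv => by
    have hv' := Frame.mem_polarBorel.mpr hv
    rw [resPairing_sub_left, sub_eq_zero]
    exact (h v hv').unique (h' v hv')
  simpa using this

lemma IsLiftedDifferential.resPairing_eq_zero (F : Frame Δ) (hn : 1 ≤ n) (hf : IsRegularFun f)
    (h : IsLiftedDifferential f A ξ) {Y : Loop (lieAlg G)} (hY : Y ∈ F.L n 0 1) :
    resPairing ξ (⁅Y, A.1⁆ - loopDeriv Y) = 0 := by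
  obtain ⟨ξ', h'⟩ := exists_isCurveDifferential hf A
  rw [← h'.resPairing_eq_zero F hn hY]
  have hv : ⁅Y, A.1⁆ - loopDeriv Y ∈ polarBorel Δ n := by
    rw [Frame.mem_polarBorel (F := F)]
    refine _root_.sub_mem ?_ (Frame.L_mono (by omega) zero_le_one (Frame.loopDeriv_mem_L hY))
    have := Frame.lie_mem_L hY ((F.mem_connB_iff hn).mp A.2).1
    exact Frame.L_mono (by omega) (by omega) this
  exact (h _ hv).unique (h'.isLiftedDifferential F hn _ hv)

/-- The hamiltonian direction of a lift is tangent to `Conn_n^B`. -/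
lemma IsLiftedDifferential.hamiltonian_mem (F : Frame Δ) (hn : 1 ≤ n) (hf : IsRegularFun f)
    (h : IsLiftedDifferential f A ξ) : ⁅A.1, ξ⁆ + loopDeriv ξ ∈ F.L n (-n) 0 := by
  have := Frame.mem_L_of_resPairing (F := F) (n := n) (a := 0) (h := 1)
    (D := ⁅A.1, ξ⁆ + loopDeriv ξ) fun Y hY => by
      rw [← resPairing_gauge_direction]
      exact h.resPairing_eq_zero F hn hf hY
  simpa using this

/-- Changing `η` by an element of the Lie algebra of the group changes the tensor by the pairing of
`ξ` with a gauge direction, and this is zero by invariance of `f`. -/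
lemma poissonTensor_congr_right (F : Frame Δ) (hn : 1 ≤ n) {g : ConnQuot G Δ n → ℂ}
    (hf : IsRegularFun f) (h : IsLiftedDifferential f A ξ) (h1 : IsLiftedDifferential g A η)
    (h2 : IsLiftedDifferential g A η') : poissonTensor A.1 ξ η = poissonTensor A.1 ξ η' := by
  rw [poissonTensor_eq, poissonTensor_eq, ← sub_eq_zero, ← resPairing_sub_right,
    ← resPairing_gauge_direction]
  exact h.resPairing_eq_zero F hn hf (h1.sub_mem F h2)

lemma poissonTensor_congr (F : Frame Δ) (hn : 1 ≤ n) {g : ConnQuot G Δ n → ℂ}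
    (hf : IsRegularFun f) (hg : IsRegularFun g) (h : IsLiftedDifferential f A ξ)
    (h' : IsLiftedDifferential f A ξ') (h1 : IsLiftedDifferential g A η)
    (h2 : IsLiftedDifferential g A η') : poissonTensor A.1 ξ η = poissonTensor A.1 ξ' η' := by
  rw [poissonTensor_congr_right F hn hf h h1 h2, poissonTensor_antisymm,
    poissonTensor_congr_right F hn hg h2 h h', ← poissonTensor_antisymm]

/-- Gauge transformations preserve lifts and their brackets. -/
lemma exists_transport (F : Frame Δ) (hn : 1 ≤ n) {A A' : connB Δ n}
    (h : (ConnQuot.mk A : ConnQuot G Δ n) = .mk A') :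
    ∃ Φ : Loop (lieAlg G) → Loop (lieAlg G),
      (∀ (f : ConnQuot G Δ n → ℂ) ξ, IsLiftedDifferential f A ξ →
        IsLiftedDifferential f A' (Φ ξ)) ∧
      ∀ ξ η, poissonTensor A'.1 (Φ ξ) (Φ η) = poissonTensor A.1 ξ η := by
  obtain ⟨g, hg, h⟩ := ConnQuot.mk_eq_iff.mp h
  obtain ⟨Φ, Ψ, c, hΦ⟩ := exists_isGaugeAction F hn hg
  have hA' : A'.1 = Φ A.1 - c := toMat_injective (by rw [h, hΦ.gauge_eq])
  have hpull : ∀ (f : ConnQuot G Δ n → ℂ) X, pullback f (Φ X - c) = pullback f X := by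
    intro f X
    have h1 : toMat (Φ X - c) = gauge g (toMat X) := (hΦ.gauge_eq X).symm
    by_cases hX : X ∈ connB Δ n
    · have h2 := gauge_mem_connB F hn hX hg h1
      rw [pullback_of_mem f hX, pullback_of_mem f h2]
      exact congrArg f (ConnQuot.mk_eq_iff.mpr ⟨g, hg, h1⟩).symm
    · have h2 : Φ X - c ∉ connB Δ n := fun h2 => hX (gauge_mem_connB F hn h2 (inv_mem hg)
        (by rw [h1, ← gauge_mul, inv_mul_cancel, gauge_one]))
      rw [pullback_of_notMem f hX, pullback_of_notMem f h2]
  refine ⟨Φ, fun f ξ hξ v hv => ?_, fun ξ η => ?_⟩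
  · have hv' : Ψ v ∈ polarBorel Δ n := by
      rw [Frame.mem_polarBorel (F := F)] at hv ⊢
      exact hΦ.inv_mem_L hv
    have h1 := hξ _ hv'
    have h2 : resPairing (Φ ξ) v = resPairing ξ (Ψ v) := by
      rw [← hΦ.resPairing_map ξ, hΦ.right_inv]
    rw [h2]
    convert h1 using 2 with t
    rw [← hpull f (A.1 + t • Ψ v), hΦ.map_add, hΦ.map_smul, hΦ.right_inv, hA']
    congr 1
    abel
  -- The terms in `c` from the connection `Φ A - c` and from the derivative of `Φ ξ` cancel.
  · rw [poissonTensor_eq, poissonTensor_eq, hΦ.loopDeriv_map, hA', loop_sub_lie, ← hΦ.map_lie,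
      ← hΦ.resPairing_map (⁅A.1, ξ⁆ + loopDeriv ξ), hΦ.map_add]
    congr 1
    abel

/-- The Poisson bracket of regular functions exists and is unique. -/
lemma existsUnique_isPoissonBracket (F : Frame Δ) (hn : 1 ≤ n) {f g : ConnQuot G Δ n → ℂ}
    (hf : IsRegularFun f) (hg : IsRegularFun g) : ∃! k, IsPoissonBracket f g k := by
  choose ξ hξ using exists_isCurveDifferential hf
  choose η hη using exists_isCurveDifferential hg
  have hξ' := fun A => (hξ A).isLiftedDifferential F hn
  have hη' := fun A => (hη A).isLiftedDifferential F hn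
  let K : connB Δ n → ℂ := fun A => poissonTensor A.1 (ξ A) (η A)
  have hK : ∀ A A', (ConnQuot.mk A : ConnQuot G Δ n) = .mk A' → K A = K A' := by
    intro A A' h
    obtain ⟨Φ, h1, h2⟩ := exists_transport F hn h
    simp only [K]
    rw [← h2]
    exact poissonTensor_congr F hn hf hg (h1 _ _ (hξ' A)) (hξ' A') (h1 _ _ (hη' A)) (hη' A')
  let k : ConnQuot G Δ n → ℂ := fun p => K (Quotient.out p)
  have hk : ∀ A, k (.mk A) = K A := fun A => hK _ _ (Quotient.out_eq _)
  have hreg : K ∈ regFun Δ n := by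
    refine mem_regFun_of_local fun A => ?_
    obtain ⟨Q, hQ, h1, ζ, hζ, ⟨a, ha⟩, h2⟩ := exists_local_differential hf A
    obtain ⟨Q', hQ', h1', ζ', hζ', ⟨a', ha'⟩, h2'⟩ := exists_local_differential hg A
    refine ⟨Q * Q', mul_mem hQ hQ', mul_ne_zero h1 h1', _, poissonTensor_mem_regFun hζ hζ' ha ha',
      fun A' hA' => ?_⟩
    have h3 := mul_ne_zero_iff.mp hA'
    have h4 : K A' = poissonTensor A'.1 ((Q A'.1)⁻¹ • ζ A') ((Q' A'.1)⁻¹ • ζ' A') :=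
      poissonTensor_congr F hn hf hg (hξ' A') ((h2 A' h3.1).isLiftedDifferential F hn) (hη' A')
        ((h2' A' h3.2).isLiftedDifferential F hn)
    have h5 : poissonTensor A'.1 ((Q A'.1)⁻¹ • ζ A') ((Q' A'.1)⁻¹ • ζ' A') =
        (Q A'.1)⁻¹ * ((Q' A'.1)⁻¹ * poissonTensor A'.1 (ζ A') (ζ' A')) := by
      rw [poissonTensor_eq, poissonTensor_eq, loop_lie_smul, map_smul, resPairing_smul_right,
        resPairing_add_left, resPairing_smul_left, resPairing_smul_left, resPairing_add_left]
      ring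
    rw [h4, h5, Pi.mul_apply]
    field_simp
  refine ⟨k, ⟨?_, fun A ξ₁ η₁ h1 h2 => ?_⟩, fun k' hk' => funext fun p => ?_⟩
  · show (fun A => k (.mk A)) ∈ regFun Δ n
    simp only [hk]
    exact hreg
  · rw [hk]
    exact poissonTensor_congr F hn hf hg (hξ' A) h1 (hη' A) h2
  · induction p using Quotient.inductionOn with | _ A => ?_
    exact (hk'.2 A _ _ (hξ' A) (hη' A)).trans (hk A).symm

end Lifts

/-! ### Covectors at connections in normal form -/

section NormalFormLifts

variable {𝔤 : Type*} [LieRing 𝔤] [LieAlgebra ℂ 𝔤] [FiniteDimensional ℂ 𝔤]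
  [LieAlgebra.IsSemisimple ℂ 𝔤] {H : LieSubalgebra ℂ 𝔤} [H.IsCartanSubalgebra]
  {Δ : (rootSystem H).Base} {F : Frame Δ} {n : ℕ}

namespace Frame

lemma resPairing_eq_zero_of_mem_L {Y v : Loop 𝔤} (hY : Y ∈ F.L n 0 1) (hv : v ∈ F.L n (-n) 0) :
    resPairing Y v = 0 := by
  rw [resPairing_eq hY.1 hv.1]
  refine Finset.sum_eq_zero fun i hi => ?_
  rw [Finset.mem_Icc] at hi
  exact F.killing_eq_zero (by omega) (hY.2 i (by omega)) (hv.2 _ (by omega))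

/-- Comparison of lowest terms of the components of `[X, ξ] + ξ'` in the root spaces. -/
lemma repr_coeff_eq_zero (F : Frame Δ) (hn : 2 ≤ n) {X ξ : Loop 𝔤} (hX : X ∈ O (-n : ℤ))
    (hXH : ∀ k, coeff k X ∈ H) {i} (hi : F.wt i (coeff (-n) X) ≠ 0) {T : ℤ}
    (hT : ∀ k < T, F.b.repr (coeff (k - n) (⁅X, ξ⁆ + loopDeriv ξ)) i = 0) :
    ∀ k < T, F.b.repr (coeff k ξ) i = 0 := by
  obtain ⟨a, ha⟩ := exists_mem_O ξ
  suffices h : ∀ m : ℕ, ∀ k < a + m, k < T → F.b.repr (coeff k ξ) i = 0 from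
    fun k hk => h (k - a + 1).toNat k (by have := Int.self_le_toNat (k - a + 1); omega) hk
  intro m
  induction m with
  | zero =>
    intro k hk _
    rw [ha k (by simpa using hk), map_zero, Finsupp.zero_apply]
  | succ m ih =>
    intro k hk hkT
    rcases (show k < a + m ∨ k = a + m by push_cast at hk; omega) with h | h
    · exact ih k h hkT
    have h1 := hT k hkT
    rw [map_add, coeff_loopDeriv, coeff_lie hX ha, map_add, map_smul, map_sum, Finsupp.add_apply,
      Finsupp.smul_apply, ih _ (by omega) (by omega), smul_zero, add_zero, Finsupp.coe_finsetSum,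
      Finset.sum_apply, Finset.sum_eq_single (-n : ℤ), F.repr_lie_of_mem (hXH _),
      show k - n - -n = k by ring] at h1
    · exact (mul_eq_zero.mp h1).resolve_left hi
    · intro r hr hr'
      rw [Finset.mem_Icc] at hr
      rw [F.repr_lie_of_mem (hXH _), ih _ (by omega) (by omega), mul_zero]
    · intro h2
      rw [Finset.mem_Icc] at h2
      omega

/-- The Killing form is nondegenerate on `H`, since `H` is orthogonal to the root spaces. -/
lemma proj_eq_zero_of_killing (F : Frame Δ) {x : 𝔤} (hx : ∀ y ∈ H, killingForm ℂ 𝔤 x y = 0) :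
    F.proj x = 0 := by
  have hnd := LieAlgebra.IsKilling.killingForm_nondegenerate (R := ℂ) (L := 𝔤)
  refine hnd.1 _ fun z => ?_
  rw [← F.killing_proj (F.proj_mem x), LieModule.traceForm_comm, F.killing_proj (F.proj_mem z),
    LieModule.traceForm_comm]
  exact hx _ (F.proj_mem z)

lemma isNormalForm_of_mem (F : Frame Δ) (hn : 1 ≤ n) {X : Loop 𝔤} (hX : X ∈ O (-n : ℤ))
    (hXH : ∀ k, coeff k X ∈ H) (hXn : ∀ k : ℤ, (n : ℤ) - 2 < k → coeff k X = 0)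
    (hreg : ∀ i, F.ht i ≠ 0 → F.wt i (coeff (-n) X) ≠ 0) :
    ∃ h : X ∈ connB Δ n, IsNormalForm Δ n ⟨X, h⟩ :=
  ⟨(F.mem_connB_iff hn).mpr ⟨⟨hX, fun k _ => F.H_le_V le_rfl (hXH k)⟩, hreg⟩, hXH, hXn⟩

end Frame

lemma IsNormalForm.add_mono {A : connB Δ n} (hA : IsNormalForm Δ n A) (F : Frame Δ) (hn : 1 ≤ n)
    {j : ℤ} (hj : -n ≤ j) (hj' : j ≤ n - 2) {y : 𝔤} (hy : y ∈ H)
    (hreg : ∀ i, F.ht i ≠ 0 → F.wt i (coeff (-n) (A.1 + mono j y)) ≠ 0) :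
    ∃ h : A.1 + mono j y ∈ connB Δ n, IsNormalForm Δ n ⟨_, h⟩ := by
  refine F.isNormalForm_of_mem hn (add_mem A.2.1.1 (mono_mem_O hj y)) (fun k => ?_) (fun k hk => ?_)
    hreg
  · rw [map_add, coeff_mono]
    refine add_mem (hA.1 k) ?_
    split_ifs
    · exact hy
    · exact H.zero_mem
  · rw [map_add, coeff_mono, hA.2 k hk, if_neg (by omega), add_zero]

lemma IsNormalForm.lie_mono {A : connB Δ n} (hA : IsNormalForm Δ n A) (j : ℤ) {y : 𝔤} (hy : y ∈ H) :
    ⁅mono j y, A.1⁆ = 0 := loop_ext fun k => by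
  rw [coeff_mono_lie, Frame.lie_eq_zero_of_mem hy (hA.1 _), map_zero]

end NormalFormLifts

/-! ### Differentials of the coordinates of the normal form -/

section Leaves

open Topology

variable {N : ℕ} {G : Subgroup (GL (Fin N) ℂ)} [LieAlgebra.IsSemisimple ℂ (lieAlg G)]
  {H : LieSubalgebra ℂ (lieAlg G)} [H.IsCartanSubalgebra] {Δ : (rootSystem H).Base} {n : ℕ}
  {f : ConnQuot G Δ n → ℂ} {A : connB Δ n}

/-- The differentials of linear functions of the coefficients of the normal form. -/
lemma isLiftedDifferential_coeff (F : Frame Δ) (hn : 2 ≤ n) (hf : IsRegularFun f) {j : ℤ}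
    (hj : -n ≤ j) (hj' : j ≤ n - 2) {w : lieAlg G} (hw : w ∈ H)
    (hfw : ∀ A : connB Δ n, IsNormalForm Δ n A →
      f (.mk A) = killingForm ℂ (lieAlg G) w (coeff j A.1))
    (hA : IsNormalForm Δ n A) : IsLiftedDifferential f A (mono (-1 - j) w) := by
  obtain ⟨ξ, hξ⟩ := exists_isCurveDifferential hf A
  replace hξ := hξ.isLiftedDifferential F (by omega)
  have hA' := (F.mem_connB_iff (by omega)).mp A.2
  have hham := hξ.hamiltonian_mem F (by omega) hf
  -- At a normal form the hamiltonian direction splits into root components. Its membership in `F.L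
  -- n (-n) 0` bounds the order of `ξ` below by `n` on negative and by `0` on positive root spaces.
  have hroot : ∀ i, F.ht i ≠ 0 → ∀ k < (if F.ht i < 0 then (n : ℤ) else 0),
      F.b.repr (coeff k ξ) i = 0 := by
    intro i hi
    refine F.repr_coeff_eq_zero hn hA'.1.1 hA.1 (hA'.2 i hi) fun k hk => ?_
    split_ifs at hk with h
    · exact hham.2 _ (by omega) i h
    · rw [hham.1 _ (by omega), map_zero, Finsupp.zero_apply]
  have htest : ∀ i : ℤ, -n ≤ i → ∀ y ∈ H, resPairing ξ (mono i y) =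
      killingForm ℂ (lieAlg G) w (coeff j (mono i y)) := by
    intro i hi y hy
    by_cases hi' : i ≤ n - 2
    · have hv : mono i y ∈ polarBorel Δ n := by
        rw [Frame.mem_polarBorel (F := F)]
        exact Frame.L_mono hi le_rfl (Frame.mono_mem_L (F.H_le_V le_rfl hy) i)
      refine (hξ _ hv).unique ?_
      have h1 := hasLoopDerivAt_line A.1 (mono i y) j (killingForm ℂ (lieAlg G) w)
      refine h1.congr_of_eventuallyEq ?_
      filter_upwards [F.eventually_mem_connB (by omega) A hv] with t ht
      rw [pullback_of_mem f ht]
      refine hfw ⟨_, ht⟩ ?_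
      have h2 : t • mono i y = mono i (t • y) := by rw [map_smul]
      have h3 : A.1 + mono i (t • y) ∈ connB Δ n := by rwa [← h2]
      obtain ⟨_, h4⟩ := hA.add_mono F (by omega) hi hi' (H.smul_mem t hy)
        ((F.mem_connB_iff (by omega)).mp h3).2
      simp only [h2]
      exact h4
    -- Beyond z^(n-2) the direction y z^i is, up to a scalar, the gauge direction of y z^(i+1),
    -- which belongs to the group because `i + 1 ≥ n`. So `ξ` annihilates it.
    · have hi0 : (i : ℂ) + 1 ≠ 0 := by exact_mod_cast (by omega : i + 1 ≠ 0)
      have h1 : mono (i + 1) y ∈ F.L n 0 1 := Frame.O_le_L' (mono_mem_O (by omega) y)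
      have h2 := hξ.resPairing_eq_zero F (by omega) hf h1
      have h0 : resPairing ξ 0 = 0 := (resForm ξ).map_zero
      rw [hA.lie_mono _ hy, loopDeriv_mono, add_sub_cancel_right, resPairing_sub_right, h0,
        resPairing_smul_right, zero_sub, neg_eq_zero] at h2
      push_cast at h2
      rw [(mul_eq_zero.mp h2).resolve_left hi0, coeff_mono, if_neg (by omega), map_zero]
  have hH : ∀ k < (n : ℤ), F.proj (coeff k (ξ - mono (-1 - j) w)) = 0 := by
    intro k hk
    refine F.proj_eq_zero_of_killing fun y hy => ?_
    have h1 := htest (-1 - k) (by omega) y hy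
    rw [resPairing_comm, resPairing_mono, sub_sub_cancel, coeff_mono] at h1
    rw [coeff_sub, map_sub, LinearMap.sub_apply, coeff_mono, LieModule.traceForm_comm, h1, sub_eq_zero]
    by_cases h : j = -1 - k
    · rw [if_pos h, if_pos (by omega)]
    · rw [if_neg h, if_neg (by omega), map_zero, map_zero, LinearMap.zero_apply]
  have hw0 : ∀ i, F.ht i ≠ 0 → ∀ k, F.b.repr (coeff k (mono (-1 - j) w)) i = 0 := by
    intro i hi k
    rw [coeff_mono]
    split_ifs
    · exact (F.mem_H_iff w).mp hw i hi
    · rw [map_zero, Finsupp.zero_apply]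
  have hD0 : ∀ i, F.ht i = 0 → ∀ k < (n : ℤ), F.b.repr (coeff k (ξ - mono (-1 - j) w)) i = 0 := by
    intro i hi k hk
    have := F.repr_proj (coeff k (ξ - mono (-1 - j) w)) i
    rwa [hH k hk, map_zero, Finsupp.zero_apply, if_pos hi, eq_comm] at this
  -- The monomial differs from a genuine lift by an element of the Lie algebra of the group, which
  -- annihilates all tangent vectors.
  have hD : ξ - mono (-1 - j) w ∈ F.L n 0 1 := by
    refine ⟨fun k hk => F.b.ext_elem fun i => ?_, fun k hk i hi => ?_⟩
    · rw [map_zero, Finsupp.zero_apply]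
      by_cases h : F.ht i = 0
      · exact hD0 i h k (by omega)
      · rw [coeff_sub, map_sub, Finsupp.sub_apply, hw0 i h, sub_zero]
        exact hroot i h k (by split_ifs <;> omega)
    · by_cases h : F.ht i = 0
      · exact hD0 i h k (by omega)
      · rw [coeff_sub, map_sub, Finsupp.sub_apply, hw0 i h, sub_zero]
        exact hroot i h k (by rw [if_pos (by omega)]; omega)
  intro v hv
  have h1 := Frame.resPairing_eq_zero_of_mem_L hD (Frame.mem_polarBorel.mp hv)
  rw [resPairing_sub_left, sub_eq_zero] at h1
  rw [← h1]
  exact hξ v hv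

end Leaves

/-! ### Hamiltonian flows on normal forms and the symplectic leaves -/

section HamiltonianFlows

open Topology

variable {N : ℕ} {G : Subgroup (GL (Fin N) ℂ)} [LieAlgebra.IsSemisimple ℂ (lieAlg G)]
  {H : LieSubalgebra ℂ (lieAlg G)} [H.IsCartanSubalgebra] {Δ : (rootSystem H).Base} {n : ℕ}
  {A A' : connB Δ n}

variable (G Δ n) in
/-- The normal form as a regular map from the quotient to `Conn_n^B`. -/
structure NormalFormMap where
  toFun : ConnQuot G Δ n → connB Δ n
  isNormalForm : ∀ p, IsNormalForm Δ n (toFun p)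
  mk_toFun : ∀ p, ConnQuot.mk (toFun p) = p
  toFun_mk : ∀ A, IsNormalForm Δ n A → toFun (.mk A) = A
  isRegularFun : ∀ (m : ℤ) (l : Dual ℂ (lieAlg G)), IsRegularFun fun p => l (coeff m (toFun p).1)

lemma nonempty_normalFormMap (F : Frame Δ) (hn : 2 ≤ n) : Nonempty (NormalFormMap G Δ n) :=
  let ⟨ν, h1, h2, h3, h4⟩ := exists_normalForm_map G F hn
  ⟨ν, h1, h2, h3, h4⟩

lemma IsNormalForm.lie_mono_right (hA : IsNormalForm Δ n A) (j : ℤ) {y : lieAlg G} (hy : y ∈ H) :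
    ⁅A.1, mono j y⁆ = 0 := by
  rw [← loop_lie_skew, hA.lie_mono j hy]
  abel

lemma NormalFormMap.isLiftedDifferential (ν : NormalFormMap G Δ n) (F : Frame Δ) (hn : 2 ≤ n) {j : ℤ}
    (hj : -n ≤ j) (hj' : j ≤ n - 2) {w : lieAlg G} (hw : w ∈ H) (hA : IsNormalForm Δ n A) :
    IsLiftedDifferential (fun p => killingForm ℂ (lieAlg G) w (coeff j (ν.toFun p).1)) A
      (mono (-1 - j) w) :=
  isLiftedDifferential_coeff F hn (ν.isRegularFun j _) hj hj' hw
    (fun A hA => by rw [ν.toFun_mk A hA]) hA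

/-- The residue is a Casimir function. -/
lemma FlowsTo.coeff_eq (ν : NormalFormMap G Δ n) (F : Frame Δ) (hn : 2 ≤ n) {p q : ConnQuot G Δ n}
    (hpq : FlowsTo p q) : coeff (-1) (ν.toFun p).1 = coeff (-1) (ν.toFun q).1 := by
  obtain ⟨h, γ, hh, hγ, rfl, rfl⟩ := hpq
  have key : ∀ w ∈ H, killingForm ℂ (lieAlg G) w (coeff (-1) (ν.toFun (γ 1)).1) -
      killingForm ℂ (lieAlg G) w (coeff (-1) (ν.toFun (γ 0)).1) = 0 := by
    intro w hw
    obtain ⟨k, hk, hd⟩ := hγ _ (ν.isRegularFun (-1) (killingForm ℂ (lieAlg G) w))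
    -- The lift for `j = -1` is the constant loop `w` in `H`. It commutes with the normal form and
    -- has derivative zero.
    have hk0 : ∀ p, k p = 0 := by
      intro p
      obtain ⟨η, hη⟩ := exists_isCurveDifferential hh (ν.toFun p)
      have h1 := ν.isLiftedDifferential F hn (j := -1) (by omega) (by omega) hw (ν.isNormalForm p)
      rw [← ν.mk_toFun p, hk.2 _ _ _ h1 (hη.isLiftedDifferential F (by omega)), poissonTensor_eq,
        (ν.isNormalForm p).lie_mono_right _ hw, loopDeriv_mono, resPairing_add_left,
        resPairing_smul_left]
      have h0 : resPairing 0 η = 0 := (resForm.flip η).map_zero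
      rw [h0]
      simp
    have h2 := Convex.norm_image_sub_le_of_norm_hasDerivWithin_le (C := 0) hd
      (fun t _ => by rw [hk0, norm_zero]) (convex_Icc 0 1) (Set.left_mem_Icc.mpr zero_le_one)
      (Set.right_mem_Icc.mpr zero_le_one)
    rw [zero_mul] at h2
    exact norm_le_zero_iff.mp h2
  rw [eq_comm, ← sub_eq_zero, ← F.proj_of_mem (sub_mem ((ν.isNormalForm (γ 1)).1 (-1))
    ((ν.isNormalForm (γ 0)).1 (-1)))]
  refine F.proj_eq_zero_of_killing fun w hw => ?_
  rw [LieModule.traceForm_comm, map_sub, key w hw]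

/-- A coefficient of the normal form, other than the residue, moves linearly along the hamiltonian
flow of the dual coefficient. -/
lemma flowsTo_add_mono (ν : NormalFormMap G Δ n) (F : Frame Δ) (hn : 2 ≤ n)
    (hA : IsNormalForm Δ n A) {j : ℤ} (hj : -n ≤ j) (hj' : j ≤ n - 2) (hj1 : j ≠ -1)
    {y : lieAlg G} (hy : y ∈ H)
    (hreg : ∀ s ∈ Set.Icc (0 : ℝ) 1, ∀ i, F.ht i ≠ 0 →
      F.wt i (coeff (-n) (A.1 + mono j ((s : ℂ) • y))) ≠ 0)
    (hA' : A'.1 = A.1 + mono j y) : FlowsTo (ConnQuot.mk A : ConnQuot G Δ n) (.mk A') := by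
  have hc : (j : ℂ) + 1 ≠ 0 := by exact_mod_cast (by omega : j + 1 ≠ 0)
  have hw : -((j : ℂ) + 1)⁻¹ • y ∈ H := H.smul_mem _ hy
  have hmem : ∀ s ∈ Set.Icc (0 : ℝ) 1, ∃ h : A.1 + mono j ((s : ℂ) • y) ∈ connB Δ n,
      IsNormalForm Δ n ⟨_, h⟩ := fun s hs =>
    hA.add_mono F (by omega) hj hj' (H.smul_mem _ hy) (hreg s hs)
  have hline : ∀ s t : ℝ, A.1 + mono j ((s : ℂ) • y) =
      A.1 + mono j ((t : ℂ) • y) + ((s : ℂ) - t) • mono j y := by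
    intro s t
    rw [← map_smul, sub_smul, map_sub]
    abel
  classical
  let γ : ℝ → ConnQuot G Δ n := fun s =>
    if h : A.1 + mono j ((s : ℂ) • y) ∈ connB Δ n then .mk ⟨_, h⟩ else .mk A
  have hγ : ∀ (s : ℝ) (h : A.1 + mono j ((s : ℂ) • y) ∈ connB Δ n), γ s = .mk ⟨_, h⟩ := fun s h =>
    dif_pos h
  -- The lift of this hamiltonian is w z^(j+1) with `w = -(j+1)⁻¹ y`; the scalar makes y z^j the
  -- velocity. The involution `j ↦ -2 - j` preserves the range from `-n` to `n - 2`.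
  have hh := ν.isRegularFun (-2 - j) (killingForm ℂ (lieAlg G) (-((j : ℂ) + 1)⁻¹ • y))
  refine ⟨_, γ, hh, fun f hf => ?_, ?_, ?_⟩
  · obtain ⟨k, hk, -⟩ := existsUnique_isPoissonBracket F (by omega) hf hh
    refine ⟨k, hk, fun t ht => ?_⟩
    obtain ⟨ht1, ht2⟩ := hmem t ht
    obtain ⟨ξ, hξ⟩ := exists_isCurveDifferential hf ⟨_, ht1⟩
    replace hξ := hξ.isLiftedDifferential F (by omega)
    have hη := ν.isLiftedDifferential F hn (j := -2 - j) (by omega) (by omega) hw ht2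
    have hkt : k (γ t) = resPairing ξ (mono j y) := by
      rw [hγ t ht1, hk.2 _ _ _ hξ hη, poissonTensor_antisymm, poissonTensor_eq,
        ht2.lie_mono_right _ hw, loopDeriv_mono, resPairing_add_left, resPairing_smul_left,
        show -1 - (-2 - j) = j + 1 by ring, add_sub_cancel_right, map_smul, resPairing_smul_left,
        resPairing_comm ξ]
      have h0 : resPairing 0 ξ = 0 := (resForm.flip ξ).map_zero
      rw [h0]
      push_cast
      field_simp
      ring
    rw [hkt]
    have hv : mono j y ∈ polarBorel Δ n := by
      rw [Frame.mem_polarBorel (F := F)]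
      exact Frame.L_mono hj le_rfl (Frame.mono_mem_L (F.H_le_V le_rfl hy) j)
    have h1 := hξ _ hv
    rw [← sub_self (t : ℂ)] at h1
    refine (h1.comp_sub_const _ _).comp_ofReal.hasDerivWithinAt.congr (fun s hs => ?_) ?_
    · obtain ⟨hs1, -⟩ := hmem s hs
      rw [hγ s hs1, ← pullback_of_mem f hs1, hline s t]
    · rw [hγ t ht1, ← pullback_of_mem f ht1, ← hline t t]
  · have h0 : A.1 + mono j (((0 : ℝ) : ℂ) • y) = A.1 := by
      rw [Complex.ofReal_zero, zero_smul, map_zero, add_zero]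
    rw [hγ 0 (by rw [h0]; exact A.2)]
    exact congrArg _ (Subtype.ext h0)
  · have h1 : A.1 + mono j (((1 : ℝ) : ℂ) • y) = A'.1 := by
      rw [Complex.ofReal_one, one_smul, hA']
    rw [hγ 1 (by rw [h1]; exact A'.2)]
    exact congrArg _ (Subtype.ext h1)

/-- Segments towards a suitable point avoid the origin. -/
lemma exists_segment_ne_zero {ι : Type*} [Finite ι] (u : ι → ℂ) :
    ∃ τ : ℂ, ∀ i, u i ≠ 0 → ∀ s : ℝ, (1 - s) * u i + s * τ ≠ 0 := by
  -- A segment from `u i` to `τ = 1 + t i` through 0 would make the two real multiples of each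
  -- other. This is excluded by a slope `t` different from the finitely many slopes of the `u i`.
  obtain ⟨t, ht⟩ := (Set.finite_range fun i => (u i).im / (u i).re).exists_notMem
  refine ⟨⟨1, t⟩, fun i hi s h => ht ⟨i, ?_⟩⟩
  have h1 := congrArg Complex.re h
  have h2 := congrArg Complex.im h
  simp at h1 h2
  have hs : s ≠ 0 := by
    rintro rfl
    simp at h
    exact hi h
  have h3 : 1 - s ≠ 0 := by
    intro h3
    rw [h3] at h1
    simp at h1
    exact hs h1
  have h4 : (u i).re ≠ 0 := by
    intro h4
    rw [h4] at h1
    simp at h1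
    exact hs h1
  have h5 : (1 - s) * ((u i).re * t - (u i).im) = 0 := by linear_combination t * h1 - h2
  rw [div_eq_iff h4]
  linear_combination -((mul_eq_zero.mp h5).resolve_left h3)

/-- A straight path between the two leading coefficients may hit a root hyperplane. Both are
therefore moved to the same point `τ • rho`. After division by `ht i`, every weight moves along a
segment that ends in the same `τ`, and `τ` is chosen such that none of these segments meets 0. -/
lemma eqvGen_of_lead (ν : NormalFormMap G Δ n) (F : Frame Δ) (hn : 2 ≤ n)
    (hA : IsNormalForm Δ n A) (hA' : IsNormalForm Δ n A') {y : lieAlg G}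
    (h : A'.1 = A.1 + mono (-n) y) :
    Relation.EqvGen FlowsTo (ConnQuot.mk A : ConnQuot G Δ n) (.mk A') := by
  let u : connB Δ n → Fin (finrank ℂ (lieAlg G)) → ℂ :=
    fun B i => F.wt i (coeff (-n) B.1) / F.ht i
  obtain ⟨τ, hτ⟩ := exists_segment_ne_zero (Sum.elim (u A) (u A'))
  have hreg : ∀ B : connB Δ n, (∀ i, u B i ≠ 0 → ∀ s : ℝ, (1 - s) * u B i + s * τ ≠ 0) →
      ∀ s : ℝ, ∀ i, F.ht i ≠ 0 →
        F.wt i (coeff (-n) (B.1 + mono (-n) ((s : ℂ) • (τ • F.rho - coeff (-n) B.1)))) ≠ 0 := by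
    intro B hB s i hi
    have hi' : (F.ht i : ℂ) ≠ 0 := Int.cast_ne_zero.mpr hi
    have h1 := hB i (div_ne_zero (((F.mem_connB_iff (by omega)).mp B.2).2 i hi) hi') s
    have h2 : F.wt i (coeff (-n) (B.1 + mono (-n) ((s : ℂ) • (τ • F.rho - coeff (-n) B.1)))) =
        F.ht i * ((1 - s) * u B i + s * τ) := by
      rw [map_add, coeff_mono, if_pos rfl, map_add, map_smul, map_sub, map_smul, F.wt_rho]
      simp only [u, smul_eq_mul]
      field_simp
      ring
    rw [h2]
    exact mul_ne_zero hi' h1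
  have hflow : ∀ B : connB Δ n, IsNormalForm Δ n B →
      (∀ i, u B i ≠ 0 → ∀ s : ℝ, (1 - s) * u B i + s * τ ≠ 0) → ∀ C : connB Δ n,
      C.1 = B.1 + mono (-n) (τ • F.rho - coeff (-n) B.1) →
      FlowsTo (ConnQuot.mk B : ConnQuot G Δ n) (.mk C) := fun B hB hBu C hC =>
    flowsTo_add_mono ν F hn hB le_rfl (by omega) (by omega)
      (sub_mem (H.smul_mem _ F.rho_mem) (hB.1 _)) (fun s _ => hreg B hBu s) hC
  have h1 := hreg A (fun i => hτ (.inl i)) 1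
  rw [Complex.ofReal_one, one_smul] at h1
  obtain ⟨hC, -⟩ := hA.add_mono F (by omega) (le_refl (-n : ℤ)) (by omega)
    (sub_mem (H.smul_mem τ F.rho_mem) (hA.1 (-n))) h1
  refine .trans _ _ _ (.rel _ _ (hflow A hA (fun i => hτ (.inl i)) ⟨_, hC⟩ rfl))
    (.symm _ _ (.rel _ _ (hflow A' hA' (fun i => hτ (.inr i)) ⟨_, hC⟩ ?_)))
  have h2 : coeff (-n) A'.1 = coeff (-n) A.1 + y := by rw [h, map_add, coeff_mono, if_pos rfl]
  show A.1 + mono (-n) (τ • F.rho - coeff (-n) A.1) = _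
  rw [h2, h, map_sub, map_sub, map_add]
  abel

lemma eqvGen_of_add_mono (ν : NormalFormMap G Δ n) (F : Frame Δ) (hn : 2 ≤ n)
    (hA : IsNormalForm Δ n A) (hA' : IsNormalForm Δ n A') {j : ℤ} (hj : -n ≤ j) (hj' : j ≤ n - 2)
    (hj1 : j ≠ -1) {y : lieAlg G} (hy : y ∈ H) (h : A'.1 = A.1 + mono j y) :
    Relation.EqvGen FlowsTo (ConnQuot.mk A : ConnQuot G Δ n) (.mk A') := by
  rcases eq_or_ne j (-n) with rfl | hjn
  · exact eqvGen_of_lead ν F hn hA hA' h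
  · refine .rel _ _ (flowsTo_add_mono ν F hn hA hj hj' hj1 hy (fun s _ i hi => ?_) h)
    rw [map_add, coeff_mono, if_neg hjn.symm, add_zero]
    exact ((F.mem_connB_iff (by omega)).mp A.2).2 i hi

/-- The coefficients are replaced one at a time, `s` bounding the set of those that still differ.
The leading coefficient is always that of `A` or of `A'`, so all intermediate points are normal
forms. -/
lemma eqvGen_of_coeff_eq (ν : NormalFormMap G Δ n) (F : Frame Δ) (hn : 2 ≤ n)
    (hA' : IsNormalForm Δ n A') (s : Finset ℤ) :
    ∀ A : connB Δ n, IsNormalForm Δ n A → (∀ k ∉ s, coeff k A.1 = coeff k A'.1) →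
      coeff (-1) A.1 = coeff (-1) A'.1 →
      Relation.EqvGen FlowsTo (ConnQuot.mk A : ConnQuot G Δ n) (.mk A') := by
  induction s using Finset.induction_on with
  | empty =>
    intro A _ h _
    have : A = A' := Subtype.ext (loop_ext fun k => h k (by simp))
    rw [this]
    exact .refl _
  | insert a s _ ih =>
    intro A hA h h1
    by_cases ha : coeff a A.1 = coeff a A'.1
    · refine ih A hA (fun k hk => ?_) h1
      by_cases hka : k = a
      · rw [hka, ha]
      · exact h k (by simp [hka, hk])
    have ha1 : a ≠ -1 := by
      rintro rfl
      exact ha h1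
    have ha2 : -n ≤ a := by
      by_contra h2
      exact ha (by rw [A.2.1.1 a (by omega), A'.2.1.1 a (by omega)])
    have ha3 : a ≤ n - 2 := by
      by_contra h2
      exact ha (by rw [hA.2 a (by omega), hA'.2 a (by omega)])
    have hy : coeff a A'.1 - coeff a A.1 ∈ H := sub_mem (hA'.1 a) (hA.1 a)
    have hB : ∀ k, coeff k (A.1 + mono a (coeff a A'.1 - coeff a A.1)) =
        if k = a then coeff k A'.1 else coeff k A.1 := by
      intro k
      rw [map_add, coeff_mono]
      split_ifs with hk
      · rw [hk, add_sub_cancel]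
      · rw [add_zero]
    obtain ⟨hB1, hB2⟩ := hA.add_mono F (by omega) ha2 ha3 hy fun i hi => by
      rw [hB]
      split_ifs
      · exact ((F.mem_connB_iff (by omega)).mp A'.2).2 i hi
      · exact ((F.mem_connB_iff (by omega)).mp A.2).2 i hi
    refine .trans _ _ _ (eqvGen_of_add_mono ν F hn hA hB2 ha2 ha3 ha1 hy rfl)
      (ih ⟨_, hB1⟩ hB2 (fun k hk => ?_) ?_)
    · show coeff k (A.1 + mono a (coeff a A'.1 - coeff a A.1)) = _
      rw [hB]
      split_ifs with hka
      · rfl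
      · exact h k (by simp [hka, hk])
    · show coeff (-1) (A.1 + mono a (coeff a A'.1 - coeff a A.1)) = _
      rw [hB, if_neg ha1.symm, h1]

lemma NormalFormMap.hasFormalResidue_iff (ν : NormalFormMap G Δ n) {p : ConnQuot G Δ n}
    {c : lieAlg G} : HasFormalResidue p c ↔ coeff (-1) (ν.toFun p).1 = c := by
  constructor
  · rintro ⟨A, hA, rfl, rfl⟩
    rw [ν.toFun_mk A hA]
  · exact fun h => ⟨_, ν.isNormalForm p, ν.mk_toFun p, h⟩

lemma NormalFormMap.eqvGen_iff (ν : NormalFormMap G Δ n) (F : Frame Δ) (hn : 2 ≤ n)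
    {p q : ConnQuot G Δ n} : Relation.EqvGen FlowsTo p q ↔
      coeff (-1) (ν.toFun p).1 = coeff (-1) (ν.toFun q).1 := by
  constructor
  · intro h
    induction h with
    | rel _ _ h => exact h.coeff_eq ν F hn
    | refl => rfl
    | symm _ _ _ ih => exact ih.symm
    | trans _ _ _ _ _ ih ih' => exact ih.trans ih'
  · intro h
    rw [← ν.mk_toFun p, ← ν.mk_toFun q]
    refine eqvGen_of_coeff_eq ν F hn (ν.isNormalForm q) (Finset.Icc (-n) (n - 2)) _
      (ν.isNormalForm p) (fun k hk => ?_) h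
    rw [Finset.mem_Icc, not_and_or, not_le, not_le] at hk
    rcases hk with hk | hk
    · rw [(ν.toFun p).2.1.1 k hk, (ν.toFun q).2.1.1 k hk]
    · rw [(ν.isNormalForm p).2 k hk, (ν.isNormalForm q).2 k hk]

/-- The connection with leading coefficient `rho` and residue `c` qualifies: `rho` is regular
because its weights are the heights. So no leaf is empty. -/
lemma NormalFormMap.exists_residue_eq (ν : NormalFormMap G Δ n) (F : Frame Δ) (hn : 2 ≤ n)
    {c : lieAlg G} (hc : c ∈ H) : ∃ p, coeff (-1) (ν.toFun p).1 = c := by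
  have hX : ∀ k : ℤ, coeff k (mono (-n) F.rho + mono (-1) c) =
      if k = -n then F.rho else if k = -1 then c else 0 := by
    intro k
    rw [map_add, coeff_mono, coeff_mono]
    split_ifs
    · omega
    · rw [add_zero]
    · rw [zero_add]
    · rw [zero_add]
  obtain ⟨h1, h2⟩ := F.isNormalForm_of_mem (n := n) (X := mono (-n) F.rho + mono (-1) c) (by omega)
    (fun k hk => by rw [hX, if_neg (by omega), if_neg (by omega)])
    (fun k => by
      rw [hX]
      split_ifs
      exacts [F.rho_mem, hc, H.zero_mem])
    (fun k hk => by rw [hX, if_neg (by omega), if_neg (by omega)])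
    (fun i hi => by
      rw [hX, if_pos rfl, F.wt_rho]
      exact Int.cast_ne_zero.mpr hi)
  refine ⟨.mk ⟨_, h1⟩, ?_⟩
  rw [ν.toFun_mk _ h2]
  show coeff (-1) (mono (-n) F.rho + mono (-1) c) = c
  rw [hX, if_neg (by omega), if_pos rfl]

lemma NormalFormMap.symplecticLeaves_eq (ν : NormalFormMap G Δ n) (F : Frame Δ) (hn : 2 ≤ n) :
    symplecticLeaves G Δ n = {S | ∃ c ∈ H, S = {p | HasFormalResidue p c}} := by
  have hleaf : ∀ q : ConnQuot G Δ n, {p | Relation.EqvGen FlowsTo p q} =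
      {p | HasFormalResidue p (coeff (-1) (ν.toFun q).1)} := fun q =>
    Set.ext fun p => (ν.eqvGen_iff F hn).trans ν.hasFormalResidue_iff.symm
  ext S
  constructor
  · rintro ⟨q, rfl⟩
    exact ⟨_, (ν.isNormalForm q).1 (-1), hleaf q⟩
  · rintro ⟨c, hc, rfl⟩
    obtain ⟨q, rfl⟩ := ν.exists_residue_eq F hn hc
    exact ⟨q, (hleaf q).symm⟩

end HamiltonianFlows

end FormalConn

end

open FormalConn in
theorem mainTheorem8 {N : ℕ} (G : Subgroup (GL (Fin N) ℂ))
    (hG : IsZariskiClosed (G : Set (GL (Fin N) ℂ)))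
    (hG' : IsZariskiConnected (G : Set (GL (Fin N) ℂ)))
    [LieAlgebra.IsSemisimple ℂ (lieAlg G)]
    (H : LieSubalgebra ℂ (lieAlg G)) [H.IsCartanSubalgebra]
    (Δ : (LieAlgebra.IsKilling.rootSystem H).Base) (n : ℕ) (hn : 2 ≤ n) :
    (∀ p : ConnQuot G Δ n, ∃! A : connB Δ n, IsNormalForm Δ n A ∧ ConnQuot.mk A = p) ∧
    (∀ f g : ConnQuot G Δ n → ℂ, IsRegularFun f → IsRegularFun g →
      ∃! k, IsPoissonBracket f g k) ∧
    symplecticLeaves G Δ n = {S | ∃ c ∈ H, S = {p | HasFormalResidue p c}} := by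
  obtain ⟨F⟩ := exists_frame Δ
  obtain ⟨ν⟩ := nonempty_normalFormMap (G := G) F hn
  refine ⟨fun p => ⟨ν.toFun p, ⟨ν.isNormalForm p, ν.mk_toFun p⟩, ?_⟩,
    fun f g hf hg => existsUnique_isPoissonBracket F (by omega) hf hg, ν.symplecticLeaves_eq F hn⟩
  rintro A ⟨hA, rfl⟩
  exact (ν.toFun_mk A hA).symm
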